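/- Let $k$ be a field and $G$ a finite abelian group. Write $\overline G=G\setminus\{1\}$, $g_{i,j}=(g_i,\dots,g_j)$, $C^n=\mathrm{Map}(\overline G^{\,n},kG)$ and $C_s=k[G\times\overline G^{\,s}]$ for $n,s\ge 0$; functions on $\overline G^{\,n}$ are extended by $0$ to tuples with an entry $1$, and a chain $(g_0,g_{1,s})$ with some $g_i=1$, $i\ge1$, is $0$. Let $\langle g,h\rangle=1$ if $gh=1$ and $0$ otherwise ($g,h\in G$). **The Tate–Hochschild cochain complex.** $\mathcal D^*=\mathcal D^*(kG,kG)$ is the graded space with $\mathcal D^n=C^n$ for $n\ge0$ and $\mathcal D^{-s-1}=C_s$ for $s\ge0$. It carries the following operations $m_p$ of degree $2-p$. * $m_1$ is $\delta$ on $C^n$, $(-1)^s\partial$ on $C_s$ for $s\ge1$, and $\tau(x)=\sum_{g\in G}gxg^{-1}$, $C_0\to C^0$, on $C_0$, where $\delta\varphi(g_{1,n+1})=g_1\varphi(g_{2,n+1})+\sum_{i=1}^n(-1)^i\varphi(\dots,g_ig_{i+1},\dots)+(-1)^{n+1}\varphi(g_{1,n})g_{n+1}$ and $\partial(g_0,g_{1,s})=(g_0g_1,g_{2,s})+\sum_{i=1}^{s-1}(-1)^i(g_0,\dots,g_ig_{i+1},\dots)+(-1)^s(g_sg_0,g_{1,s-1})$.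 * $m_2=\cup$: for $\varphi\in C^n$, $\psi\in C^m$, $\alpha=(g_0,g_{1,s})$, $\beta=(h_0,h_{1,t})$, $(\varphi\cup\psi)(l_{1,n+m})=\varphi(l_{1,n})\psi(l_{n+1,n+m})$; $\alpha\cup\beta=\sum_{g}(gh_0,h_{1,t},g^{-1}g_0,g_{1,s})$; $\varphi\cup\beta=(\varphi(h_{t-n+1,t})h_0,h_{1,t-n})$ if $n\le t$, and $(\varphi\cup\beta)(l_{1,n-t-1})=\sum_g\varphi(l_{1,n-t-1},g^{-1},h_{1,t})h_0g$ if $n>t$; $\alpha\cup\psi=(g_0\psi(g_{1,m}),g_{m+1,s})$ if $m\le s$, and $(\alpha\cup\psi)(l_{1,m-s-1})=\sum_g gg_0\psi(g_{1,s},g^{-1},l_{1,m-s-1})$ if $m>s$. * $m_3$ is zero except in the following two cases. For $\varphi\in C^m$, $\alpha=(g_0,g_{1,r})$, $\psi\in C^n$ with $r+2\le m+n$, $$m_3(\varphi,\alpha,\psi)(l_{1,m+n-r-2})=\sum_{g\in G}\sum_j(-1)^{m+r+j-1}\varphi(l_{1,m-r+j-2},g,g_{j,r})\,g_0\,\psi(g_{1,j-1},g^{-1},l_{m-r+j-1,m+n-r-2}),$$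 over $1\le j\le\min(n,r+1)$ with $m-r+j-2\ge0$. For $\alpha=(g_0,g_{1,r})$, $\varphi\in C^m$, $\beta=(h_0,h_{1,s})$ with $m\le r+s+1$, $$m_3(\alpha,\varphi,\beta)=\sum_{g\in G}\sum_j(-1)^{r+s+m-j}(g_0\varphi(g_{1,m-s+j-1},g,h_{j+1,s})h_0,\,h_{1,j},\,g^{-1},\,g_{m-s+j,r}),$$ over $0\le j\le s$ with $0\le m-s+j-1\le r$. * $m_p=0$ for $p>3$. The symmetric bilinear form on $\mathcal D^*$ is $\langle\varphi,(g_0,g_{1,s})\rangle=\langle\varphi(g_{1,s}),g_0\rangle$ for $\varphi\in C^s$, and $\langle\mathcal D^i,\mathcal D^j\rangle=0$ unless $i+j=-1$. **The Tate cochain complex.** $\widehat C^*=\widehat C^*(G,k)$ has $\widehat C^n=\mathrm{Map}(\overline G^{\,n},k)$ and $\widehat C^{-s-1}=k[\overline G^{\,s}]$ for $n,s\ge0$. Its differential $m_1$ is the group cohomology differential for $n\ge0$, $(-1)^s$ times the group homology differential on $k[\overline G^{\,s}]$ for $s\ge1$ (both with trivial coefficients), and multiplication by $|G|$ from degree $-1$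 to degree $0$. It embeds in $\mathcal D^*$ by the map $\iota$ sending $\varphi$ to $g_{1,n}\mapsto\varphi(g_{1,n})g_1\cdots g_n$ and $(g_{1,s})$ to $((g_1\cdots g_s)^{-1},g_{1,s})$; its products $m_p$, $p\ge2$, and its form are the restrictions of those of $\mathcal D^*$ along $\iota$. **The tensor product.** $kG\otimes\widehat C^*$ is graded by $(kG\otimes\widehat C^*)^n=kG\otimes\widehat C^n$ and has $$m'_p(g_1\otimes\alpha_1,\dots,g_p\otimes\alpha_p)=g_1\cdots g_p\otimes m_p(\alpha_1,\dots,\alpha_p),\qquad\langle g_1\otimes\alpha_1,g_2\otimes\alpha_2\rangle'=\langle g_1,g_2\rangle\langle\alpha_1,\alpha_2\rangle .$$ Call a graded space with operations $m_p$ ($p\ge1$) of degree $2-p$ and a symmetric nondegenerate bilinear form of degree $-1$ (in the above sense) a *cyclic $A_\infty$-algebra* if $\sum_{r+s+t=n,\ s\ge1}(-1)^{r+st}m_{r+1+t}(1^{\otimes r}\otimes m_s\otimes1^{\otimes t})=0$ for all $n\ge1$ (with Koszul signs) and $\langle\alpha_0,m_p(\alpha_1,\dots,\alpha_p)\rangle=(-1)^{|\alpha_0|(2-p)+p}\langle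 m_p(\alpha_0,\dots,\alpha_{p-1}),\alpha_p\rangle$ for all $p\ge1$ and all homogeneous $\alpha_0,\dots,\alpha_p$. **Claim.** $\mathcal D^*(kG,kG)$, $\widehat C^*(G,k)$ and $kG\otimes\widehat C^*(G,k)$ are cyclic $A_\infty$-algebras; $\iota$ is injective, commutes with all $m_p$ and preserves the forms, so that $\widehat C^*(G,k)$ is a cyclic $A_\infty$-subalgebra of $\mathcal D^*(kG,kG)$; and there is an isomorphism of cyclic $A_\infty$-algebras $$\mathcal D^*(kG,kG)\;\cong\;kG\otimes\widehat C^*(G,k),$$ that is, a degree-preserving linear bijection which commutes with all the products $m_p$ and preserves the bilinear forms. -/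

import Mathlib

open scoped DirectSum TensorProduct

noncomputable section

/-! ## Cyclic A-infinity-algebras over a field -/

/-- Operations `m p` (`p ≥ 1`) and a bilinear form on the total space of a `ℤ`-graded vector
space `V`; the value `m 0` plays no role. -/
structure AInfData (k : Type*) [Field k] (V : ℤ → Type*) [∀ i, AddCommGroup (V i)]
    [∀ i, Module k (V i)] where
  /-- the higher products -/
  m : (p : ℕ) → MultilinearMap k (fun _ : Fin p => ⨁ i, V i) (⨁ i, V i)
  /-- the bilinear form -/
  pair : (⨁ i, V i) →ₗ[k] (⨁ i, V i) →ₗ[k] k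

namespace AInfData

variable {k : Type*} [Field k] {V : ℤ → Type*} [∀ i, AddCommGroup (V i)] [∀ i, Module k (V i)]
  {W : ℤ → Type*} [∀ i, AddCommGroup (W i)] [∀ i, Module k (W i)]

/-- `A` is a cyclic A-infinity-algebra: `m p` has degree `2 - p`, the Stasheff identities
`∑_{r+s+t=n} (-1)^(r+st) m_{r+1+t} (1^{⊗r} ⊗ m_s ⊗ 1^{⊗t}) = 0` hold (evaluated on homogeneous
elements with the Koszul sign), and the form is symmetric, nondegenerate, of degree `-1`
(it vanishes on `V^i × V^j` unless `i + j = -1`) and cyclic: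
`⟨α₀, m_p(α₁, …, α_p)⟩ = (-1)^(|α₀|(2-p)+p) ⟨m_p(α₀, …, α_{p-1}), α_p⟩`.
Finite lists of homogeneous elements are written as initial segments of sequences. -/
structure IsCyclicAInfinity (A : AInfData k V) : Prop where
  degree : ∀ p : ℕ, 1 ≤ p → ∀ (d : Fin p → ℤ) (v : ∀ i, V (d i)),
    A.m p (fun i => DirectSum.lof k ℤ V (d i) (v i)) ∈
      LinearMap.range (DirectSum.lof k ℤ V ((∑ i, d i) + 2 - p))
  stasheff : ∀ n : ℕ, 1 ≤ n → ∀ (d : ℕ → ℤ) (v : ∀ i, V (d i)) (x : ℕ → ⨁ i, V i),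
    (∀ i, x i = DirectSum.lof k ℤ V (d i) (v i)) →
    ∑ s ∈ Finset.Icc 1 n, ∑ r ∈ Finset.range (n - s + 1),
      (((r : ℤ) + s * ((n : ℤ) - s - r)
          + (2 - (s : ℤ)) * ∑ i ∈ Finset.range r, d i).negOnePow) •
        A.m (n - s + 1) (fun i : Fin (n - s + 1) =>
          if (i : ℕ) < r then x i
          else if (i : ℕ) = r then A.m s (fun j : Fin s => x (r + j))
          else x (i + s - 1)) = 0
  pair_degree : ∀ (i j : ℤ) (v : V i) (w : V j), i + j ≠ -1 →
    A.pair (DirectSum.lof k ℤ V i v) (DirectSum.lof k ℤ V j w) = 0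
  pair_symm : ∀ x y, A.pair x y = A.pair y x
  pair_nondegenerate : A.pair.Nondegenerate
  cyclic : ∀ p : ℕ, 1 ≤ p → ∀ (d : ℕ → ℤ) (v : ∀ i, V (d i)) (x : ℕ → ⨁ i, V i),
    (∀ i, x i = DirectSum.lof k ℤ V (d i) (v i)) →
    A.pair (x 0) (A.m p (fun i => x (i + 1))) =
      ((d 0 * (2 - (p : ℤ)) + p).negOnePow) • A.pair (A.m p (fun i => x i)) (x p)

/-- A degree-preserving linear map commuting with all products and preserving the form. -/
structure IsStrictMorphism (A : AInfData k V) (B : AInfData k W)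
    (f : ∀ i, V i →ₗ[k] W i) : Prop where
  map_m : ∀ p : ℕ, 1 ≤ p → ∀ x : Fin p → ⨁ i, V i,
    DirectSum.lmap f (A.m p x) = B.m p (fun i => DirectSum.lmap f (x i))
  map_pair : ∀ x y, B.pair (DirectSum.lmap f x) (DirectSum.lmap f y) = A.pair x y

/-- A (strict) isomorphism of cyclic A-infinity-algebras. -/
structure CyclicIso (A : AInfData k V) (B : AInfData k W) where
  /-- the underlying graded linear isomorphism -/
  equiv : ∀ i, V i ≃ₗ[k] W i
  isStrictMorphism : A.IsStrictMorphism B (fun i => (equiv i).toLinearMap)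

end AInfData

/-! ## Multilinear maps on graded vector spaces -/

section Multilinear

variable {k : Type*} [Field k] {U T : Type*} [AddCommGroup U] [Module k U] [AddCommGroup T]
  [Module k T] {V : ℤ → Type*} [∀ i, AddCommGroup (V i)] [∀ i, Module k (V i)]

/-- The `p`-ary multilinear maps `x ↦ f₁ (x 0)`, `x ↦ f₂ (x 0) (x 1)`,
`x ↦ f₃ (x 0) (x 1) (x 2)` for `p = 1, 2, 3`, and `0` otherwise. -/
def upToTernary (f₁ : U →ₗ[k] T) (f₂ : U →ₗ[k] U →ₗ[k] T) (f₃ : U →ₗ[k] U →ₗ[k] U →ₗ[k] T) :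
    (p : ℕ) → MultilinearMap k (fun _ : Fin p => U) T
  | 1 => MultilinearMap.mk' (fun x => f₁ (x 0))
      (by intro x i a b; fin_cases i; simp) (by intro x i c a; fin_cases i; simp)
  | 2 => MultilinearMap.mk' (fun x => f₂ (x 0) (x 1))
      (by intro x i a b; fin_cases i <;> simp) (by intro x i c a; fin_cases i <;> simp)
  | 3 => MultilinearMap.mk' (fun x => f₃ (x 0) (x 1) (x 2))
      (by intro x i a b; fin_cases i <;> simp [Function.update])
      (by intro x i c a; fin_cases i <;> simp [Function.update])
  | _ => 0

/-- The linear map on a direct sum with given restrictions. -/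
def extend₁ (f : ∀ a, V a →ₗ[k] T) : (⨁ i, V i) →ₗ[k] T := DirectSum.toModule k ℤ T f

/-- The bilinear map on a direct sum with given restrictions. -/
def extend₂ (f : ∀ a b, V a →ₗ[k] V b →ₗ[k] T) : (⨁ i, V i) →ₗ[k] (⨁ i, V i) →ₗ[k] T :=
  extend₁ fun a => (extend₁ fun b => (f a b).flip).flip

/-- The trilinear map on a direct sum with given restrictions. -/
def extend₃ (f : ∀ a b c, V a →ₗ[k] V b →ₗ[k] V c →ₗ[k] T) :
    (⨁ i, V i) →ₗ[k] (⨁ i, V i) →ₗ[k] (⨁ i, V i) →ₗ[k] T :=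
  (LinearMap.lflip (R₀ := k)).comp (LinearMap.flip (extend₁ fun c =>
    ((LinearMap.lflip (R₀ := k)).comp (extend₂ fun a b => f a b c)).flip))

@[simp] lemma extend₁_lof (f : ∀ a, V a →ₗ[k] T) (a : ℤ) (x : V a) :
    extend₁ f (DirectSum.lof k ℤ V a x) = f a x := by
  simp [extend₁]

@[simp] lemma extend₂_lof (f : ∀ a b, V a →ₗ[k] V b →ₗ[k] T) (a b : ℤ) (x : V a) (y : V b) :
    extend₂ f (DirectSum.lof k ℤ V a x) (DirectSum.lof k ℤ V b y) = f a b x y := by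
  simp [extend₂]

@[simp] lemma extend₃_lof (f : ∀ a b c, V a →ₗ[k] V b →ₗ[k] V c →ₗ[k] T) (a b c : ℤ)
    (x : V a) (y : V b) (z : V c) :
    extend₃ f (DirectSum.lof k ℤ V a x) (DirectSum.lof k ℤ V b y) (DirectSum.lof k ℤ V c z) =
      f a b c x y z := by
  simp [extend₃]

/-- Extend a function of a basis element, linear in a parameter, to the free vector space. -/
def basisLift {k X U T : Type*} [Field k] [AddCommMonoid U] [Module k U] [AddCommMonoid T]
    [Module k T] (f : X → U →ₗ[k] T) : (X →₀ k) →ₗ[k] U →ₗ[k] T :=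
  Finsupp.linearCombination k f

end Multilinear

/-! ## Tuples of non-identity elements, and splicing of complexes -/

universe u

/-- The set `(G - {1})^n`. -/
def BarTuple (G : Type*) [One G] (n : ℕ) : Type _ :=
  {l : List G // l.length = n ∧ ∀ g ∈ l, g ≠ 1}

/-- `(g₁, …, g_{i-1}, g_i g_{i+1}, g_{i+2}, …, g_n)` (entries are numbered from `1`). -/
def contract {G : Type*} [Group G] (i : ℕ) (l : List G) : List G :=
  l.take (i - 1) ++ ((l.drop (i - 1)).take 2).prod :: l.drop (i + 1)

/-- `C^n` in degrees `n ≥ 0` and `H_s` in degrees `-s - 1 < 0`. -/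
def Spliced (C H : ℕ → Type u) : ℤ → Type u
  | .ofNat n => C n
  | .negSucc s => H s

section Spliced

variable {k : Type*} [Field k] {C H : ℕ → Type u} [∀ n, AddCommGroup (C n)]
  [∀ n, AddCommGroup (H n)]

instance : ∀ i, AddCommGroup (Spliced C H i)
  | .ofNat n => inferInstanceAs (AddCommGroup (C n))
  | .negSucc s => inferInstanceAs (AddCommGroup (H s))

variable [∀ n, Module k (C n)] [∀ n, Module k (H n)]

instance : ∀ i, Module k (Spliced C H i)
  | .ofNat n => inferInstanceAs (Module k (C n))
  | .negSucc s => inferInstanceAs (Module k (H s))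

variable (k C H) in
/-- The inclusion of `C^n` in the total space. -/
def inC (n : ℕ) : C n →ₗ[k] ⨁ i, Spliced C H i :=
  DirectSum.lof k ℤ (Spliced C H) (Int.ofNat n)

variable (k C H) in
/-- The inclusion of `H_s` in the total space. -/
def inH (s : ℕ) : H s →ₗ[k] ⨁ i, Spliced C H i :=
  DirectSum.lof k ℤ (Spliced C H) (Int.negSucc s)

/-- The differential on the total space with components `δ : C^n → C^(n+1)`,
`τ : H_0 → C^0` and `(-1)^s ∂` on `H_s`, `s ≥ 1`. -/
def splicedDifferential (δ : ∀ n, C n →ₗ[k] C (n + 1)) (τ : H 0 →ₗ[k] C 0)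
    (del : ∀ s, H (s + 1) →ₗ[k] H s) : (⨁ i, Spliced C H i) →ₗ[k] ⨁ i, Spliced C H i :=
  extend₁ (V := Spliced C H) fun
    | .ofNat n => inC k C H (n + 1) ∘ₗ δ n
    | .negSucc 0 => inC k C H 0 ∘ₗ τ
    | .negSucc (s + 1) => inH k C H s ∘ₗ ((-1 : k) ^ (s + 1) • del s)

end Spliced

section TateHochschild

open Classical in
/-- The value of `φ : (G - {1})^n → M` at a list of elements of `G`, extended by `0` to lists with
an entry `1` (normalization) and to lists of length different from `n`. -/
def evalAt (k : Type*) {G M : Type*} [Field k] [Group G] [AddCommGroup M] [Module k M] {n : ℕ}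
    (l : List G) : (BarTuple G n → M) →ₗ[k] M :=
  if h : l.length = n ∧ ∀ g ∈ l, g ≠ 1 then LinearMap.proj ⟨l, h⟩ else 0

variable (k G : Type*) [Field k] [Group G]

/-- Hochschild cochains `C^n(kG, kG) = Map((G - {1})^n, kG)`. -/
abbrev HochCochain (n : ℕ) : Type _ := BarTuple G n → MonoidAlgebra k G

/-- Hochschild chains `C_s(kG, kG) = k[G × (G - {1})^s]`. -/
abbrev HochChain (s : ℕ) : Type _ := (G × BarTuple G s) →₀ k

/-- The graded vector space `D^*(kG, kG)`, with `D^n = C^n(kG, kG)` and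
`D^(-s-1) = C_s(kG, kG)` for `n, s ≥ 0`. -/
abbrev TateHoch : ℤ → Type _ := Spliced (HochCochain k G) (HochChain k G)

variable {G}

/-- A group element as an element of `kG`. -/
abbrev gp (g : G) : MonoidAlgebra k G := MonoidAlgebra.single g 1

variable (G)

/-- The coefficient of `g` in an element of `kG`. -/
def coeffAt (g : G) : MonoidAlgebra k G →ₗ[k] k :=
  Finsupp.lapply g ∘ₗ (MonoidAlgebra.coeffLinearEquiv k).toLinearMap

/-- The symmetrizing form of `kG`: `⟨g, h⟩ = 1` if `gh = 1`, and `0` otherwise. -/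
def symmForm : MonoidAlgebra k G →ₗ[k] MonoidAlgebra k G →ₗ[k] k :=
  (LinearMap.mul k (MonoidAlgebra k G)).compr₂ (coeffAt k G 1)

variable {G}

open Classical in
/-- The chain `(a, g₁, …, g_s)` for `a ∈ kG`, linear in `a`; it is `0` if some `g_i` is `1`
(normalization) or if the list has length different from `s`. -/
def chainAt (s : ℕ) (l : List G) : MonoidAlgebra k G →ₗ[k] HochChain k G s :=
  if h : l.length = s ∧ ∀ g ∈ l, g ≠ 1 then
    Finsupp.lmapDomain k k (fun g => (g, (⟨l, h⟩ : BarTuple G s))) ∘ₗ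
      (MonoidAlgebra.coeffLinearEquiv k).toLinearMap
  else 0

variable (G)

/-! ### The differential -/

/-- The Hochschild cochain differential: `δ(φ)(g₁, …, g_{n+1})` is
`g₁ φ(g₂, …) + ∑_{i=1}^n (-1)^i φ(…, g_i g_{i+1}, …) + (-1)^(n+1) φ(g₁, …, g_n) g_{n+1}`. -/
def hochDelta (n : ℕ) : HochCochain k G n →ₗ[k] HochCochain k G (n + 1) where
  toFun φ l := gp k (l.1.take 1).prod * evalAt k (l.1.drop 1) φ
    + ∑ i ∈ Finset.Icc 1 n, (-1 : k) ^ i • evalAt k (contract i l.1) φ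
    + (-1 : k) ^ (n + 1) • (evalAt k (l.1.take n) φ * gp k (l.1.drop n).prod)
  map_add' φ ψ := by
    funext l
    simp only [map_add, mul_add, add_mul, smul_add, Finset.sum_add_distrib, Pi.add_apply]
    abel
  map_smul' c φ := by
    funext l
    simp only [map_smul, mul_smul_comm, smul_mul_assoc, smul_add, Finset.smul_sum,
      Pi.smul_apply, RingHom.id_apply, smul_comm c]

/-- The Hochschild chain differential: `∂(g₀, g₁, …, g_{s+1})` is
`(g₀ g₁, g₂, …) + ∑_{i=1}^s (-1)^i (g₀, …, g_i g_{i+1}, …) + (-1)^(s+1) (g_{s+1} g₀, g₁, …, g_s)`. -/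
def hochDel (s : ℕ) : HochChain k G (s + 1) →ₗ[k] HochChain k G s :=
  Finsupp.linearCombination k fun x =>
    chainAt k s (x.2.1.drop 1) (gp k x.1 * gp k (x.2.1.take 1).prod)
    + ∑ i ∈ Finset.Icc 1 s, (-1 : k) ^ i • chainAt k s (contract i x.2.1) (gp k x.1)
    + (-1 : k) ^ (s + 1) • chainAt k s (x.2.1.take s) (gp k (x.2.1.drop s).prod * gp k x.1)

variable [Fintype G]

/-- The trace map `τ : C_0 = kG → kG = C^0`, `x ↦ ∑ g x g⁻¹`. -/
def hochTrace : HochChain k G 0 →ₗ[k] HochCochain k G 0 :=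
  Finsupp.linearCombination k fun x _ => ∑ g : G, gp k g * gp k x.1 * gp k g⁻¹

/-! ### The generalized cup product

In the comments `α = (g₀, g₁, …, g_s)` and `β = (h₀, h₁, …, h_t)` are basis chains. -/

/-- Cup product of cochains: `(φ ∪ ψ)(l) = φ(l₁, …, l_n) ψ(l_{n+1}, …, l_{n+m})`. -/
def cupCC (n m : ℕ) : HochCochain k G n →ₗ[k] HochCochain k G m →ₗ[k] HochCochain k G (n + m) :=
  LinearMap.mk₂ k
    (fun φ ψ l => evalAt k (l.1.take n) φ * evalAt k (l.1.drop n) ψ)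
    (by intros; funext l; simp [add_mul]) (by intros; funext l; simp)
    (by intros; funext l; simp [mul_add]) (by intros; funext l; simp)

/-- Product of chains: `α ∪ β = ∑_g (g h₀, h₁, …, h_t, g⁻¹ g₀, g₁, …, g_s)`. -/
def cupHH (s t : ℕ) : HochChain k G s →ₗ[k] HochChain k G t →ₗ[k] HochChain k G (s + t + 1) :=
  basisLift fun x => Finsupp.linearCombination k fun y =>
    ∑ g : G, chainAt k (s + t + 1) (y.2.1 ++ (g⁻¹ * x.1) :: x.2.1) (gp k g * gp k y.1)

/-- Cap product, for `n ≤ t`: `φ ∪ β = (φ(h_{t-n+1}, …, h_t) h₀, h₁, …, h_{t-n})`. -/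
def capCH (n t : ℕ) : HochCochain k G n →ₗ[k] HochChain k G t →ₗ[k] HochChain k G (t - n) :=
  (basisLift fun y => chainAt k (t - n) (y.2.1.take (t - n)) ∘ₗ
    (LinearMap.mul k (MonoidAlgebra k G)).flip (gp k y.1) ∘ₗ
      evalAt k (y.2.1.drop (t - n))).flip

/-- Generalized cap product, for `t < n`:
`(φ ∪ β)(l₁, …, l_{n-t-1}) = ∑_g φ(l₁, …, l_{n-t-1}, g⁻¹, h₁, …, h_t) h₀ g`. -/
def gcapCH (n t : ℕ) :
    HochCochain k G n →ₗ[k] HochChain k G t →ₗ[k] HochCochain k G (n - t - 1) :=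
  (basisLift fun y => LinearMap.pi fun l => ∑ g : G,
    (LinearMap.mul k (MonoidAlgebra k G)).flip (gp k y.1 * gp k g) ∘ₗ
      evalAt k (l.1 ++ g⁻¹ :: y.2.1)).flip

/-- Cap product from the right, for `m ≤ s`:
`α ∪ ψ = (g₀ ψ(g₁, …, g_m), g_{m+1}, …, g_s)`. -/
def capHC (s m : ℕ) : HochChain k G s →ₗ[k] HochCochain k G m →ₗ[k] HochChain k G (s - m) :=
  basisLift fun x => chainAt k (s - m) (x.2.1.drop m) ∘ₗ
    LinearMap.mul k (MonoidAlgebra k G) (gp k x.1) ∘ₗ evalAt k (x.2.1.take m)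

/-- Generalized cap product from the right, for `s < m`:
`(α ∪ ψ)(l₁, …, l_{m-s-1}) = ∑_g g g₀ ψ(g₁, …, g_s, g⁻¹, l₁, …, l_{m-s-1})`. -/
def gcapHC (s m : ℕ) :
    HochChain k G s →ₗ[k] HochCochain k G m →ₗ[k] HochCochain k G (m - s - 1) :=
  basisLift fun x => LinearMap.pi fun l => ∑ g : G,
    LinearMap.mul k (MonoidAlgebra k G) (gp k g * gp k x.1) ∘ₗ
      evalAt k (x.2.1 ++ g⁻¹ :: l.1)

/-- The generalized cup product on homogeneous components. -/
def cupDeg : (a b : ℤ) →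
    TateHoch k G a →ₗ[k] TateHoch k G b →ₗ[k] ⨁ i, TateHoch k G i
  | .ofNat n, .ofNat m => (cupCC k G n m).compr₂ (inC k _ _ (n + m))
  | .negSucc s, .negSucc t => (cupHH k G s t).compr₂ (inH k _ _ (s + t + 1))
  | .ofNat n, .negSucc t =>
      if n ≤ t then (capCH k G n t).compr₂ (inH k _ _ (t - n))
      else (gcapCH k G n t).compr₂ (inC k _ _ (n - t - 1))
  | .negSucc s, .ofNat m =>
      if m ≤ s then (capHC k G s m).compr₂ (inH k _ _ (s - m))
      else (gcapHC k G s m).compr₂ (inC k _ _ (m - s - 1))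

/-! ### The ternary product -/

/-- For cochains `φ, ψ` of degrees `m, n` and a basis chain `(g₀, …, g_r)` with `r + 2 ≤ m + n`:
`m₃(φ, α, ψ)(l₁, …, l_{m+n-r-2}) = ∑_g ∑_j (-1)^(m+r+j-1)
  φ(l₁, …, l_{m-r+j-2}, g, g_j, …, g_r) g₀ ψ(g₁, …, g_{j-1}, g⁻¹, l_{m-r+j-1}, …)`,
where `j` runs over `1 ≤ j ≤ min(n, r+1)` with `m - r + j - 2 ≥ 0`. -/
def m3CHC (m r n : ℕ) : HochCochain k G m →ₗ[k] HochChain k G r →ₗ[k] HochCochain k G n →ₗ[k]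
    HochCochain k G (m + n - r - 2) :=
  (basisLift fun x => LinearMap.mk₂ k
    (fun φ ψ l => ∑ g : G, ∑ j ∈ Finset.Icc (max 1 (r + 2 - m)) (min n (r + 1)),
      (-1 : k) ^ (m + r + j - 1) •
        (evalAt k (l.1.take (m + j - r - 2) ++ g :: x.2.1.drop (j - 1)) φ * gp k x.1 *
          evalAt k (x.2.1.take (j - 1) ++ g⁻¹ :: l.1.drop (m + j - r - 2)) ψ))
    (by intros; funext l; simp [add_mul, Finset.sum_add_distrib])
    (by intro c φ ψ; funext l; simp [Finset.smul_sum, smul_comm c])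
    (by intros; funext l; simp [mul_add, Finset.sum_add_distrib])
    (by intro c φ ψ; funext l; simp [Finset.smul_sum, smul_comm c])).flip

/-- For basis chains `α = (g₀, …, g_r)`, `β = (h₀, …, h_s)` and a cochain `φ` of degree `m` with
`m ≤ r + s + 1`: `m₃(α, φ, β) = ∑_g ∑_j (-1)^(r+s+m-j)
  (g₀ φ(g₁, …, g_{m-s+j-1}, g, h_{j+1}, …, h_s) h₀, h₁, …, h_j, g⁻¹, g_{m-s+j}, …, g_r)`,
where `j` runs over `0 ≤ j ≤ s` with `0 ≤ m - s + j - 1 ≤ r`. -/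
def m3HCH (r m s : ℕ) : HochChain k G r →ₗ[k] HochCochain k G m →ₗ[k] HochChain k G s →ₗ[k]
    HochChain k G (r + s + 2 - m) :=
  basisLift fun x : G × BarTuple G r => (basisLift fun y : G × BarTuple G s =>
    ∑ g : G, ∑ j ∈ Finset.Icc (s + 1 - m) (min s (r + s + 1 - m)),
      (-1 : k) ^ (r + s + m - j) •
        (chainAt k (r + s + 2 - m) (y.2.1.take j ++ g⁻¹ :: x.2.1.drop (m + j - s - 1)) ∘ₗ
          (LinearMap.mul k (MonoidAlgebra k G)).flip (gp k y.1) ∘ₗ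
          LinearMap.mul k (MonoidAlgebra k G) (gp k x.1) ∘ₗ
          evalAt k (x.2.1.take (m + j - s - 1) ++ g :: y.2.1.drop j))).flip

/-- The ternary product on homogeneous components; it vanishes in the cases not listed. -/
def m3Deg : (a b c : ℤ) → TateHoch k G a →ₗ[k] TateHoch k G b →ₗ[k] TateHoch k G c →ₗ[k]
    ⨁ i, TateHoch k G i
  | .ofNat m, .negSucc r, .ofNat n =>
      if r + 2 ≤ m + n then (m3CHC k G m r n).compr₂
        (LinearMap.compRight k (inC k _ _ (m + n - r - 2))) else 0
  | .negSucc r, .ofNat m, .negSucc s =>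
      if m ≤ r + s + 1 then (m3HCH k G r m s).compr₂
        (LinearMap.compRight k (inH k _ _ (r + s + 2 - m))) else 0
  | _, _, _ => 0

/-! ### The cyclic A-infinity-algebra `D^*(kG, kG)` -/

/-- `⟨φ, (g₀, g₁, …, g_s)⟩ = ⟨φ(g₁, …, g_s), g₀⟩` for a cochain `φ` of degree `s`, and `0` for
cochains of other degrees. -/
def pairCH (n s : ℕ) : HochCochain k G n →ₗ[k] HochChain k G s →ₗ[k] k :=
  (basisLift fun x => (symmForm k G).flip (gp k x.1) ∘ₗ evalAt k x.2.1).flip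

/-- The symmetric bilinear form on homogeneous components. -/
def pairDeg : (a b : ℤ) → TateHoch k G a →ₗ[k] TateHoch k G b →ₗ[k] k
  | .ofNat n, .negSucc s => pairCH k G n s
  | .negSucc s, .ofNat n => (pairCH k G n s).flip
  | _, _ => 0

/-- The Tate-Hochschild cochain complex `D^*(kG, kG)` with its products `m₁` (the differential),
`m₂` (the generalized cup product), `m₃`, `m_p = 0` for `p > 3`, and its form. -/
def tateHochschild : AInfData k (TateHoch k G) where
  m := upToTernary (splicedDifferential (hochDelta k G) (hochTrace k G) (hochDel k G))
    (extend₂ (cupDeg k G)) (extend₃ (m3Deg k G))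
  pair := extend₂ (pairDeg k G)

/-! ### The Tate cochain complex of `G` with trivial coefficients -/

/-- Group cochains `C^n(G, k) = Map((G - {1})^n, k)`. -/
abbrev GrpCochain (n : ℕ) : Type _ := BarTuple G n → k

/-- Group chains `C_s(G, k) = k[(G - {1})^s]`. -/
abbrev GrpChain (s : ℕ) : Type _ := BarTuple G s →₀ k

/-- The graded vector space of the Tate cochain complex, `C^n(G, k)` in degree `n ≥ 0` and
`C_s(G, k)` in degree `-s - 1`. -/
abbrev TateGrp : ℤ → Type _ := Spliced (GrpCochain k G) (GrpChain k G)

/-- The differential of group cochains (trivial coefficients). -/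
def grpDelta (n : ℕ) : GrpCochain k G n →ₗ[k] GrpCochain k G (n + 1) :=
  LinearMap.pi fun l => evalAt k (l.1.drop 1)
    + ∑ i ∈ Finset.Icc 1 n, (-1 : k) ^ i • evalAt k (contract i l.1)
    + (-1 : k) ^ (n + 1) • evalAt k (l.1.take n)

open Classical in
/-- The chain `(g₁, …, g_s)`; it is `0` if some `g_i` is `1` or if the length is not `s`. -/
def tupleAt {G : Type*} [Group G] (s : ℕ) (l : List G) : GrpChain k G s :=
  if h : l.length = s ∧ ∀ g ∈ l, g ≠ 1 then Finsupp.single ⟨l, h⟩ 1 else 0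

/-- The differential of group chains (trivial coefficients). -/
def grpDel (s : ℕ) : GrpChain k G (s + 1) →ₗ[k] GrpChain k G s :=
  Finsupp.linearCombination k fun x =>
    tupleAt k s (x.1.drop 1)
    + ∑ i ∈ Finset.Icc 1 s, (-1 : k) ^ i • tupleAt k s (contract i x.1)
    + (-1 : k) ^ (s + 1) • tupleAt k s (x.1.take s)

/-- The embedding of the Tate cochain complex in `D^*(kG, kG)`:
`φ ↦ ((g₁, …, g_n) ↦ φ(g₁, …, g_n) g₁⋯g_n)` and
`(g₁, …, g_s) ↦ ((g₁⋯g_s)⁻¹, g₁, …, g_s)`. -/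
def tateIncl : ∀ i, TateGrp k G i →ₗ[k] TateHoch k G i
  | .ofNat n => (LinearMap.pi fun l : BarTuple G n =>
      (LinearMap.toSpanSingleton k _ (gp k l.1.prod)) ∘ₗ LinearMap.proj l :
        GrpCochain k G n →ₗ[k] HochCochain k G n)
  | .negSucc s => (Finsupp.linearCombination k fun x => chainAt k s x.1 (gp k x.1.prod⁻¹) :
        GrpChain k G s →ₗ[k] HochChain k G s)

open Classical in
/-- The left inverse of `tateIncl` which picks out the coefficients of `g₁⋯g_n` in
`φ(g₁, …, g_n)` and kills the chains `(g₀, g₁, …, g_s)` with `g₀ g₁⋯g_s ≠ 1`. -/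
def tateProj : ∀ i, TateHoch k G i →ₗ[k] TateGrp k G i
  | .ofNat n => (LinearMap.pi fun l : BarTuple G n => coeffAt k G l.1.prod ∘ₗ LinearMap.proj l :
        HochCochain k G n →ₗ[k] GrpCochain k G n)
  | .negSucc s => (Finsupp.linearCombination k fun x =>
        if x.1 * x.2.1.prod = 1 then Finsupp.single x.2 1 else 0 :
        HochChain k G s →ₗ[k] GrpChain k G s)

/-- The norm map `C_0(G, k) = k → k = C^0(G, k)`, multiplication by `|G|`. -/
def grpNorm : GrpChain k G 0 →ₗ[k] GrpCochain k G 0 :=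
  Finsupp.linearCombination k fun _ _ => (Fintype.card G : k)

/-- The Tate cochain complex with its differential as `m₁`; the products `m_p`, `p ≥ 2`, and the
form are restricted from `D^*(kG, kG)` along `tateIncl`. -/
def tateGroup : AInfData k (TateGrp k G) where
  m
    | 1 => upToTernary (splicedDifferential (grpDelta k G) (grpNorm k G) (grpDel k G)) 0 0 1
    | p => (DirectSum.lmap (tateProj k G)).compMultilinearMap
        (((tateHochschild k G).m p).compLinearMap fun _ => DirectSum.lmap (tateIncl k G))
  pair := (tateHochschild k G).pair.compl₁₂ (DirectSum.lmap (tateIncl k G))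
    (DirectSum.lmap (tateIncl k G))

/-! ### The tensor product with `kG` -/

variable {V : ℤ → Type*} [∀ i, AddCommGroup (V i)] [∀ i, Module k (V i)]

/-- `α ↦ g ⊗ α`. -/
def tensorIn (g : G) : (⨁ i, V i) →ₗ[k] ⨁ i, MonoidAlgebra k G ⊗[k] V i :=
  DirectSum.lmap fun i => TensorProduct.mk k (MonoidAlgebra k G) (V i) (gp k g)

/-- `∑_h h ⊗ α_h ↦ α_g`. -/
def tensorCoeff (g : G) : (⨁ i, MonoidAlgebra k G ⊗[k] V i) →ₗ[k] ⨁ i, V i :=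
  DirectSum.lmap fun i =>
    (TensorProduct.lid k (V i)).toLinearMap ∘ₗ (coeffAt k G g).rTensor (V i)

/-- `kG ⊗ A`, with `m_p(g₁ ⊗ α₁, …, g_p ⊗ α_p) = g₁⋯g_p ⊗ m_p(α₁, …, α_p)` and
`⟨g ⊗ α, h ⊗ β⟩ = ⟨g, h⟩⟨α, β⟩`. -/
def groupTensor (A : AInfData k V) : AInfData k (fun i => MonoidAlgebra k G ⊗[k] V i) where
  m p := ∑ g : Fin p → G, (tensorIn k G (List.ofFn g).prod).compMultilinearMap
    ((A.m p).compLinearMap fun i => tensorCoeff k G (g i))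
  pair := ∑ g : G, ∑ h : G, symmForm k G (gp k g) (gp k h) •
    A.pair.compl₁₂ (tensorCoeff k G g) (tensorCoeff k G h)

lemma tensorCoeff_tensorIn [DecidableEq G] (g h : G) (x : ⨁ i, V i) :
    tensorCoeff k G g (tensorIn k G h x) = if h = g then x else 0 := by
  induction x using DirectSum.induction_on with
  | zero => simp
  | of i v =>
    simp only [tensorCoeff, tensorIn, DirectSum.lmap_of]
    by_cases e : h = g <;> simp [coeffAt, e]
  | add x y hx hy => rw [map_add, map_add, hx, hy]; split_ifs <;> simp

lemma groupTensor_m (A : AInfData k V) (p : ℕ) (g : Fin p → G) (x : Fin p → ⨁ i, V i) :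
    (groupTensor k G A).m p (fun i => tensorIn k G (g i) (x i)) =
      tensorIn k G (List.ofFn g).prod (A.m p x) := by
  classical
  simp only [groupTensor, _root_.sum_apply, LinearMap.compMultilinearMap_apply,
    MultilinearMap.compLinearMap_apply, tensorCoeff_tensorIn]
  rw [Finset.sum_eq_single g]
  · simp
  · intro h _ hne
    obtain ⟨i, hi⟩ := Function.ne_iff.mp hne
    rw [(A.m p).map_coord_zero i (by simp [hi.symm]), map_zero]
  · simp

lemma groupTensor_pair (A : AInfData k V) (g h : G) (x y : ⨁ i, V i) :
    (groupTensor k G A).pair (tensorIn k G g x) (tensorIn k G h y) =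
      symmForm k G (gp k g) (gp k h) * A.pair x y := by
  classical
  simp only [groupTensor, LinearMap.sum_apply, LinearMap.smul_apply, LinearMap.compl₁₂_apply,
    tensorCoeff_tensorIn]
  rw [Finset.sum_eq_single g, Finset.sum_eq_single h] <;> simp +contextual [eq_comm]

end TateHochschild

end

/-!
The idea is to use *twisted coordinates*: a cochain `φ` is written as
`φ(g₁, …, g_n) = f(g₁, …, g_n) g₁⋯g_n`, and a chain as a linear combination of
`(ρ (g₁⋯g_n)⁻¹, g₁, …, g_n)` with `ρ ∈ kG` (`coch`, `chn`). Because `G` is commutative, all group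
elements which the operations of `D^*(kG, kG)` insert cancel in these coordinates: the differential
becomes the bar differential with trivial coefficients, and every operation is an operation on
functions of words which is multilinear over the commutative ring `kG` in the values `f` and the
coefficients `ρ` (`tateDiff_coch`, `tateDiff_chn`, `tateCup_coch_chn`, `tateTriple_coch_chn_coch`,
`tateTriple_chn_coch_chn` and their companions). The Tate cochain complex is the part with `f` and
`ρ` in `k`, so `D^*(kG, kG)` is obtained from it by extension of scalars from `k` to `kG`. This
gives all the assertions on `ι` and on the isomorphism: `ι` has image closed under the operations
(`tateCup_mem_range`, `tateTriple_mem_range`), the operations commute with the action of `kG`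
(`tateHochschild_m_act`), the translates of the image of `ι` by the elements of `G` are independent
and span (`tateProjTotal_act_tateInclTotal`, `sum_act_tateInclTotal`), and a cyclic A-infinity
structure can be pulled back along an injective strict morphism
if the form stays nondegenerate (`AInfData.IsStrictMorphism.isCyclicAInfinity`).

It remains to show that `D^*(kG, kG)` is a cyclic A-infinity-algebra. The products are cyclic for
the form (`tateDiff_cyclic`, `tateCup_cyclic`, `tateTriple_cyclic`) and the form is nondegenerate,
so the Stasheff identity in `n` elements may be paired with one more element, and the resulting
function of `n + 1` elements may be rotated: it has to be verified for one representative of each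
cyclic pattern of cochains and chains (`eq_zero_of_rotation`). As `m_p = 0` for `p > 3`, only
`n ≤ 5` matters. The ternary product is governed by a bracket
`{f, h}(w, v) = ∑ (-1)^|a| f(a g d) h(c g⁻¹ b)`, summed over the decompositions `v = a b`,
`w = c d` and over `g ∈ G` (`bracket`). The essential cases are the following.
* Two elements: the bar differential is a derivation of the concatenation product, and a
  coderivation, up to norm terms, for the insertion of a letter (`sum_barDelta_append_cons`).
* Three elements: the bracket commutes with the bar differential up to four terms, which are the
  failure of associativity of the generalized cup product (`crossSum_barDelta`).
* Four elements: the bracket is a double derivation (`bracket_conv`).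
* Five elements: the bracket satisfies a double Jacobi identity (`bracket_jacobi`).
In the last two cases the degrees exclude most patterns: a ternary product is nonzero only if
cochains and chains alternate (`tateTriple_eq_zero`).
-/

noncomputable section

/-! ### Signs -/

/-- The sign `(-1)^a` as an integer, for an integer exponent. -/
def sg (a : ℤ) : ℤ := (a.negOnePow : ℤˣ)

lemma sg_add (a b : ℤ) : sg (a + b) = sg a * sg b := by
  simp [sg, Int.negOnePow_add]

@[simp] lemma sg_zero : sg 0 = 1 := by simp [sg]

@[simp] lemma sg_one : sg 1 = -1 := by simp [sg]

@[simp] lemma sg_mul_self (a : ℤ) : sg a * sg a = 1 := by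
  rw [← sg_add, sg, Int.negOnePow_even _ ⟨a, rfl⟩]; rfl

lemma sg_congr {a b : ℤ} (h : (a - b) % 2 = 0) : sg a = sg b := by
  rw [sg, sg, (Int.negOnePow_eq_iff a b).2 (Int.even_iff.2 h)]

lemma sg_congr_neg {a b : ℤ} (h : (a - b) % 2 = 1) : sg a = -sg b := by
  rw [show a = (a - 1) + 1 by ring, sg_add, sg_one, sg_congr (a := a - 1) (b := b) (by omega)]
  ring

lemma sg_natCast (n : ℕ) : sg n = (-1) ^ n := by
  induction n with
  | zero => simp
  | succ n ih => rw [Nat.cast_succ, sg_add, ih, sg_one, pow_succ]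

lemma neg_one_pow_smul_eq_sg {k M : Type*} [Ring k] [AddCommGroup M] [Module k M] (n : ℕ) (x : M) :
    (-1 : k) ^ n • x = sg n • x := by
  rw [sg_natCast]
  rcases Nat.even_or_odd n with h | h <;> simp [h.neg_one_pow]

lemma negOnePow_smul_eq_sg {M : Type*} [AddCommGroup M] (a : ℤ) (x : M) :
    a.negOnePow • x = sg a • x := by
  rw [Units.smul_def, sg]

/-! ### Sums over the decompositions of a word -/

section Words

variable {α M N : Type*}

section AddCommMonoid

variable [AddCommMonoid M] [AddCommMonoid N]

/-- `∑_{w = a b} F(a, b)`, the sum over all ways of cutting the word `w` in two. -/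
def splitSum (w : List α) (F : List α → List α → M) : M :=
  ∑ i ∈ Finset.range (w.length + 1), F (w.take i) (w.drop i)

@[simp] lemma splitSum_nil (F : List α → List α → M) : splitSum [] F = F [] [] := by
  simp [splitSum]

@[simp] lemma splitSum_cons (x : α) (w : List α) (F : List α → List α → M) :
    splitSum (x :: w) F = F [] (x :: w) + splitSum w (fun a b => F (x :: a) b) := by
  simp only [splitSum, List.length_cons]
  rw [Finset.sum_range_succ']
  simp [add_comm]

lemma splitSum_congr {w : List α} {F F' : List α → List α → M}
    (h : ∀ a b, a ++ b = w → F a b = F' a b) : splitSum w F = splitSum w F' :=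
  Finset.sum_congr rfl fun i _ => h _ _ (List.take_append_drop i w)

lemma splitSum_eq_zero {w : List α} {F : List α → List α → M}
    (h : ∀ a b, a ++ b = w → F a b = 0) : splitSum w F = 0 :=
  Finset.sum_eq_zero fun i _ => h _ _ (List.take_append_drop i w)

@[simp] lemma splitSum_zero (w : List α) : splitSum w (fun _ _ => (0 : M)) = 0 :=
  splitSum_eq_zero fun _ _ _ => rfl

lemma splitSum_add (w : List α) (F F' : List α → List α → M) :
    splitSum w (fun a b => F a b + F' a b) = splitSum w F + splitSum w F' :=
  Finset.sum_add_distrib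

lemma splitSum_sum {ι : Type*} (s : Finset ι) (w : List α) (F : ι → List α → List α → M) :
    splitSum w (fun a b => ∑ i ∈ s, F i a b) = ∑ i ∈ s, splitSum w (F i) :=
  Finset.sum_comm

lemma splitSum_comm (w v : List α) (F : List α → List α → List α → List α → M) :
    splitSum w (fun a b => splitSum v (F a b)) =
      splitSum v (fun c d => splitSum w (fun a b => F a b c d)) :=
  Finset.sum_comm

lemma map_splitSum {φ : Type*} [FunLike φ M N] [AddMonoidHomClass φ M N] (f : φ) (w : List α)
    (F : List α → List α → M) : f (splitSum w F) = splitSum w (fun a b => f (F a b)) :=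
  map_sum f _ _

lemma splitSum_append_cons (u : List α) (g : α) (v : List α) (F : List α → List α → M) :
    splitSum (u ++ g :: v) F = splitSum u (fun a b => F a (b ++ g :: v)) +
      splitSum v (fun a b => F (u ++ g :: a) b) := by
  induction u generalizing F with
  | nil => simp
  | cons x u ih => simp [ih, add_assoc]

lemma splitSum_assoc (w : List α) (F : List α → List α → List α → M) :
    splitSum w (fun a b => splitSum a (fun c d => F c d b)) =
      splitSum w (fun a b => splitSum b (fun c d => F a c d)) := by
  induction w generalizing F with
  | nil => simp
  | cons x w ih => simp [splitSum_add, ih, add_assoc]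

/-- `∑_{w = a x b} F(a, x, b)`, the sum over all letters `x` of the word `w`. -/
def letterSum : List α → (List α → α → List α → M) → M
  | [], _ => 0
  | x :: w, F => F [] x w + letterSum w (fun a y b => F (x :: a) y b)

lemma letterSum_congr {w : List α} {F F' : List α → α → List α → M}
    (h : ∀ a x b, a ++ x :: b = w → F a x b = F' a x b) : letterSum w F = letterSum w F' := by
  induction w generalizing F F' with
  | nil => rfl
  | cons x w ih =>
    simp only [letterSum]
    rw [h [] x w rfl, ih]
    intro a y b e
    exact h (x :: a) y b (by simp [e])

/-- `F(x, a)` for a word `x a`, and `0` for the empty word. -/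
def headTerm (F : α → List α → M) : List α → M
  | [] => 0
  | x :: w => F x w

/-- `F(a, x)` for a word `a x`, and `0` for the empty word. -/
def lastTerm (F : List α → α → M) (w : List α) : M :=
  headTerm (fun x a => F a.reverse x) w.reverse

@[simp] lemma headTerm_nil (F : α → List α → M) : headTerm F [] = 0 := rfl

@[simp] lemma headTerm_cons (F : α → List α → M) (x : α) (w : List α) :
    headTerm F (x :: w) = F x w := rfl

@[simp] lemma lastTerm_nil (F : List α → α → M) : lastTerm F [] = 0 := rfl

@[simp] lemma lastTerm_singleton (F : List α → α → M) (x : α) : lastTerm F [x] = F [] x := rfl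

@[simp] lemma lastTerm_cons_cons (F : List α → α → M) (x y : α) (w : List α) :
    lastTerm F (x :: y :: w) = lastTerm (fun a z => F (x :: a) z) (y :: w) := by
  obtain ⟨a, z, e⟩ : ∃ a z, y :: w = a ++ [z] :=
    ⟨_, _, (List.dropLast_append_getLast (List.cons_ne_nil y w)).symm⟩
  rw [e]
  simp [lastTerm]

lemma map_headTerm {φ : Type*} [FunLike φ M N] [AddMonoidHomClass φ M N] (f : φ)
    (F : α → List α → M) (w : List α) : f (headTerm F w) = headTerm (fun x a => f (F x a)) w := by
  cases w <;> simp

lemma map_lastTerm {φ : Type*} [FunLike φ M N] [AddMonoidHomClass φ M N] (f : φ)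
    (F : List α → α → M) (w : List α) : f (lastTerm F w) = lastTerm (fun x a => f (F x a)) w :=
  map_headTerm f _ _

lemma splitSum_headTerm_left (w : List α) (K : α → List α → List α → M) :
    splitSum w (fun a b => headTerm (fun x c => K x c b) a) =
      headTerm (fun x t => splitSum t (K x)) w := by
  cases w <;> simp

lemma splitSum_headTerm_right (w : List α) (K : List α → α → List α → M) :
    splitSum w (fun a b => headTerm (K a) b) = letterSum w K := by
  induction w generalizing K with
  | nil => simp [letterSum]
  | cons x w ih => simp [letterSum, ih]

lemma splitSum_lastTerm_left (w : List α) (K : List α → α → List α → M) :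
    splitSum w (fun a b => lastTerm (fun c x => K c x b) a) = letterSum w K := by
  induction w generalizing K with
  | nil => simp [letterSum]
  | cons x w ih =>
    simp only [splitSum_cons, lastTerm_nil, letterSum, zero_add]
    rw [← ih]
    cases w <;> simp

lemma splitSum_lastTerm_right (w : List α) (K : List α → List α → α → M) :
    splitSum w (fun a b => lastTerm (K a) b) =
      lastTerm (fun t x => splitSum t (fun a b => K a b x)) w := by
  induction w generalizing K with
  | nil => simp
  | cons x w ih =>
    cases w with
    | nil => simp
    | cons y w =>
      rw [splitSum_cons, ih, lastTerm_cons_cons, lastTerm_cons_cons]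
      generalize y :: w = v
      simp only [splitSum_cons, lastTerm]
      cases v.reverse <;> simp

end AddCommMonoid

section AddCommGroup

variable [AddCommGroup M] [AddCommGroup N]

lemma splitSum_neg (w : List α) (F : List α → List α → M) :
    splitSum w (fun a b => -F a b) = -splitSum w F :=
  Finset.sum_neg_distrib _

lemma splitSum_sub (w : List α) (F F' : List α → List α → M) :
    splitSum w (fun a b => F a b - F' a b) = splitSum w F - splitSum w F' :=
  Finset.sum_sub_distrib _ _

lemma splitSum_zsmul (w : List α) (n : ℤ) (F : List α → List α → M) :
    splitSum w (fun a b => n • F a b) = n • splitSum w F :=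
  (Finset.smul_sum).symm

lemma letterSum_neg (w : List α) (F : List α → α → List α → M) :
    letterSum w (fun a x b => -F a x b) = -letterSum w F := by
  induction w generalizing F with
  | nil => simp [letterSum]
  | cons x w ih => simp only [letterSum, ih]; abel

lemma headTerm_add (F F' : α → List α → M) (w : List α) :
    headTerm (fun x a => F x a + F' x a) w = headTerm F w + headTerm F' w := by
  cases w <;> simp

lemma headTerm_sub (F F' : α → List α → M) (w : List α) :
    headTerm (fun x a => F x a - F' x a) w = headTerm F w - headTerm F' w := by
  cases w <;> simp

@[simp] lemma headTerm_zero (w : List α) : headTerm (fun _ _ => (0 : M)) w = 0 := by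
  cases w <;> rfl

lemma headTerm_congr {F F' : α → List α → M} {w : List α} (h : ∀ x a, x :: a = w → F x a = F' x a) :
    headTerm F w = headTerm F' w := by
  cases w
  · rfl
  · exact h _ _ rfl

lemma lastTerm_sub (F F' : List α → α → M) (w : List α) :
    lastTerm (fun x a => F x a - F' x a) w = lastTerm F w - lastTerm F' w :=
  headTerm_sub _ _ _

lemma lastTerm_congr {F F' : List α → α → M} {w : List α}
    (h : ∀ a x, a ++ [x] = w → F a x = F' a x) : lastTerm F w = lastTerm F' w := by
  refine headTerm_congr fun x a e => h _ _ ?_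
  have := congrArg List.reverse e
  simpa using this

end AddCommGroup

end Words

/-! ### The bar differential -/

section Bar

variable {G M N : Type*} [Group G] [AddCommGroup M] [AddCommGroup N]

/-- `∑_{w = a x y b} (-1)^(|a|+1) F(a (xy) b)`, the inner part of the bar differential. -/
def mergeSum : List G → (List G → M) → M
  | [], _ => 0
  | x :: w, F => -headTerm (fun y b => F (x * y :: b)) w - mergeSum w (fun l => F (x :: l))

/-- The differential of the bar complex with trivial coefficients, applied to a function `F` on
words: `F(g₂, …, g_n) + ∑ (-1)^i F(…, g_i g_{i+1}, …) + (-1)^n F(g₁, …, g_{n-1})`; its value at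
the empty word is `0`. For `F` the inclusion of words in the chains, this is `∂`. -/
def barDelta (F : List G → M) (w : List G) : M :=
  headTerm (fun _ b => F b) w + mergeSum w F + sg w.length • lastTerm (fun a _ => F a) w

@[simp] lemma mergeSum_nil (F : List G → M) : mergeSum [] F = 0 := rfl

@[simp] lemma mergeSum_cons (x : G) (w : List G) (F : List G → M) :
    mergeSum (x :: w) F =
      -headTerm (fun y b => F (x * y :: b)) w - mergeSum w (fun l => F (x :: l)) := rfl

lemma map_mergeSum {φ : Type*} [FunLike φ M N] [AddMonoidHomClass φ M N] (f : φ)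
    (w : List G) (F : List G → M) : f (mergeSum w F) = mergeSum w (fun l => f (F l)) := by
  induction w generalizing F with
  | nil => simp
  | cons x w ih => simp [ih, map_headTerm]

lemma map_barDelta {φ : Type*} [FunLike φ M N] [AddMonoidHomClass φ M N] (f : φ)
    (F : List G → M) (w : List G) : f (barDelta F w) = barDelta (fun l => f (F l)) w := by
  simp [barDelta, map_mergeSum, map_headTerm, map_lastTerm, map_zsmul]

lemma mergeSum_congr {w : List G} {F F' : List G → M}
    (h : ∀ l, l.length + 1 = w.length → F l = F' l) : mergeSum w F = mergeSum w F' := by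
  induction w generalizing F F' with
  | nil => rfl
  | cons x w ih =>
    simp only [mergeSum_cons]
    rw [ih (F := fun l => F (x :: l)) (F' := fun l => F' (x :: l))
        (fun l hl => h _ (by simp [hl])),
      headTerm_congr (fun y b e => h _ (by simp [← e]))]

lemma barDelta_congr {w : List G} {F F' : List G → M}
    (h : ∀ l, l.length + 1 = w.length → F l = F' l) : barDelta F w = barDelta F' w := by
  simp only [barDelta]
  rw [mergeSum_congr h, headTerm_congr (fun y b e => h _ (by simp [← e])),
    lastTerm_congr (fun y b e => h _ (by simp [← e]))]

@[simp] lemma barDelta_nil (F : List G → M) : barDelta F [] = 0 := by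
  simp [barDelta]

@[simp] lemma barDelta_zero (w : List G) : barDelta (fun _ => (0 : M)) w = 0 := by
  simpa using (map_barDelta (0 : M →+ M) (fun _ => (0 : M)) w).symm

lemma barDelta_cons (F : List G → M) (x : G) (w : List G) :
    barDelta F (x :: w) = F w - barDelta (fun l => F (x :: l)) w
      + headTerm (fun y b => F (x :: b) - F (x * y :: b)) w - if w = [] then F [] else 0 := by
  cases w with
  | nil => simp [barDelta]
  | cons y w =>
    simp only [barDelta, headTerm_cons, mergeSum_cons, lastTerm_cons_cons, List.length_cons,
      Nat.cast_add, Nat.cast_one, sg_add, sg_one]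
    simp only [mul_neg, mul_one, neg_smul, neg_neg, reduceCtorEq, if_false]
    abel

lemma barDelta_add (F F' : List G → M) (w : List G) :
    barDelta (fun l => F l + F' l) w = barDelta F w + barDelta F' w := by
  have h := map_barDelta (AddMonoidHom.coprod (AddMonoidHom.id M) (AddMonoidHom.id M))
    (fun l => (F l, F' l)) w
  have h1 := map_barDelta (AddMonoidHom.fst M M) (fun l => (F l, F' l)) w
  have h2 := map_barDelta (AddMonoidHom.snd M M) (fun l => (F l, F' l)) w
  simp only [AddMonoidHom.coprod_apply, AddMonoidHom.id_apply] at h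
  rw [← h]
  exact congrArg₂ _ h1 h2

lemma barDelta_zsmul (n : ℤ) (F : List G → M) (w : List G) :
    barDelta (fun l => n • F l) w = n • barDelta F w :=
  (map_barDelta (zsmulAddGroupHom n : M →+ M) F w).symm

lemma barDelta_neg (F : List G → M) (w : List G) :
    barDelta (fun l => -F l) w = -barDelta F w :=
  (map_barDelta (negAddMonoidHom : M →+ M) F w).symm

lemma barDelta_sub (F F' : List G → M) (w : List G) :
    barDelta (fun l => F l - F' l) w = barDelta F w - barDelta F' w := by
  simp only [sub_eq_add_neg]
  rw [barDelta_add, barDelta_neg]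

lemma barDelta_sum {ι : Type*} (s : Finset ι) (F : ι → List G → M) (w : List G) :
    barDelta (fun l => ∑ i ∈ s, F i l) w = ∑ i ∈ s, barDelta (F i) w := by
  classical
  induction s using Finset.induction_on with
  | empty => simp
  | insert a s ha ih => simp only [Finset.sum_insert ha, barDelta_add, ih]

lemma barDelta_ite_nil (c : M) (w : List G) :
    barDelta (fun l => if l = [] then c else 0) w = 0 := by
  cases w with
  | nil => simp
  | cons x w => cases w <;> simp [barDelta_cons]

/-- The bar differential has square zero. -/
lemma barDelta_barDelta (F : List G → M) (w : List G) : barDelta (barDelta F) w = 0 := by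
  induction w generalizing F with
  | nil => simp
  | cons x t ih =>
    have h : headTerm (fun y b => barDelta F (x :: b) - barDelta F (x * y :: b)) t =
        barDelta (fun l => headTerm (fun y b => F (x :: b) - F (x * y :: b)) l) t := by
      cases t with
      | nil => simp
      | cons y b =>
        rw [barDelta_cons]
        simp only [headTerm_cons, barDelta_cons, barDelta_sub, headTerm_nil, ite_self]
        cases b <;> simp [mul_assoc]
        abel
    rw [barDelta_cons, h]
    simp only [barDelta_cons F x, barDelta_sub, barDelta_add, barDelta_ite_nil, ih]
    simp

lemma mergeSum_splitSum (w : List G) (K : List G → List G → M) :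
    mergeSum w (fun l => splitSum l K) =
      splitSum w (fun a b => mergeSum a (fun c => K c b)) +
      splitSum w (fun a b => sg a.length • mergeSum b (K a)) := by
  induction w generalizing K with
  | nil => simp
  | cons x t ih =>
    have h := splitSum_headTerm_left t (fun y c b => K (x * y :: c) b)
    have h2 : mergeSum t (fun l => K [] (x :: l) + splitSum l (fun a b => K (x :: a) b)) =
        mergeSum t (fun l => K [] (x :: l)) +
          mergeSum t (fun l => splitSum l (fun a b => K (x :: a) b)) := by
      have h := map_mergeSum (AddMonoidHom.coprod (AddMonoidHom.id M) (AddMonoidHom.id M)) t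
        (fun l => (K [] (x :: l), splitSum l (fun a b => K (x :: a) b)))
      have h1 := map_mergeSum (AddMonoidHom.fst M M) t
        (fun l => (K [] (x :: l), splitSum l (fun a b => K (x :: a) b)))
      have h2 := map_mergeSum (AddMonoidHom.snd M M) t
        (fun l => (K [] (x :: l), splitSum l (fun a b => K (x :: a) b)))
      simp only [AddMonoidHom.coprod_apply, AddMonoidHom.id_apply] at h
      rw [← h]
      exact congrArg₂ _ h1 h2
    simp only [mergeSum_cons, splitSum_cons, h2, ih, splitSum_sub, splitSum_neg, h, mergeSum_nil,
      List.length_cons, List.length_nil, Nat.cast_add, Nat.cast_zero, Nat.cast_one, sg_add, sg_one,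
      sg_zero, one_smul, mul_neg, mul_one, neg_smul, headTerm_add]
    abel

/-- The bar differential is a coderivation for cutting words in two. -/
lemma barDelta_splitSum (w : List G) (K : List G → List G → M) :
    barDelta (fun u => splitSum u K) w =
      splitSum w (fun a b => barDelta (fun c => K c b) a) +
      splitSum w (fun a b => sg a.length • barDelta (K a) b) := by
  have h1 := splitSum_headTerm_left w (fun _ c b => K c b)
  have h2 : splitSum w (fun a b => sg a.length • headTerm (fun _ c => K a c) b) =
      letterSum w (fun a _ b => sg a.length • K a b) := by
    rw [← splitSum_headTerm_right]
    exact splitSum_congr fun a b _ => map_headTerm (zsmulAddGroupHom (sg a.length) : M →+ M) _ _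
  have h3 : splitSum w (fun a b => sg a.length • lastTerm (fun c _ => K c b) a) =
      -letterSum w (fun a _ b => sg a.length • K a b) := by
    rw [← letterSum_neg, ← splitSum_lastTerm_left]
    refine splitSum_congr fun a b _ => ?_
    refine (map_lastTerm (zsmulAddGroupHom (sg a.length) : M →+ M) _ _).trans ?_
    refine lastTerm_congr fun c x e => ?_
    simp [← e, sg_add]
  have h4 : splitSum w (fun a b => sg a.length • sg b.length • lastTerm (fun c _ => K a c) b) =
      sg w.length • lastTerm (fun a _ => splitSum a K) w := by
    have := splitSum_lastTerm_right w (fun a b (_ : G) => K a b)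
    rw [← this, ← splitSum_zsmul]
    refine splitSum_congr fun a b e => ?_
    rw [smul_smul, ← sg_add, ← e]
    simp
  simp only [barDelta, smul_add, splitSum_add, mergeSum_splitSum]
  rw [h1, h2, h3, h4]
  abel

lemma mergeSum_append_cons (v : List G) (g : G) (w : List G) (F : List G → M) :
    mergeSum (v ++ g :: w) F = mergeSum v (fun l => F (l ++ g :: w))
      + sg v.length • lastTerm (fun a x => F (a ++ (x * g) :: w)) v
      - sg v.length • headTerm (fun y b => F (v ++ (g * y) :: b)) w
      - sg v.length • mergeSum w (fun l => F (v ++ g :: l)) := by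
  induction v generalizing F with
  | nil => simp
  | cons x v ih =>
    simp only [List.cons_append, mergeSum_cons, ih]
    cases v with
    | nil => simp; abel
    | cons y v =>
      simp only [List.cons_append, headTerm_cons, mergeSum_cons, lastTerm_cons_cons,
        List.length_cons, Nat.cast_add, Nat.cast_one, sg_add, sg_one]
      simp only [mul_neg, mul_one, neg_smul, neg_neg]
      abel

/-- The bar differential at a word `v g w` with a marked letter `g`: the two one-sided
differentials, and the correction terms in which `g` takes part or which use the ends. -/
lemma barDelta_append_cons (F : List G → M) (v : List G) (g : G) (w : List G) :
    barDelta F (v ++ g :: w) =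
      barDelta (fun l => F (l ++ g :: w)) v
      - sg v.length • barDelta (fun l => F (v ++ g :: l)) w
      + ((if v = [] then F w else 0) - sg v.length • (if w = [] then F v else 0))
      + sg v.length • lastTerm (fun a x => F (a ++ (x * g) :: w) - F (a ++ g :: w)) v
      - sg v.length • headTerm (fun y b => F (v ++ (g * y) :: b) - F (v ++ g :: b)) w := by
  have h1 : headTerm (fun _ b => F b) (v ++ g :: w) =
      headTerm (fun _ b => F (b ++ g :: w)) v + if v = [] then F w else 0 := by
    cases v <;> simp
  have h2 : lastTerm (fun a _ => F a) (v ++ g :: w) =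
      lastTerm (fun a _ => F (v ++ g :: a)) w + if w = [] then F v else 0 := by
    rcases List.eq_nil_or_concat w with rfl | ⟨w, y, rfl⟩ <;> simp [lastTerm]
  simp only [barDelta, h1, h2, mergeSum_append_cons, headTerm_sub, lastTerm_sub, List.length_append,
    List.length_cons, Nat.cast_add, Nat.cast_one, sg_add, sg_one, smul_add, smul_sub]
  simp only [mul_neg, mul_one, neg_smul, smul_smul]
  rcases eq_or_ne w [] with rfl | hw
  · simp
    abel
  · simp only [hw, if_false, smul_zero]
    abel

end Bar

/-! ### Identities for functions of words -/

lemma splitSum_ite_left {α N : Type*} [AddCommMonoid N] [DecidableEq (List α)] (w : List α)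
    (X : List α → List α → N) :
    splitSum w (fun a b => if a = [] then X a b else 0) = X [] w := by
  cases w <;> simp

lemma splitSum_ite_right {α N : Type*} [AddCommMonoid N] [DecidableEq (List α)] (w : List α)
    (X : List α → List α → N) :
    splitSum w (fun a b => if b = [] then X a b else 0) = X w [] := by
  induction w generalizing X with
  | nil => simp
  | cons x w ih => simpa using ih fun a b => X (x :: a) b

section CrossSum

variable {G M : Type*} [AddCommGroup M] [Fintype G]

/-- `∑ F(a, b, c, d, g)` over all decompositions `v = a b`, `w = c d` and all `g ∈ G`. -/
def crossSum (v w : List G) (F : List G → List G → List G → List G → G → M) : M :=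
  splitSum v fun a b => splitSum w fun c d => ∑ g : G, F a b c d g

lemma crossSum_congr {v w : List G} {F F' : List G → List G → List G → List G → G → M}
    (h : ∀ a b c d g, a ++ b = v → c ++ d = w → F a b c d g = F' a b c d g) :
    crossSum v w F = crossSum v w F' :=
  splitSum_congr fun a b e => splitSum_congr fun c d e' =>
    Finset.sum_congr rfl fun g _ => h a b c d g e e'

lemma crossSum_add (v w : List G) (F F' : List G → List G → List G → List G → G → M) :
    crossSum v w (fun a b c d g => F a b c d g + F' a b c d g) =
      crossSum v w F + crossSum v w F' := by
  simp only [crossSum, Finset.sum_add_distrib, splitSum_add]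

lemma crossSum_sub (v w : List G) (F F' : List G → List G → List G → List G → G → M) :
    crossSum v w (fun a b c d g => F a b c d g - F' a b c d g) =
      crossSum v w F - crossSum v w F' := by
  simp only [crossSum, Finset.sum_sub_distrib, splitSum_sub]

lemma crossSum_zsmul (v w : List G) (n : ℤ) (F : List G → List G → List G → List G → G → M) :
    crossSum v w (fun a b c d g => n • F a b c d g) = n • crossSum v w F := by
  simp only [crossSum, ← Finset.smul_sum, splitSum_zsmul]

lemma map_crossSum {N : Type*} [AddCommGroup N] {φ : Type*} [FunLike φ M N]
    [AddMonoidHomClass φ M N] (f : φ) (v w : List G)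
    (F : List G → List G → List G → List G → G → M) :
    f (crossSum v w F) = crossSum v w (fun a b c d g => f (F a b c d g)) := by
  simp only [crossSum, map_splitSum, map_sum]

lemma crossSum_lastTerm_left (v w : List G)
    (F : List G → G → List G → List G → List G → G → M) :
    crossSum v w (fun a b c d g => lastTerm (fun a' x => F a' x b c d g) a) =
      letterSum v (fun a x b => splitSum w fun c d => ∑ g : G, F a x b c d g) := by
  rw [← splitSum_lastTerm_left]
  refine splitSum_congr fun a b _ => ?_
  rcases List.eq_nil_or_concat a with rfl | ⟨a, x, rfl⟩ <;> simp [lastTerm]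

lemma crossSum_headTerm_left (v w : List G)
    (F : List G → G → List G → List G → List G → G → M) :
    crossSum v w (fun a b c d g => headTerm (fun y b' => F a y b' c d g) b) =
      letterSum v (fun a x b => splitSum w fun c d => ∑ g : G, F a x b c d g) := by
  rw [← splitSum_headTerm_right]
  refine splitSum_congr fun a b _ => ?_
  cases b <;> simp

lemma crossSum_lastTerm_right (v w : List G)
    (F : List G → List G → List G → G → List G → G → M) :
    crossSum v w (fun a b c d g => lastTerm (fun c' x => F a b c' x d g) c) =
      letterSum w (fun c x d => splitSum v fun a b => ∑ g : G, F a b c x d g) := by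
  rw [crossSum, splitSum_comm]
  exact crossSum_lastTerm_left w v fun c x d a b g => F a b c x d g

lemma crossSum_headTerm_right (v w : List G)
    (F : List G → List G → List G → G → List G → G → M) :
    crossSum v w (fun a b c d g => headTerm (fun y d' => F a b c y d' g) d) =
      letterSum w (fun c x d => splitSum v fun a b => ∑ g : G, F a b c x d g) := by
  rw [crossSum, splitSum_comm]
  exact crossSum_headTerm_left w v fun c x d a b g => F a b c x d g

lemma crossSum_eq_zero {v w : List G}
    {F : List G → List G → List G → List G → G → M}
    (h : ∀ a b c d g, a ++ b = v → c ++ d = w → F a b c d g = 0) : crossSum v w F = 0 :=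
  splitSum_eq_zero fun a b e => splitSum_eq_zero fun c d e' =>
    Finset.sum_eq_zero fun g _ => h a b c d g e e'

lemma crossSum_smul {k X : Type*} [Semiring k] [AddCommGroup X] [Module k X] (v w : List G) (c : k)
    (F : List G → List G → List G → List G → G → X) :
    crossSum v w (fun a b p q g => c • F a b p q g) = c • crossSum v w F := by
  simp only [crossSum, ← Finset.smul_sum, splitSum, ← Finset.smul_sum]

end CrossSum

section WordIdentities

variable {G M : Type*} [Group G] [AddCommGroup M]

lemma barDelta_splitSum_param {α : Type*} (w : List α) (F : List G → List α → List α → M)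
    (u : List G) :
    barDelta (fun l => splitSum w (F l)) u =
      splitSum w (fun a b => barDelta (fun l => F l a b) u) :=
  barDelta_sum _ _ _

lemma barDelta_sg_smul (F : List G → M) (w : List G) :
    barDelta (fun l => sg l.length • F l) w = -(sg w.length • barDelta F w) := by
  rw [← barDelta_zsmul, ← barDelta_neg]
  refine barDelta_congr fun l hl => ?_
  rw [← hl, Nat.cast_add, Nat.cast_one, sg_add, sg_one]
  simp

variable [Fintype G]

/-- The bar differential is a coderivation, up to the norm at the ends, for the sum over all
letters `g` put between two words. -/
lemma sum_barDelta_append_cons [DecidableEq (List G)] (F : List G → M) (v w : List G) :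
    ∑ g : G, barDelta F (v ++ g :: w) =
      barDelta (fun l => ∑ g : G, F (l ++ g :: w)) v
      - sg v.length • barDelta (fun l => ∑ g : G, F (v ++ g :: l)) w
      + ((if v = [] then Fintype.card G • F w else 0)
        - sg v.length • (if w = [] then Fintype.card G • F v else 0)) := by
  have h1 : ∑ g : G, lastTerm (fun a x => F (a ++ (x * g) :: w) - F (a ++ g :: w)) v = 0 := by
    rcases List.eq_nil_or_concat v with rfl | ⟨v, x, rfl⟩
    · simp
    · simp only [lastTerm, List.concat_eq_append, List.reverse_append, List.reverse_cons,
        List.reverse_nil, List.nil_append, List.cons_append, headTerm_cons, List.reverse_reverse,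
        Finset.sum_sub_distrib]
      rw [sub_eq_zero]
      exact Equiv.sum_comp (Equiv.mulLeft x) fun g => F (v ++ g :: w)
  have h2 : ∑ g : G, headTerm (fun y b => F (v ++ (g * y) :: b) - F (v ++ g :: b)) w = 0 := by
    cases w with
    | nil => simp
    | cons y b =>
      simp only [headTerm_cons, Finset.sum_sub_distrib]
      rw [sub_eq_zero]
      exact Equiv.sum_comp (Equiv.mulRight y) fun g => F (v ++ g :: b)
  simp only [barDelta_append_cons, Finset.sum_sub_distrib, Finset.sum_add_distrib,
    ← Finset.smul_sum, h1, h2, barDelta_sum]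
  split_ifs <;> simp

lemma crossSum_swap (v w : List G) (F : List G → List G → List G → List G → G → M) :
    crossSum v w F = crossSum w v (fun c d a b g => F a b c d g⁻¹) := by
  rw [crossSum, splitSum_comm]
  exact splitSum_congr fun c d _ => splitSum_congr fun a b _ =>
    (Equiv.sum_comp (Equiv.inv G) fun g => F a b c d g).symm

lemma crossSum_barDelta_left (v w : List G)
    (K : List G → List G → List G → List G → G → M) :
    barDelta (fun u => crossSum u w (fun a b c d g => sg a.length • K a b c d g)) v =
      crossSum v w (fun a b c d g => barDelta (K a · c d g) b)
      - crossSum v w (fun a b c d g => sg a.length • barDelta (K · b c d g) a) := by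
  simp only [crossSum, barDelta_splitSum, barDelta_splitSum_param, barDelta_sum,
    barDelta_zsmul, barDelta_sg_smul, splitSum_neg, ← Finset.smul_sum,
    splitSum_zsmul, smul_smul, sg_mul_self, one_smul]
  abel

lemma crossSum_barDelta_right (v w : List G)
    (K : List G → List G → List G → List G → G → M) :
    barDelta (fun u => crossSum v u (fun a b c d g => sg c.length • K a b c d g)) w =
      crossSum v w (fun a b c d g => barDelta (K a b c · g) d)
      - crossSum v w (fun a b c d g => sg c.length • barDelta (K a b · d g) c) := by
  have h := crossSum_barDelta_left w v (fun c d a b g => K a b c d g)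
  simp only [crossSum] at h ⊢
  simp only [splitSum_comm v]
  exact h

/-- The compatibility of the double bracket with the bar differential: applying the differential
to `K` in both variables differs from applying it to `v` and to `w` by four terms, in which one of
the words stays whole. -/
lemma crossSum_barDelta (v w : List G) (K : List G → List G → M) :
    crossSum v w (fun a b c d g =>
        sg a.length • barDelta (fun l => K l (c ++ g⁻¹ :: b)) (a ++ g :: d)
        + sg c.length • barDelta (K (a ++ g :: d)) (c ++ g⁻¹ :: b)) =
      -barDelta (fun v => crossSum v w (fun a b c d g =>
          sg a.length • K (a ++ g :: d) (c ++ g⁻¹ :: b))) v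
      - barDelta (fun w => crossSum v w (fun a b c d g =>
          sg c.length • K (a ++ g :: d) (c ++ g⁻¹ :: b))) w
      + splitSum w (fun c d => ∑ g : G, K d (c ++ g :: v))
      - splitSum v (fun a b => ∑ g : G, K a (w ++ g :: b))
      + splitSum v (fun a b => ∑ g : G, K (a ++ g :: w) b)
      - splitSum w (fun c d => ∑ g : G, K (v ++ g :: d) c) := by
  classical
  have e1 : crossSum v w (fun a b c d g => if a = [] then K d (c ++ g⁻¹ :: b) else 0) =
      splitSum w (fun c d => ∑ g : G, K d (c ++ g :: v)) := by
    rw [crossSum, splitSum_comm]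
    refine splitSum_congr fun c d _ => ?_
    rw [splitSum_sum]
    simp only [splitSum_ite_left]
    exact Equiv.sum_comp (Equiv.inv G) fun g => K d (c ++ g :: v)
  have e2 : crossSum v w (fun a b c d g => if d = [] then K a (c ++ g⁻¹ :: b) else 0) =
      splitSum v (fun a b => ∑ g : G, K a (w ++ g :: b)) := by
    refine splitSum_congr fun a b _ => ?_
    rw [splitSum_sum]
    simp only [splitSum_ite_right]
    exact Equiv.sum_comp (Equiv.inv G) fun g => K a (w ++ g :: b)
  have e3 : crossSum v w (fun a b c d g => if c = [] then K (a ++ g :: d) b else 0) =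
      splitSum v (fun a b => ∑ g : G, K (a ++ g :: w) b) := by
    refine splitSum_congr fun a b _ => ?_
    rw [splitSum_sum]
    simp only [splitSum_ite_left]
  have e4 : crossSum v w (fun a b c d g => if b = [] then K (a ++ g :: d) c else 0) =
      splitSum w (fun c d => ∑ g : G, K (v ++ g :: d) c) := by
    rw [crossSum, splitSum_comm]
    refine splitSum_congr fun c d _ => ?_
    rw [splitSum_sum]
    simp only [splitSum_ite_right]
  have e5 := crossSum_lastTerm_left v w (fun a x b c d g =>
    K (a ++ (x * g) :: d) (c ++ g⁻¹ :: b) - K (a ++ g :: d) (c ++ g⁻¹ :: b))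
  have e6 := crossSum_headTerm_left v w (fun a y b c d g =>
    K (a ++ g :: d) (c ++ (g⁻¹ * y) :: b) - K (a ++ g :: d) (c ++ g⁻¹ :: b))
  have e56 : crossSum v w (fun a b c d g => lastTerm (fun a' x =>
        K (a' ++ (x * g) :: d) (c ++ g⁻¹ :: b) - K (a' ++ g :: d) (c ++ g⁻¹ :: b)) a) =
      crossSum v w (fun a b c d g => headTerm (fun y b' =>
        K (a ++ g :: d) (c ++ (g⁻¹ * y) :: b') - K (a ++ g :: d) (c ++ g⁻¹ :: b')) b) := by
    rw [e5, e6]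
    refine letterSum_congr fun a x b _ => splitSum_congr fun c d _ => ?_
    rw [Finset.sum_sub_distrib, Finset.sum_sub_distrib,
      ← Equiv.sum_comp (Equiv.mulLeft x) fun g => K (a ++ g :: d) (c ++ (g⁻¹ * x) :: b)]
    simp
  have e7 := crossSum_lastTerm_right v w (fun a b c x d g =>
    K (a ++ g :: d) (c ++ (x * g⁻¹) :: b) - K (a ++ g :: d) (c ++ g⁻¹ :: b))
  have e8 := crossSum_headTerm_right v w (fun a b c y d g =>
    K (a ++ (g * y) :: d) (c ++ g⁻¹ :: b) - K (a ++ g :: d) (c ++ g⁻¹ :: b))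
  have e78 : crossSum v w (fun a b c d g => lastTerm (fun c' x =>
        K (a ++ g :: d) (c' ++ (x * g⁻¹) :: b) - K (a ++ g :: d) (c' ++ g⁻¹ :: b)) c) =
      crossSum v w (fun a b c d g => headTerm (fun y d' =>
        K (a ++ (g * y) :: d') (c ++ g⁻¹ :: b) - K (a ++ g :: d') (c ++ g⁻¹ :: b)) d) := by
    rw [e7, e8]
    refine letterSum_congr fun c x d _ => splitSum_congr fun a b _ => ?_
    rw [Finset.sum_sub_distrib, Finset.sum_sub_distrib,
      ← Equiv.sum_comp (Equiv.mulRight x) fun g => K (a ++ g :: d) (c ++ (x * g⁻¹) :: b)]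
    simp
  have hl : ∀ a b c d : List G, ∀ g : G,
      sg a.length • barDelta (fun l => K l (c ++ g⁻¹ :: b)) (a ++ g :: d) =
      sg a.length • barDelta (fun l => K (l ++ g :: d) (c ++ g⁻¹ :: b)) a
      - barDelta (fun l => K (a ++ g :: l) (c ++ g⁻¹ :: b)) d
      + (if a = [] then K d (c ++ g⁻¹ :: b) else 0) - (if d = [] then K a (c ++ g⁻¹ :: b) else 0)
      + lastTerm (fun a' x => K (a' ++ (x * g) :: d) (c ++ g⁻¹ :: b)
          - K (a' ++ g :: d) (c ++ g⁻¹ :: b)) a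
      - headTerm (fun y d' => K (a ++ (g * y) :: d') (c ++ g⁻¹ :: b)
          - K (a ++ g :: d') (c ++ g⁻¹ :: b)) d := by
    intro a b c d g
    rw [barDelta_append_cons]
    simp only [smul_add, smul_sub, smul_smul, sg_mul_self, one_smul]
    have : sg a.length • (if a = [] then K d (c ++ g⁻¹ :: b) else 0) =
        if a = [] then K d (c ++ g⁻¹ :: b) else 0 := by split_ifs with h <;> simp [h]
    rw [this]
    abel
  have hr : ∀ a b c d : List G, ∀ g : G,
      sg c.length • barDelta (K (a ++ g :: d)) (c ++ g⁻¹ :: b) =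
      sg c.length • barDelta (fun l => K (a ++ g :: d) (l ++ g⁻¹ :: b)) c
      - barDelta (fun l => K (a ++ g :: d) (c ++ g⁻¹ :: l)) b
      + (if c = [] then K (a ++ g :: d) b else 0) - (if b = [] then K (a ++ g :: d) c else 0)
      + lastTerm (fun c' x => K (a ++ g :: d) (c' ++ (x * g⁻¹) :: b)
          - K (a ++ g :: d) (c' ++ g⁻¹ :: b)) c
      - headTerm (fun y b' => K (a ++ g :: d) (c ++ (g⁻¹ * y) :: b')
          - K (a ++ g :: d) (c ++ g⁻¹ :: b')) b := by
    intro a b c d g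
    rw [barDelta_append_cons]
    simp only [smul_add, smul_sub, smul_smul, sg_mul_self, one_smul]
    have : sg c.length • (if c = [] then K (a ++ g :: d) b else 0) =
        if c = [] then K (a ++ g :: d) b else 0 := by split_ifs with h <;> simp [h]
    rw [this]
    abel
  simp only [hl, hr, crossSum_add, crossSum_sub, e1, e2, e3, e4, e56, e78]
  rw [crossSum_barDelta_left v w fun a b c d g => K (a ++ g :: d) (c ++ g⁻¹ :: b),
    crossSum_barDelta_right v w fun a b c d g => K (a ++ g :: d) (c ++ g⁻¹ :: b)]
  abel

end WordIdentities

/-! ### The double bracket of functions on words -/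

section Bracket

variable {G R : Type*} [CommRing R]

/-- The concatenation product of functions on words. -/
def conv (f h : List G → R) (w : List G) : R := splitSum w fun a b => f a * h b

lemma splitSum_mul_left (w : List G) (r : R) (F : List G → List G → R) :
    r * splitSum w F = splitSum w (fun a b => r * F a b) :=
  Finset.mul_sum _ _ _

lemma splitSum_mul_right (w : List G) (r : R) (F : List G → List G → R) :
    splitSum w F * r = splitSum w (fun a b => F a b * r) :=
  Finset.sum_mul _ _ _

variable [Fintype G]

lemma crossSum_mul_right (v w : List G) (F : List G → List G → List G → List G → G → R) (r : R) :
    crossSum v w F * r = crossSum v w (fun a b c d g => F a b c d g * r) :=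
  map_crossSum (AddMonoidHom.mulRight r) v w F

variable [Group G]

/-- The double bracket `∑ (-1)^|a| f(a g d) h(c g⁻¹ b)` over all `v = a b`, `w = c d`, `g ∈ G`. -/
def bracket (f h : List G → R) (w v : List G) : R :=
  crossSum v w fun a b c d g => sg a.length • (f (a ++ g :: d) * h (c ++ g⁻¹ :: b))

/-- The double bracket is a double derivation for the concatenation product. -/
lemma bracket_conv (f₁ f₂ h : List G → R) (w v : List G) :
    bracket (conv f₁ f₂) h w v =
      splitSum w (fun a b => f₂ b * bracket f₁ h a v) +
      splitSum v (fun a b => sg a.length • (f₁ a * bracket f₂ h w b)) := by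
  simp only [bracket, crossSum, conv, splitSum_append_cons, add_mul, smul_add,
    Finset.sum_add_distrib, splitSum_add]
  rw [add_comm]
  simp only [splitSum_sum, splitSum_mul_right, splitSum_mul_left, Finset.mul_sum, Finset.smul_sum,
    ← splitSum_zsmul]
  refine congrArg₂ (· + ·) ?_ ?_
  · refine Finset.sum_congr rfl fun g _ => ?_
    rw [splitSum_comm w v]
    refine splitSum_congr fun a b _ => ?_
    rw [← splitSum_assoc]
    refine splitSum_congr fun c d _ => splitSum_congr fun p q _ => ?_
    rw [mul_smul_comm]
    congr 1
    ring
  · refine Finset.sum_congr rfl fun g _ => ?_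
    have : ∀ a b : List G, splitSum w (fun c d => splitSum a fun p q =>
        sg a.length • (f₁ p * f₂ (q ++ g :: d) * h (c ++ g⁻¹ :: b))) =
        splitSum a fun p q => splitSum w fun c d =>
          sg p.length • sg q.length • (f₁ p * f₂ (q ++ g :: d) * h (c ++ g⁻¹ :: b)) := by
      intro a b
      rw [splitSum_comm]
      refine splitSum_congr fun p q e => splitSum_congr fun c d _ => ?_
      rw [smul_smul, ← sg_add, ← e]
      simp
    simp only [this]
    rw [splitSum_assoc v fun p q b => splitSum w fun c d =>
      sg p.length • sg q.length • (f₁ p * f₂ (q ++ g :: d) * h (c ++ g⁻¹ :: b))]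
    refine splitSum_congr fun p q _ => splitSum_congr fun a b _ => splitSum_congr fun c d _ => ?_
    rw [mul_smul_comm, mul_assoc]

/-- The common summands of the double Jacobi identity: `v` is cut into three pieces. -/
def jacobiV (f h e : List G → R) (w u v : List G) : R :=
  ∑ g : G, ∑ g' : G, splitSum v fun v₁ r => splitSum r fun v₂ v₃ => splitSum w fun c d =>
    splitSum u fun p q => sg v₂.length •
      (f (v₁ ++ g :: d) * h (c ++ g⁻¹ :: (v₂ ++ g' :: q)) * e (p ++ g'⁻¹ :: v₃))

/-- The common summands of the double Jacobi identity: `u` is cut into three pieces. -/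
def jacobiU (f h e : List G → R) (w u v : List G) : R :=
  ∑ g : G, ∑ g' : G, splitSum u fun u₁ r => splitSum r fun u₂ u₃ => splitSum w fun c d =>
    splitSum v fun a b => sg u₂.length •
      (f (a ++ g' :: (u₂ ++ g :: d)) * h (c ++ g⁻¹ :: u₃) * e (u₁ ++ g'⁻¹ :: b))

/-- The common summands of the double Jacobi identity: `w` is cut into three pieces. -/
def jacobiW (f h e : List G → R) (w u v : List G) : R :=
  ∑ g : G, ∑ g' : G, splitSum w fun w₁ r => splitSum r fun w₂ w₃ => splitSum u fun p q =>
    splitSum v fun a b => sg w₂.length •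
      (f (a ++ g :: w₃) * h (w₁ ++ g' :: q) * e (p ++ g'⁻¹ :: (w₂ ++ g⁻¹ :: b)))

/-- The first of the three iterated operations in the double Jacobi identity. -/
lemma bracket_bracket_left (f h e : List G → R) (w u v : List G) :
    bracket (bracket f h w) e u v = jacobiV f h e w u v - jacobiU f h e w u v := by
  have key : ∀ (a q : List G) (g' : G) (x : R), sg a.length • (bracket f h w (a ++ g' :: q) * x) =
      ∑ g : G, splitSum a (fun a₁ a₂ => splitSum w fun c d => sg a₂.length •
        (f (a₁ ++ g :: d) * h (c ++ g⁻¹ :: (a₂ ++ g' :: q)) * x)) -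
      ∑ g : G, splitSum q (fun q₁ q₂ => splitSum w fun c d => sg q₁.length •
        (f (a ++ g' :: (q₁ ++ g :: d)) * h (c ++ g⁻¹ :: q₂) * x)) := by
    intro a q g' x
    simp only [bracket, crossSum, splitSum_append_cons, add_mul, smul_add, sub_eq_add_neg]
    simp only [splitSum_sum, splitSum_mul_right, Finset.sum_mul, Finset.smul_sum,
      ← splitSum_zsmul, ← splitSum_neg, ← Finset.sum_neg_distrib]
    congr 1
    · refine Finset.sum_congr rfl fun g _ => splitSum_congr fun a₁ a₂ ea =>
        splitSum_congr fun c d _ => ?_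
      rw [smul_mul_assoc, smul_smul, ← ea, List.length_append, Nat.cast_add, ← sg_add,
        sg_congr (b := a₂.length) (by omega)]
    · refine Finset.sum_congr rfl fun g _ => splitSum_congr fun q₁ q₂ _ =>
        splitSum_congr fun c d _ => ?_
      rw [smul_mul_assoc, smul_smul, List.length_append, List.length_cons, ← sg_add,
        sg_congr_neg (b := q₁.length) (by push_cast; omega), neg_smul]
      simp
  rw [bracket]
  simp only [key, crossSum_sub]
  congr 1
  · simp only [crossSum, jacobiV, splitSum_sum]
    rw [Finset.sum_comm]
    refine Finset.sum_congr rfl fun g _ => Finset.sum_congr rfl fun g' _ => ?_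
    rw [← splitSum_assoc v fun v₁ v₂ v₃ => splitSum w fun c d => splitSum u fun p q =>
      sg v₂.length • (f (v₁ ++ g :: d) * h (c ++ g⁻¹ :: (v₂ ++ g' :: q)) * e (p ++ g'⁻¹ :: v₃))]
    refine splitSum_congr fun a b _ => ?_
    rw [splitSum_comm]
    exact splitSum_congr fun v₁ v₂ _ => splitSum_comm _ _ _
  · simp only [crossSum, jacobiU, splitSum_sum]
    rw [Finset.sum_comm]
    refine Finset.sum_congr rfl fun g _ => Finset.sum_congr rfl fun g' _ => ?_
    rw [splitSum_comm]
    refine splitSum_congr fun p q _ => ?_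
    rw [splitSum_comm]
    exact splitSum_congr fun u₂ u₃ _ => splitSum_comm _ _ _

/-- The second of the three iterated operations in the double Jacobi identity; the degree of `f`
is `n`. -/
lemma crossSum_bracket (f h e : List G → R) (w u v : List G) (n : ℤ)
    (hf : ∀ l, sg n • f l = sg l.length • f l) :
    sg n • crossSum u w (fun a b c d g =>
        sg d.length • (h (c ++ g :: b) * bracket f e (a ++ g⁻¹ :: d) v)) =
      jacobiU f h e w u v - jacobiW f h e w u v := by
  have key : ∀ (a d : List G) (g : G) (x : R),
      sg n • sg d.length • (x * bracket f e (a ++ g⁻¹ :: d) v) =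
      ∑ g' : G, splitSum a (fun a₁ a₂ => splitSum v fun s t => sg a₂.length •
        (f (s ++ g' :: (a₂ ++ g⁻¹ :: d)) * x * e (a₁ ++ g'⁻¹ :: t))) -
      ∑ g' : G, splitSum d (fun d₁ d₂ => splitSum v fun s t => sg d₁.length •
        (f (s ++ g' :: d₂) * x * e (a ++ g⁻¹ :: (d₁ ++ g'⁻¹ :: t)))) := by
    intro a d g x
    simp only [bracket, crossSum]
    rw [splitSum_comm]
    simp only [splitSum_append_cons, mul_add, smul_add, sub_eq_add_neg]
    simp only [splitSum_sum, splitSum_mul_left, Finset.mul_sum, Finset.smul_sum,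
      ← splitSum_zsmul, ← splitSum_neg, ← Finset.sum_neg_distrib]
    have hs : ∀ (l : List G) (m : ℤ) (y z : R), sg n • sg m • (x * (f l * y)) =
        sg (l.length + m) • (f l * x * y) := by
      intro l m y z
      rw [smul_smul, mul_comm, ← smul_smul, sg_add, mul_comm (sg _) (sg m), ← smul_smul]
      congr 1
      rw [show x * (f l * y) = f l * (x * y) by ring, mul_assoc, ← smul_mul_assoc, hf,
        smul_mul_assoc]
    congr 1
    · refine Finset.sum_congr rfl fun g' _ => splitSum_congr fun a₁ a₂ _ =>
        splitSum_congr fun s t _ => ?_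
      rw [mul_smul_comm, smul_smul (sg d.length), ← sg_add, hs _ _ _ 0]
      congr 1
      refine sg_congr ?_
      simp only [List.length_append, List.length_cons]
      push_cast
      omega
    · refine Finset.sum_congr rfl fun g' _ => splitSum_congr fun d₁ d₂ ed =>
        splitSum_congr fun s t _ => ?_
      rw [mul_smul_comm, smul_smul (sg d.length), ← sg_add, hs _ _ _ 0, ← neg_smul]
      congr 1
      · refine sg_congr_neg ?_
        simp only [List.length_append, List.length_cons, ← ed]
        push_cast
        omega
      · simp
  rw [← crossSum_zsmul]
  simp only [key, crossSum_sub]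
  congr 1
  · simp only [crossSum, jacobiU, splitSum_sum]
    rw [← Equiv.sum_comp (Equiv.inv G)]
    refine Finset.sum_congr rfl fun g _ => Finset.sum_congr rfl fun g' _ => ?_
    simp only [Equiv.inv_apply, inv_inv]
    rw [← splitSum_assoc u fun u₁ u₂ u₃ => splitSum w fun c d => splitSum v fun a b =>
      sg u₂.length • (f (a ++ g' :: (u₂ ++ g :: d)) * h (c ++ g⁻¹ :: u₃) * e (u₁ ++ g'⁻¹ :: b))]
    refine splitSum_congr fun a b _ => ?_
    rw [splitSum_comm]
  · simp only [crossSum, jacobiW, splitSum_sum]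
    rw [Finset.sum_comm]
    refine Finset.sum_congr rfl fun g _ => Finset.sum_congr rfl fun g' _ => ?_
    rw [splitSum_comm]
    refine splitSum_congr fun c d _ => ?_
    rw [splitSum_comm]

/-- The third of the three iterated operations in the double Jacobi identity; the degree of `f`
is `n`. -/
lemma bracket_bracket_right (f h e : List G → R) (w u v : List G) (n : ℤ)
    (hf : ∀ l, sg n • f l = sg l.length • f l) :
    sg (n + w.length + 1) • bracket f (bracket h e u) w v =
      jacobiW f h e w u v - jacobiV f h e w u v := by
  have key : ∀ (a b c d : List G) (g : G), c ++ d = w →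
      sg (n + w.length + 1) • sg a.length •
        (f (a ++ g :: d) * bracket h e u (c ++ g⁻¹ :: b)) =
      ∑ g' : G, splitSum c (fun c₁ c₂ => splitSum u fun p q => sg c₂.length •
        (f (a ++ g :: d) * h (c₁ ++ g' :: q) * e (p ++ g'⁻¹ :: (c₂ ++ g⁻¹ :: b)))) -
      ∑ g' : G, splitSum b (fun b₁ b₂ => splitSum u fun p q => sg b₁.length •
        (f (a ++ g :: d) * h (c ++ g⁻¹ :: (b₁ ++ g' :: q)) * e (p ++ g'⁻¹ :: b₂))) := by
    intro a b c d g ew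
    have hs : ∀ (y : R), sg (n + w.length + 1) • sg a.length • (f (a ++ g :: d) * y) =
        sg c.length • (f (a ++ g :: d) * y) := by
      intro y
      rw [add_assoc, sg_add, mul_smul, smul_comm (sg n), smul_comm (sg n), ← smul_mul_assoc, hf,
        smul_mul_assoc, smul_smul, smul_smul, ← sg_add, ← sg_add]
      congr 1
      refine sg_congr ?_
      simp only [List.length_append, List.length_cons, ← ew]
      push_cast
      omega
    rw [hs]
    simp only [bracket, crossSum, splitSum_append_cons, mul_add, smul_add, sub_eq_add_neg]
    simp only [splitSum_sum, splitSum_mul_left, Finset.mul_sum, Finset.smul_sum,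
      ← splitSum_zsmul, ← splitSum_neg, ← Finset.sum_neg_distrib]
    congr 1
    · refine Finset.sum_congr rfl fun g _ => splitSum_congr fun c₁ c₂ ec =>
        splitSum_congr fun p q _ => ?_
      rw [mul_smul_comm, smul_smul, ← ec, List.length_append, Nat.cast_add, ← sg_add,
        sg_congr (b := c₂.length) (by omega), mul_assoc]
    · refine Finset.sum_congr rfl fun g _ => splitSum_congr fun b₁ b₂ _ =>
        splitSum_congr fun p q _ => ?_
      rw [mul_smul_comm, smul_smul, List.length_append, List.length_cons, ← sg_add,
        sg_congr_neg (b := b₁.length) (by push_cast; omega), neg_smul]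
      simp [mul_assoc]
  rw [bracket, ← crossSum_zsmul, crossSum_congr fun a b c d g _ ew => key a b c d g ew,
    crossSum_sub]
  congr 1
  · simp only [crossSum, jacobiW, splitSum_sum]
    refine Finset.sum_congr rfl fun g _ => Finset.sum_congr rfl fun g' _ => ?_
    rw [← splitSum_assoc w fun w₁ w₂ w₃ => splitSum u fun p q => splitSum v fun a b =>
      sg w₂.length • (f (a ++ g :: w₃) * h (w₁ ++ g' :: q) * e (p ++ g'⁻¹ :: (w₂ ++ g⁻¹ :: b)))]
    rw [splitSum_comm]
    refine splitSum_congr fun c d _ => ?_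
    rw [splitSum_comm]
    exact splitSum_congr fun c d _ => splitSum_comm _ _ _
  · simp only [crossSum, jacobiV, splitSum_sum]
    refine Finset.sum_congr rfl fun g _ => Finset.sum_congr rfl fun g' _ => ?_
    refine splitSum_congr fun a b _ => ?_
    rw [splitSum_comm]

/-- The double Jacobi identity for the double bracket; it holds strictly. -/
lemma bracket_jacobi (f h e : List G → R) (w u v : List G) (n : ℤ)
    (hf : ∀ l, sg n • f l = sg l.length • f l) :
    bracket (bracket f h w) e u v
    + sg n • crossSum u w (fun a b c d g =>
        sg d.length • (h (c ++ g :: b) * bracket f e (a ++ g⁻¹ :: d) v))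
    + sg (n + w.length + 1) • bracket f (bracket h e u) w v = 0 := by
  rw [bracket_bracket_left, crossSum_bracket f h e w u v n hf,
    bracket_bracket_right f h e w u v n hf]
  abel

end Bracket

/-! ### Twisted coordinates on the Tate-Hochschild complex -/

section Twisted

variable (k : Type*) [Field k] {G : Type*} [CommGroup G]

lemma gp_mul (a b : G) : gp k a * gp k b = gp k (a * b) := by simp

@[simp] lemma gp_one : gp k (1 : G) = 1 := rfl

lemma gp_inv_mul (a : G) : gp k a⁻¹ * gp k a = 1 := by rw [gp_mul, inv_mul_cancel, gp_one]

lemma gp_mul_inv (a : G) : gp k a * gp k a⁻¹ = 1 := by rw [gp_mul, mul_inv_cancel, gp_one]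

variable {k} in
lemma monoidAlgebra_induction {P : MonoidAlgebra k G → Prop} (x : MonoidAlgebra k G)
    (add : ∀ x y, P x → P y → P (x + y)) (smul : ∀ (c : k) (x), P x → P (c • x))
    (gp : ∀ g, P (gp k g)) : P x := by
  induction x using MonoidAlgebra.induction_linear with
  | zero => simpa using smul 0 _ (gp 1)
  | add x y hx hy => exact add x y hx hy
  | single g c => simpa using smul c _ (gp g)

variable {k} in
/-- `f` is supported on the words of length `n` without entry `1`. -/
def IsCoch (n : ℕ) (f : List G → MonoidAlgebra k G) : Prop :=
  ∀ l, f l ≠ 0 → l.length = n ∧ ∀ g ∈ l, g ≠ 1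

/-- The cochain `l ↦ f(l) g₁⋯g_n`, where `l = (g₁, …, g_n)`, in the total space. -/
def coch (f : List G → MonoidAlgebra k G) (n : ℕ) : ⨁ i, TateHoch k G i :=
  inC k (HochCochain k G) (HochChain k G) n fun l => f l.1 * gp k l.1.prod

/-- The chain `(ρ (g₁⋯g_n)⁻¹, g₁, …, g_n)`, where `w = (g₁, …, g_n)`, in the total space; it
vanishes if some `g_i` is `1`. -/
def chn (w : List G) : MonoidAlgebra k G →ₗ[k] ⨁ i, TateHoch k G i :=
  inH k (HochCochain k G) (HochChain k G) w.length ∘ₗ chainAt k w.length w ∘ₗ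
    LinearMap.mulRight k (gp k w.prod⁻¹)

variable {k}

/-- The products occurring in the ternary product, in twisted coordinates. -/
lemma gp_prod_take_drop (l w : List G) (r g : G) (p i : ℕ) :
    gp k (l.take p ++ g :: w.drop i).prod * gp k (r * w.prod⁻¹) *
      gp k (w.take i ++ g⁻¹ :: l.drop p).prod = gp k r * gp k l.prod := by
  have h1 : w.prod = (w.take i).prod * (w.drop i).prod := by
    rw [← List.prod_append, List.take_append_drop]
  have h2 : l.prod = (l.take p).prod * (l.drop p).prod := by
    rw [← List.prod_append, List.take_append_drop]
  rw [gp_mul, gp_mul, gp_mul, h1, h2]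
  congr 1
  simp only [List.prod_append, List.prod_cons]
  apply Additive.ofMul.injective
  simp only [ofMul_mul, ofMul_inv]
  abel

lemma IsCoch.eq_zero_of_length {n : ℕ} {f : List G → MonoidAlgebra k G} (hf : IsCoch n f)
    {l : List G} (h : l.length ≠ n) : f l = 0 := by
  by_contra h'
  exact h (hf l h').1

lemma IsCoch.eq_zero_of_mem {n : ℕ} {f : List G → MonoidAlgebra k G} (hf : IsCoch n f)
    {l : List G} (h : (1 : G) ∈ l) : f l = 0 := by
  by_contra h'
  exact (hf l h').2 1 h rfl

lemma IsCoch.sg_smul {n : ℕ} {f : List G → MonoidAlgebra k G} (hf : IsCoch n f) (l : List G) :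
    sg n • f l = sg l.length • f l := by
  by_cases h : f l = 0
  · simp [h]
  · rw [(hf l h).1]

lemma isCoch_evalAt {n : ℕ} (φ : HochCochain k G n) :
    IsCoch n (fun l => evalAt k l φ * gp k l.prod⁻¹) := by
  intro l hl
  by_contra h
  exact hl (by simp [evalAt, dif_neg h])

lemma inC_eq_coch {n : ℕ} (φ : HochCochain k G n) :
    inC k (HochCochain k G) (HochChain k G) n φ =
      coch k (fun l => evalAt k l φ * gp k l.prod⁻¹) n := by
  rw [coch]
  congr 1
  funext l
  rw [evalAt, dif_pos l.2, mul_assoc, gp_inv_mul, mul_one]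
  rfl

lemma evalAt_mul_prod {n : ℕ} {f : List G → MonoidAlgebra k G} (hf : IsCoch n f) (l : List G) :
    evalAt k l (fun l : BarTuple G n => f l.1 * gp k l.1.prod) = f l * gp k l.prod := by
  rw [evalAt]
  split_ifs with h
  · rfl
  · by_cases h' : f l = 0
    · simp [h']
    · exact absurd (hf l h') h

lemma coch_congr {n : ℕ} {f f' : List G → MonoidAlgebra k G}
    (h : ∀ l, l.length = n → f l = f' l) : coch k f n = coch k f' n := by
  rw [coch, coch]
  congr 1
  funext l
  rw [h _ l.2.1]

@[simp] lemma coch_zero (n : ℕ) : coch k (fun _ : List G => 0) n = 0 := by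
  rw [coch]
  simp only [zero_mul]
  exact map_zero _

lemma coch_eq_zero {n : ℕ} {f : List G → MonoidAlgebra k G}
    (h : ∀ l, l.length = n → f l = 0) : coch k f n = 0 := by
  rw [coch_congr h, coch_zero]

lemma coch_add (f f' : List G → MonoidAlgebra k G) (n : ℕ) :
    coch k (fun l => f l + f' l) n = coch k f n + coch k f' n := by
  rw [coch, coch, coch, ← map_add]
  congr 1
  funext l
  exact add_mul _ _ _

lemma coch_smul (c : k) (f : List G → MonoidAlgebra k G) (n : ℕ) :
    coch k (fun l => c • f l) n = c • coch k f n := by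
  rw [coch, coch, ← map_smul]
  congr 1
  funext l
  exact smul_mul_assoc _ _ _

lemma coch_zsmul (c : ℤ) (f : List G → MonoidAlgebra k G) (n : ℕ) :
    coch k (fun l => c • f l) n = c • coch k f n := by
  rw [coch, coch, ← map_zsmul]
  congr 1
  funext l
  exact smul_mul_assoc _ _ _

lemma coch_neg (f : List G → MonoidAlgebra k G) (n : ℕ) :
    coch k (fun l => -f l) n = -coch k f n := by
  simpa using coch_zsmul (-1) f n

lemma chn_apply (w : List G) (ρ : MonoidAlgebra k G) :
    chn k w ρ = inH k (HochCochain k G) (HochChain k G) w.length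
      (chainAt k w.length w (ρ * gp k w.prod⁻¹)) := rfl

lemma chainAt_of_mem {s : ℕ} {w : List G} (h : (1 : G) ∈ w) : chainAt k s w = 0 := by
  rw [chainAt, dif_neg]
  rintro ⟨-, h'⟩
  exact h' 1 h rfl

lemma chn_of_mem {w : List G} (h : (1 : G) ∈ w) : chn k w = 0 := by
  ext1
  simp [chn, chainAt_of_mem h]

lemma inH_chainAt {s : ℕ} {w : List G} (h : w.length = s) (a : MonoidAlgebra k G) :
    inH k (HochCochain k G) (HochChain k G) s (chainAt k s w a) = chn k w (a * gp k w.prod) := by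
  subst h
  rw [chn_apply, mul_assoc, gp_mul_inv, mul_one]

lemma chn_gp {w : List G} (hw : ∀ g ∈ w, g ≠ 1) (r : G) :
    chn k w (gp k r) = inH k (HochCochain k G) (HochChain k G) w.length
      (Finsupp.single (r * w.prod⁻¹, (⟨w, rfl, hw⟩ : BarTuple G w.length)) 1) := by
  rw [chn_apply, gp_mul, chainAt, dif_pos ⟨rfl, hw⟩]
  congr 1
  simp [gp]

/-- A formula for a linear function of a chain needs to be checked only on normalized words with
a group element as coefficient. -/
lemma eq_of_eq_on_chn {X : Type*} [AddCommGroup X] [Module k X] (w : List G)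
    (L : (⨁ i, TateHoch k G i) →ₗ[k] X) (F : MonoidAlgebra k G → X)
    (hadd : ∀ x y, F (x + y) = F x + F y) (hsmul : ∀ (c : k) (x), F (c • x) = c • F x)
    (h1 : (1 : G) ∈ w → ∀ ρ, F ρ = 0)
    (h : ∀ (hw : ∀ g ∈ w, g ≠ 1) (r : G),
      L (inH k (HochCochain k G) (HochChain k G) w.length
        (Finsupp.single (r * w.prod⁻¹, (⟨w, rfl, hw⟩ : BarTuple G w.length)) 1)) = F (gp k r))
    (ρ : MonoidAlgebra k G) : L (chn k w ρ) = F ρ := by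
  by_cases hw : (1 : G) ∈ w
  · rw [chn_of_mem hw, h1 hw]
    simp
  · have hw' : ∀ g ∈ w, g ≠ 1 := fun g hg e => hw (e ▸ hg)
    induction ρ using monoidAlgebra_induction with
    | add x y hx hy => rw [map_add, map_add, hx, hy, hadd]
    | smul c x hx => rw [map_smul, map_smul, hx, hsmul]
    | gp r => rw [chn_gp hw', h hw']

lemma splitSum_smul {α X : Type*} [AddCommGroup X] [Module k X] (w : List α) (c : k)
    (F : List α → List α → X) : splitSum w (fun a b => c • F a b) = c • splitSum w F :=
  Finset.smul_sum.symm

lemma splitSum_eq_term {α N : Type*} [AddCommMonoid N] {w : List α} {F : List α → List α → N}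
    (i : ℕ) (h : ∀ a b, a ++ b = w → a.length ≠ i → F a b = 0) :
    splitSum w F = F (w.take i) (w.drop i) := by
  rcases le_or_gt i w.length with hi | hi
  · rw [splitSum, Finset.sum_eq_single i]
    · intro j hj hji
      refine h _ _ (List.take_append_drop j w) ?_
      have := Finset.mem_range.1 hj
      rw [List.length_take]
      omega
    · intro hi'
      exact absurd (Finset.mem_range.2 (by omega)) hi'
  · rw [List.take_of_length_le hi.le, List.drop_eq_nil_of_le hi.le,
      h w [] (List.append_nil w) (by omega)]
    refine splitSum_eq_zero fun a b e => h a b e ?_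
    have := congrArg List.length e
    simp at this
    omega

lemma contract_cons {i : ℕ} (hi : 1 ≤ i) (x : G) (l : List G) :
    contract (i + 1) (x :: l) = x :: contract i l := by
  obtain ⟨i, rfl⟩ : ∃ j, i = j + 1 := ⟨i - 1, by omega⟩
  simp [contract]

lemma prod_contract {i : ℕ} (hi : 1 ≤ i) (l : List G) : (contract i l).prod = l.prod := by
  obtain ⟨i, rfl⟩ : ∃ j, i = j + 1 := ⟨i - 1, by omega⟩
  rw [contract, Nat.add_sub_cancel, List.prod_append, List.prod_cons]
  conv_rhs => rw [← List.take_append_drop i l, List.prod_append,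
    ← List.take_append_drop 2 (l.drop i), List.prod_append, List.drop_drop]

lemma length_contract {i n : ℕ} (hi : 1 ≤ i) (hn : i ≤ n) {l : List G} (hl : l.length = n + 1) :
    (contract i l).length = n := by
  simp only [contract, List.length_append, List.length_take, List.length_cons, List.length_drop]
  omega

lemma sum_Icc_one {M : Type*} [AddCommMonoid M] (n : ℕ) (f : ℕ → M) :
    ∑ i ∈ Finset.Icc 1 n, f i = ∑ i ∈ Finset.range n, f (i + 1) := by
  induction n with
  | zero => simp
  | succ n ih => rw [Finset.sum_Icc_succ_top (by omega), ih, Finset.sum_range_succ]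

lemma mergeSum_eq_sum {M : Type*} [AddCommGroup M] (F : List G → M) {n : ℕ} {l : List G}
    (hl : l.length = n + 1) :
    mergeSum l F = ∑ i ∈ Finset.Icc 1 n, sg i • F (contract i l) := by
  induction n generalizing l F with
  | zero =>
    obtain ⟨x, rfl⟩ := List.length_eq_one_iff.1 hl
    simp
  | succ n ih =>
    obtain ⟨x, l, rfl⟩ := List.exists_cons_of_length_eq_add_one hl
    have hl' : l.length = n + 1 := by simpa using hl
    rw [mergeSum_cons, ih _ hl', sum_Icc_one, sum_Icc_one, Finset.sum_range_succ', add_comm,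
      sub_eq_add_neg, ← Finset.sum_neg_distrib]
    congr 1
    · obtain ⟨y, l, rfl⟩ := List.exists_cons_of_length_eq_add_one hl'
      simp [contract]
    · refine Finset.sum_congr rfl fun i _ => ?_
      rw [contract_cons (by omega), sg_congr_neg (a := ((i + 1 + 1 : ℕ) : ℤ))
        (b := ((i + 1 : ℕ) : ℤ)) (by push_cast; omega), neg_smul]

lemma barDelta_eq_sum {M : Type*} [AddCommGroup M] (F : List G → M) {n : ℕ} {l : List G}
    (hl : l.length = n + 1) :
    barDelta F l = F (l.drop 1) + ∑ i ∈ Finset.Icc 1 n, sg i • F (contract i l) +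
      sg (n + 1 : ℕ) • F (l.take n) := by
  have h1 : headTerm (fun _ b => F b) l = F (l.drop 1) := by
    obtain ⟨x, l, rfl⟩ := List.exists_cons_of_length_eq_add_one hl
    simp
  have h2 : lastTerm (fun a _ => F a) l = F (l.take n) := by
    rcases List.eq_nil_or_concat l with rfl | ⟨l, x, rfl⟩
    · simp at hl
    · have : l.length = n := by simpa using hl
      simp [lastTerm, ← this]
  rw [barDelta, h1, h2, mergeSum_eq_sum F hl, hl]

end Twisted

/-! ### The operations in twisted coordinates -/

section Operations

variable {k : Type*} [Field k] {G : Type*} [CommGroup G]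

lemma basisLift_single_one {X U T : Type*} [AddCommMonoid U] [Module k U] [AddCommMonoid T]
    [Module k T] (f : X → U →ₗ[k] T) (x : X) : basisLift f (Finsupp.single x 1) = f x := by
  simp [basisLift]

variable [Fintype G]

variable (k G) in
/-- The differential `m₁` of the Tate-Hochschild complex. -/
def tateDiff : (⨁ i, TateHoch k G i) →ₗ[k] ⨁ i, TateHoch k G i :=
  splicedDifferential (hochDelta k G) (hochTrace k G) (hochDel k G)

variable (k G) in
/-- The product `m₂` of the Tate-Hochschild complex. -/
def tateCup : (⨁ i, TateHoch k G i) →ₗ[k] (⨁ i, TateHoch k G i) →ₗ[k] ⨁ i, TateHoch k G i :=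
  extend₂ (cupDeg k G)

variable (k G) in
/-- The product `m₃` of the Tate-Hochschild complex. -/
def tateTriple : (⨁ i, TateHoch k G i) →ₗ[k] (⨁ i, TateHoch k G i) →ₗ[k]
    (⨁ i, TateHoch k G i) →ₗ[k] ⨁ i, TateHoch k G i :=
  extend₃ (m3Deg k G)

lemma tateCup_inC_inH_of_le {n t : ℕ} (h : n ≤ t) (φ : HochCochain k G n) (η : HochChain k G t) :
    tateCup k G (inC k _ _ n φ) (inH k _ _ t η) = inH k _ _ (t - n) (capCH k G n t φ η) := by
  have e : cupDeg k G (Int.ofNat n) (Int.negSucc t) =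
      (capCH k G n t).compr₂ (inH k _ _ (t - n)) := if_pos h
  refine (extend₂_lof (cupDeg k G) (Int.ofNat n) (Int.negSucc t) φ η).trans ?_
  rw [e]
  rfl

lemma tateCup_inC_inH_of_lt {n t : ℕ} (h : t < n) (φ : HochCochain k G n) (η : HochChain k G t) :
    tateCup k G (inC k _ _ n φ) (inH k _ _ t η) = inC k _ _ (n - t - 1) (gcapCH k G n t φ η) := by
  have e : cupDeg k G (Int.ofNat n) (Int.negSucc t) =
      (gcapCH k G n t).compr₂ (inC k _ _ (n - t - 1)) := if_neg (not_le.2 h)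
  refine (extend₂_lof (cupDeg k G) (Int.ofNat n) (Int.negSucc t) φ η).trans ?_
  rw [e]
  rfl

lemma tateCup_inH_inC_of_le {n t : ℕ} (h : n ≤ t) (φ : HochCochain k G n) (η : HochChain k G t) :
    tateCup k G (inH k _ _ t η) (inC k _ _ n φ) = inH k _ _ (t - n) (capHC k G t n η φ) := by
  have e : cupDeg k G (Int.negSucc t) (Int.ofNat n) =
      (capHC k G t n).compr₂ (inH k _ _ (t - n)) := if_pos h
  refine (extend₂_lof (cupDeg k G) (Int.negSucc t) (Int.ofNat n) η φ).trans ?_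
  rw [e]
  rfl

lemma tateCup_inH_inC_of_lt {n t : ℕ} (h : t < n) (φ : HochCochain k G n) (η : HochChain k G t) :
    tateCup k G (inH k _ _ t η) (inC k _ _ n φ) = inC k _ _ (n - t - 1) (gcapHC k G t n η φ) := by
  have e : cupDeg k G (Int.negSucc t) (Int.ofNat n) =
      (gcapHC k G t n).compr₂ (inC k _ _ (n - t - 1)) := if_neg (not_le.2 h)
  refine (extend₂_lof (cupDeg k G) (Int.negSucc t) (Int.ofNat n) η φ).trans ?_
  rw [e]
  rfl

lemma tateCup_coch_coch {n m : ℕ} {f h : List G → MonoidAlgebra k G} (hf : IsCoch n f)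
    (hh : IsCoch m h) :
    tateCup k G (coch k f n) (coch k h m) = coch k (conv f h) (n + m) := by
  refine (extend₂_lof (cupDeg k G) (Int.ofNat n) (Int.ofNat m) _ _).trans ?_
  refine congrArg (inC k (HochCochain k G) (HochChain k G) (n + m)) ?_
  funext l
  refine (congrArg₂ (· * ·) (evalAt_mul_prod hf _) (evalAt_mul_prod hh _)).trans ?_
  rw [conv, splitSum_eq_term n]
  · conv_rhs => rw [← List.take_append_drop n l.1, List.prod_append, ← gp_mul]
    simp only [List.take_append_drop]
    ring
  · intro a b _ ha
    rw [hf.eq_zero_of_length ha, zero_mul]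

lemma tateCup_chn_chn (w v : List G) (ρ σ : MonoidAlgebra k G) :
    tateCup k G (chn k w ρ) (chn k v σ) = ∑ g : G, chn k (v ++ g :: w) (ρ * σ) := by
  refine eq_of_eq_on_chn w ((tateCup k G).flip (chn k v σ))
    (fun ρ => ∑ g : G, chn k (v ++ g :: w) (ρ * σ)) ?_ ?_ ?_ ?_ ρ
  · intro x y
    simp only [add_mul, map_add, Finset.sum_add_distrib]
  · intro c x
    simp only [smul_mul_assoc, map_smul, Finset.smul_sum]
  · intro h ρ
    exact Finset.sum_eq_zero fun g _ => by rw [chn_of_mem (by simp [h])]; rfl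
  intro hw r
  refine eq_of_eq_on_chn v (tateCup k G (inH k _ _ w.length (Finsupp.single _ 1)))
    (fun σ => ∑ g : G, chn k (v ++ g :: w) (gp k r * σ)) ?_ ?_ ?_ ?_ σ
  · intro x y
    simp only [mul_add, map_add, Finset.sum_add_distrib]
  · intro c x
    simp only [mul_smul_comm, map_smul, Finset.smul_sum]
  · intro h ρ
    exact Finset.sum_eq_zero fun g _ => by rw [chn_of_mem (by simp [h])]; rfl
  intro hv s
  refine (extend₂_lof (cupDeg k G) (Int.negSucc w.length) (Int.negSucc v.length) _ _).trans ?_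
  refine (congrArg (inH k (HochCochain k G) (HochChain k G) (w.length + v.length + 1))
    (?_ : _ = ∑ g : G, chainAt k (w.length + v.length + 1) (v ++ (g⁻¹ * (r * w.prod⁻¹)) :: w)
      (gp k g * gp k (s * v.prod⁻¹)))).trans ?_
  · simp [cupHH, basisLift]
  · rw [map_sum, ← Equiv.sum_comp ((Equiv.inv G).trans (Equiv.mulRight (r * w.prod⁻¹)))
      fun g => chn k (v ++ g :: w) (gp k r * gp k s)]
    refine Finset.sum_congr rfl fun g _ => ?_
    rw [inH_chainAt (by simp; omega)]
    simp only [Equiv.trans_apply, Equiv.inv_apply, Equiv.coe_mulRight, gp_mul]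
    refine congrArg (chn k _) (congrArg (gp k) ?_)
    simp only [List.prod_append, List.prod_cons]
    apply Additive.ofMul.injective
    simp only [ofMul_mul, ofMul_inv]
    abel

/-- The generalized cap product. The two summands live in different degrees: the first is nonzero
only for `n ≤ |w|`, the second only for `|w| < n`, so that no case distinction is needed. -/
lemma tateCup_coch_chn {n : ℕ} {f : List G → MonoidAlgebra k G} (hf : IsCoch n f) (w : List G)
    (ρ : MonoidAlgebra k G) :
    tateCup k G (coch k f n) (chn k w ρ) = splitSum w (fun a b => chn k a (f b * ρ)) +
      coch k (fun u => (∑ g : G, f (u ++ g :: w)) * ρ) (n - w.length - 1) := by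
  refine eq_of_eq_on_chn w (tateCup k G (coch k f n)) (fun ρ => splitSum w
    (fun a b => chn k a (f b * ρ)) +
      coch k (fun u => (∑ g : G, f (u ++ g :: w)) * ρ) (n - w.length - 1)) ?_ ?_ ?_ ?_ ρ
  · intro x y
    simp only [mul_add, map_add, splitSum_add, coch_add]
    abel
  · intro c x
    simp only [mul_smul_comm, map_smul, splitSum_smul, coch_smul, smul_add]
  · intro h ρ
    rw [splitSum_eq_zero, coch_eq_zero, add_zero]
    · intro l _
      rw [Finset.sum_eq_zero fun g _ => hf.eq_zero_of_mem (by simp [h]), zero_mul]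
    · intro a b e
      rw [← e, List.mem_append] at h
      rcases h with h | h
      · rw [chn_of_mem h]; rfl
      · rw [hf.eq_zero_of_mem h, zero_mul, map_zero]
  intro hw r
  rcases le_or_gt n w.length with hn | hn
  · have hz : coch k (fun u => (∑ g : G, f (u ++ g :: w)) * gp k r) (n - w.length - 1) = 0 := by
      refine coch_eq_zero fun l _ => ?_
      rw [Finset.sum_eq_zero fun g _ => hf.eq_zero_of_length (by simp; omega), zero_mul]
    rw [hz, add_zero, splitSum_eq_term (w.length - n)]
    · refine (tateCup_inC_inH_of_le hn _ _).trans ((congrArg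
        (inH k (HochCochain k G) (HochChain k G) (w.length - n))
        (?_ : _ = chainAt k (w.length - n) (w.take (w.length - n))
          (evalAt k (w.drop (w.length - n)) (fun l : BarTuple G n => f l.1 * gp k l.1.prod) *
            gp k (r * w.prod⁻¹)))).trans ?_)
      · simp [capCH, basisLift]
        exact congrArg _ (mul_comm _ _)
      · rw [inH_chainAt (by simp), evalAt_mul_prod hf, ← gp_mul]
        congr 1
        have h1 : gp k (w.take (w.length - n)).prod * gp k (w.drop (w.length - n)).prod *
            gp k w.prod⁻¹ = 1 := by
          rw [gp_mul, ← List.prod_append, List.take_append_drop, gp_mul_inv]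
        linear_combination (f (w.drop (w.length - n)) * gp k r) * h1
    · intro a b e ha
      rw [hf.eq_zero_of_length, zero_mul, map_zero]
      have := congrArg List.length e
      rw [List.length_append] at this
      omega
  · have hz : splitSum w (fun a b => chn k a (f b * gp k r)) = 0 := by
      refine splitSum_eq_zero fun a b e => ?_
      rw [hf.eq_zero_of_length, zero_mul, map_zero]
      have := congrArg List.length e
      rw [List.length_append] at this
      omega
    rw [hz, zero_add]
    refine (tateCup_inC_inH_of_lt hn _ _).trans
      (congrArg (inC k (HochCochain k G) (HochChain k G) (n - w.length - 1)) ?_)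
    funext l
    refine (?_ : _ = ∑ g : G, evalAt k (l.1 ++ g⁻¹ :: w)
      (fun l : BarTuple G n => f l.1 * gp k l.1.prod) *
        (gp k (r * w.prod⁻¹) * gp k g)).trans ?_
    · simp [gcapCH, basisLift]
      exact Finset.sum_congr rfl fun _ _ => mul_comm _ _
    · beta_reduce
      rw [← Equiv.sum_comp (Equiv.inv G), Finset.sum_mul, Finset.sum_mul]
      refine Finset.sum_congr rfl fun g _ => ?_
      rw [Equiv.inv_apply, inv_inv, evalAt_mul_prod hf, mul_assoc, mul_assoc, gp_mul, gp_mul,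
          gp_mul]
      congr 2
      simp only [List.prod_append, List.prod_cons]
      apply Additive.ofMul.injective
      simp only [ofMul_mul, ofMul_inv]
      abel

lemma tateCup_chn_coch {n : ℕ} {f : List G → MonoidAlgebra k G} (hf : IsCoch n f) (w : List G)
    (ρ : MonoidAlgebra k G) :
    tateCup k G (chn k w ρ) (coch k f n) = splitSum w (fun a b => chn k b (f a * ρ)) +
      coch k (fun u => (∑ g : G, f (w ++ g :: u)) * ρ) (n - w.length - 1) := by
  refine eq_of_eq_on_chn w ((tateCup k G).flip (coch k f n)) (fun ρ => splitSum w
    (fun a b => chn k b (f a * ρ)) +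
      coch k (fun u => (∑ g : G, f (w ++ g :: u)) * ρ) (n - w.length - 1)) ?_ ?_ ?_ ?_ ρ
  · intro x y
    simp only [mul_add, map_add, splitSum_add, coch_add]
    abel
  · intro c x
    simp only [mul_smul_comm, map_smul, splitSum_smul, coch_smul, smul_add]
  · intro h ρ
    rw [splitSum_eq_zero, coch_eq_zero, add_zero]
    · intro l _
      rw [Finset.sum_eq_zero fun g _ => hf.eq_zero_of_mem (by simp [h]), zero_mul]
    · intro a b e
      rw [← e, List.mem_append] at h
      rcases h with h | h
      · rw [hf.eq_zero_of_mem h, zero_mul, map_zero]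
      · rw [chn_of_mem h]; rfl
  intro hw r
  rcases le_or_gt n w.length with hn | hn
  · have hz : coch k (fun u => (∑ g : G, f (w ++ g :: u)) * gp k r) (n - w.length - 1) = 0 := by
      refine coch_eq_zero fun l _ => ?_
      rw [Finset.sum_eq_zero fun g _ => hf.eq_zero_of_length (by simp; omega), zero_mul]
    rw [hz, add_zero, splitSum_eq_term n]
    · refine (tateCup_inH_inC_of_le hn _ _).trans ((congrArg
        (inH k (HochCochain k G) (HochChain k G) (w.length - n))
        (?_ : _ = chainAt k (w.length - n) (w.drop n)
          (gp k (r * w.prod⁻¹) *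
            evalAt k (w.take n) (fun l : BarTuple G n => f l.1 * gp k l.1.prod)))).trans ?_)
      · simp [capHC, basisLift]
      · rw [inH_chainAt (by simp), evalAt_mul_prod hf, ← gp_mul]
        congr 1
        have h1 : gp k (w.take n).prod * gp k (w.drop n).prod * gp k w.prod⁻¹ = 1 := by
          rw [gp_mul, ← List.prod_append, List.take_append_drop, gp_mul_inv]
        linear_combination (f (w.take n) * gp k r) * h1
    · intro a b e ha
      rw [hf.eq_zero_of_length ha, zero_mul, map_zero]
  · have hz : splitSum w (fun a b => chn k b (f a * gp k r)) = 0 := by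
      refine splitSum_eq_zero fun a b e => ?_
      rw [hf.eq_zero_of_length, zero_mul, map_zero]
      have := congrArg List.length e
      rw [List.length_append] at this
      omega
    rw [hz, zero_add]
    refine (tateCup_inH_inC_of_lt hn _ _).trans
      (congrArg (inC k (HochCochain k G) (HochChain k G) (n - w.length - 1)) ?_)
    funext l
    refine (?_ : _ = ∑ g : G, gp k g * gp k (r * w.prod⁻¹) * evalAt k (w ++ g⁻¹ :: l.1)
      (fun l : BarTuple G n => f l.1 * gp k l.1.prod)).trans ?_
    · simp [gcapHC, basisLift]
    · beta_reduce
      rw [← Equiv.sum_comp (Equiv.inv G), Finset.sum_mul, Finset.sum_mul]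
      refine Finset.sum_congr rfl fun g _ => ?_
      rw [Equiv.inv_apply, inv_inv, evalAt_mul_prod hf, mul_comm, mul_assoc, mul_assoc, gp_mul,
        gp_mul, gp_mul]
      congr 2
      simp only [List.prod_append, List.prod_cons]
      apply Additive.ofMul.injective
      simp only [ofMul_mul, ofMul_inv]
      abel

end Operations

section Operations

variable {k : Type*} [Field k] {G : Type*} [CommGroup G] [Fintype G]

lemma tateTriple_inC_inH_inC_of_le {m r n : ℕ} (h : r + 2 ≤ m + n) (φ : HochCochain k G m)
    (η : HochChain k G r) (ψ : HochCochain k G n) :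
    tateTriple k G (inC k _ _ m φ) (inH k _ _ r η) (inC k _ _ n ψ) =
      inC k _ _ (m + n - r - 2) (m3CHC k G m r n φ η ψ) := by
  have e : m3Deg k G (Int.ofNat m) (Int.negSucc r) (Int.ofNat n) = _ := if_pos h
  refine (extend₃_lof (m3Deg k G) (Int.ofNat m) (Int.negSucc r) (Int.ofNat n) φ η ψ).trans ?_
  rw [e]
  rfl

lemma tateTriple_inC_inH_inC_of_lt {m r n : ℕ} (h : m + n < r + 2) (φ : HochCochain k G m)
    (η : HochChain k G r) (ψ : HochCochain k G n) :
    tateTriple k G (inC k _ _ m φ) (inH k _ _ r η) (inC k _ _ n ψ) = 0 := by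
  have e : m3Deg k G (Int.ofNat m) (Int.negSucc r) (Int.ofNat n) = 0 := if_neg (not_le.2 h)
  refine (extend₃_lof (m3Deg k G) (Int.ofNat m) (Int.negSucc r) (Int.ofNat n) φ η ψ).trans ?_
  rw [e]
  rfl

lemma tateTriple_inH_inC_inH_of_le {r m s : ℕ} (h : m ≤ r + s + 1) (η : HochChain k G r)
    (φ : HochCochain k G m) (θ : HochChain k G s) :
    tateTriple k G (inH k _ _ r η) (inC k _ _ m φ) (inH k _ _ s θ) =
      inH k _ _ (r + s + 2 - m) (m3HCH k G r m s η φ θ) := by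
  have e : m3Deg k G (Int.negSucc r) (Int.ofNat m) (Int.negSucc s) = _ := if_pos h
  refine (extend₃_lof (m3Deg k G) (Int.negSucc r) (Int.ofNat m) (Int.negSucc s) η φ θ).trans ?_
  rw [e]
  rfl

lemma tateTriple_inH_inC_inH_of_lt {r m s : ℕ} (h : r + s + 1 < m) (η : HochChain k G r)
    (φ : HochCochain k G m) (θ : HochChain k G s) :
    tateTriple k G (inH k _ _ r η) (inC k _ _ m φ) (inH k _ _ s θ) = 0 := by
  have e : m3Deg k G (Int.negSucc r) (Int.ofNat m) (Int.negSucc s) = 0 := if_neg (not_le.2 h)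
  refine (extend₃_lof (m3Deg k G) (Int.negSucc r) (Int.ofNat m) (Int.negSucc s) η φ θ).trans ?_
  rw [e]
  rfl

lemma m3CHC_single {m n r : ℕ} (φ : HochCochain k G m) (x : G × BarTuple G r)
    (ψ : HochCochain k G n) (l : BarTuple G (m + n - r - 2)) :
    m3CHC k G m r n φ (Finsupp.single x 1) ψ l =
      ∑ g : G, ∑ j ∈ Finset.Icc (max 1 (r + 2 - m)) (min n (r + 1)),
        (-1 : k) ^ (m + r + j - 1) •
          (evalAt k (l.1.take (m + j - r - 2) ++ g :: x.2.1.drop (j - 1)) φ * gp k x.1 *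
            evalAt k (x.2.1.take (j - 1) ++ g⁻¹ :: l.1.drop (m + j - r - 2)) ψ) := by
  rw [m3CHC, LinearMap.flip_apply, basisLift_single_one]
  rfl

lemma m3HCH_single {m r s : ℕ} (φ : HochCochain k G m) (x : G × BarTuple G r)
    (y : G × BarTuple G s) :
    m3HCH k G r m s (Finsupp.single x 1) φ (Finsupp.single y 1) =
      ∑ g : G, ∑ j ∈ Finset.Icc (s + 1 - m) (min s (r + s + 1 - m)),
        (-1 : k) ^ (r + s + m - j) •
          chainAt k (r + s + 2 - m) (y.2.1.take j ++ g⁻¹ :: x.2.1.drop (m + j - s - 1))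
            (gp k x.1 * evalAt k (x.2.1.take (m + j - s - 1) ++ g :: y.2.1.drop j) φ *
              gp k y.1) := by
  rw [m3HCH, basisLift_single_one, LinearMap.flip_apply, basisLift_single_one]
  simp only [LinearMap.sum_apply, LinearMap.smul_apply, LinearMap.comp_apply, LinearMap.flip_apply,
    LinearMap.mul_apply']

/-- The sum over `j` in the definition of `m₃(φ, α, ψ)` is the bracket: all other decompositions of
the two words contribute zero, since the cochains are supported in a single degree. -/
lemma sum_Icc_eq_bracket {m n : ℕ} {f h : List G → MonoidAlgebra k G} (hf : IsCoch m f)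
    (hh : IsCoch n h) (w l : List G) (hl : l.length = m + n - w.length - 2) :
    ∑ g : G, ∑ j ∈ Finset.Icc (max 1 (w.length + 2 - m)) (min n (w.length + 1)),
      (-1 : k) ^ (m + w.length + j - 1) •
        (f (l.take (m + j - w.length - 2) ++ g :: w.drop (j - 1)) *
          h (w.take (j - 1) ++ g⁻¹ :: l.drop (m + j - w.length - 2))) = -bracket f h w l := by
  set T : ℕ → G → MonoidAlgebra k G := fun j g => (-1 : k) ^ (m + w.length + j - 1) •
    (f (l.take (m + j - w.length - 2) ++ g :: w.drop (j - 1)) *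
      h (w.take (j - 1) ++ g⁻¹ :: l.drop (m + j - w.length - 2))) with hT
  have hsub : ∀ g : G, ∑ j ∈ Finset.Icc (max 1 (w.length + 2 - m)) (min n (w.length + 1)), T j g =
      ∑ i ∈ Finset.range (w.length + 1), T (i + 1) g := by
    intro g
    rw [← sum_Icc_one (w.length + 1) fun j => T j g]
    refine Finset.sum_subset (Finset.Icc_subset_Icc (le_max_left _ _) (min_le_right _ _)) ?_
    intro j hj hj'
    rw [Finset.mem_Icc] at hj hj'
    simp only [hT]
    by_cases hjn : j ≤ n
    · rw [hf.eq_zero_of_length, zero_mul, smul_zero]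
      simp only [List.length_append, List.length_cons, List.length_take, List.length_drop]
      omega
    · rw [hh.eq_zero_of_length, mul_zero, smul_zero]
      simp only [List.length_append, List.length_cons, List.length_take, List.length_drop]
      omega
  refine (Finset.sum_congr rfl fun g _ => hsub g).trans ?_
  rw [bracket, crossSum, splitSum_comm, splitSum, Finset.sum_comm, ← Finset.sum_neg_distrib]
  refine Finset.sum_congr rfl fun i hi => ?_
  have hi' := Finset.mem_range.1 hi
  have hci : (w.take i).length = i := by rw [List.length_take]; omega
  have hdi : (w.drop i).length = w.length - i := List.length_drop
  rw [splitSum_eq_term (m + (i + 1) - w.length - 2), ← Finset.sum_neg_distrib]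
  · refine Finset.sum_congr rfl fun g _ => ?_
    simp only [hT, Nat.add_sub_cancel, neg_one_pow_smul_eq_sg]
    generalize hp : m + (i + 1) - w.length - 2 = p
    by_cases hz : f (l.take p ++ g :: w.drop i) = 0
    · simp [hz]
    · have hlen2 := (hf _ hz).1
      rw [List.length_append, List.length_cons, hdi] at hlen2
      rw [sg_congr_neg (a := ((m + w.length + (i + 1) - 1 : ℕ) : ℤ))
        (b := ((l.take p).length : ℤ)) (by omega), neg_smul]
  · intro a b e ha
    refine Finset.sum_eq_zero fun g _ => ?_
    have h1 := congrArg List.length e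
    rw [List.length_append] at h1
    by_cases hb : (w.take i ++ g⁻¹ :: b).length = n
    · rw [hf.eq_zero_of_length, zero_mul, smul_zero]
      simp only [List.length_append, List.length_cons, hci, hdi] at hb ⊢
      omega
    · rw [hh.eq_zero_of_length hb, mul_zero, smul_zero]

lemma m3CHC_coch {m n : ℕ} {f h : List G → MonoidAlgebra k G} (hf : IsCoch m f)
    (hh : IsCoch n h) (w : List G) (hw : ∀ g ∈ w, g ≠ 1) (r : G)
    (l : BarTuple G (m + n - w.length - 2)) :
    m3CHC k G m w.length n (fun l => f l.1 * gp k l.1.prod)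
      (Finsupp.single (r * w.prod⁻¹, (⟨w, rfl, hw⟩ : BarTuple G w.length)) 1)
      (fun l => h l.1 * gp k l.1.prod) l =
      -(bracket f h w l.1 * gp k r) * gp k l.1.prod := by
  rw [m3CHC_single, neg_mul, mul_assoc, ← neg_mul, ← sum_Icc_eq_bracket hf hh w l.1 l.2.1,
    Finset.sum_mul]
  refine Finset.sum_congr rfl fun g _ => ?_
  rw [Finset.sum_mul]
  refine Finset.sum_congr rfl fun j _ => ?_
  rw [evalAt_mul_prod hf, evalAt_mul_prod hh, smul_mul_assoc]
  congr 1
  linear_combination (f (l.1.take (m + j - w.length - 2) ++ g :: w.drop (j - 1)) *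
    h (w.take (j - 1) ++ g⁻¹ :: l.1.drop (m + j - w.length - 2))) *
    gp_prod_take_drop (k := k) l.1 w r g (m + j - w.length - 2) (j - 1)

lemma bracket_eq_zero_of_mem {m n : ℕ} {f h : List G → MonoidAlgebra k G} (hf : IsCoch m f)
    (hh : IsCoch n h) {w v : List G} (hw : (1 : G) ∈ w ∨ (1 : G) ∈ v) : bracket f h w v = 0 := by
  refine crossSum_eq_zero fun a b c d g e e' => ?_
  have h' : (1 : G) ∈ a ++ g :: d ∨ (1 : G) ∈ c ++ g⁻¹ :: b := by
    rw [← e, ← e'] at hw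
    simp only [List.mem_append, List.mem_cons] at hw ⊢
    tauto
  rcases h' with h' | h'
  · rw [hf.eq_zero_of_mem h', zero_mul, smul_zero]
  · rw [hh.eq_zero_of_mem h', mul_zero, smul_zero]

lemma bracket_eq_zero_of_length {m n : ℕ} {f h : List G → MonoidAlgebra k G} (hf : IsCoch m f)
    (hh : IsCoch n h) {w v : List G} (hw : v.length + w.length + 2 ≠ m + n) :
    bracket f h w v = 0 := by
  refine crossSum_eq_zero fun a b c d g e e' => ?_
  have h1 := congrArg List.length e
  have h2 := congrArg List.length e'
  rw [List.length_append] at h1 h2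
  by_cases ha : (a ++ g :: d).length = m
  · rw [hh.eq_zero_of_length, mul_zero, smul_zero]
    simp only [List.length_append, List.length_cons] at ha ⊢
    omega
  · rw [hf.eq_zero_of_length ha, zero_mul, smul_zero]

/-- The ternary product of a chain between two cochains is the bracket. -/
lemma tateTriple_coch_chn_coch {m n : ℕ} {f h : List G → MonoidAlgebra k G} (hf : IsCoch m f)
    (hh : IsCoch n h) (w : List G) (ρ : MonoidAlgebra k G) :
    tateTriple k G (coch k f m) (chn k w ρ) (coch k h n) =
      coch k (fun v => -(bracket f h w v * ρ)) (m + n - w.length - 2) := by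
  refine eq_of_eq_on_chn w ((tateTriple k G (coch k f m)).flip (coch k h n)) (fun ρ =>
      coch k (fun v => -(bracket f h w v * ρ)) (m + n - w.length - 2)) ?_ ?_ ?_ ?_ ρ
  · intro x y
    simp only [mul_add, neg_add, coch_add]
  · intro c x
    simp only [mul_smul_comm, ← smul_neg, coch_smul]
  · intro hw ρ
    refine coch_eq_zero fun l _ => ?_
    rw [bracket_eq_zero_of_mem hf hh (Or.inl hw), zero_mul, neg_zero]
  intro hw r
  rw [LinearMap.flip_apply]
  rcases le_or_gt (w.length + 2) (m + n) with hle | hlt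
  · refine (tateTriple_inC_inH_inC_of_le hle _ _ _).trans
      (congrArg (inC k (HochCochain k G) (HochChain k G) (m + n - w.length - 2)) ?_)
    funext l
    exact m3CHC_coch hf hh w hw r l
  · refine (tateTriple_inC_inH_inC_of_lt hlt _ _ _).trans (coch_eq_zero fun l _ => ?_).symm
    rw [bracket_eq_zero_of_length hf hh (by omega), zero_mul, neg_zero]

lemma inH_m3HCH_coch {m : ℕ} {f : List G → MonoidAlgebra k G} (hf : IsCoch m f)
    {w v : List G} (hw : ∀ g ∈ w, g ≠ 1) (hv : ∀ g ∈ v, g ≠ 1) (r s : G)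
    (hle : m ≤ w.length + v.length + 1) :
    inH k (HochCochain k G) (HochChain k G) (w.length + v.length + 2 - m)
      (m3HCH k G w.length m v.length
        (Finsupp.single (r * w.prod⁻¹, (⟨w, rfl, hw⟩ : BarTuple G w.length)) 1)
        (fun l => f l.1 * gp k l.1.prod)
        (Finsupp.single (s * v.prod⁻¹, (⟨v, rfl, hv⟩ : BarTuple G v.length)) 1)) =
      -crossSum v w (fun a b c d g =>
        sg d.length • chn k (a ++ g⁻¹ :: d) (f (c ++ g :: b) * (gp k r * gp k s))) := by
  rw [m3HCH_single]
  simp only [evalAt_mul_prod hf]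
  set N := w.length + v.length + 2 - m with hN
  set T : ℕ → G → HochChain k G N := fun j g =>
    (-1 : k) ^ (w.length + v.length + m - j) •
      chainAt k N (v.take j ++ g⁻¹ :: w.drop (m + j - v.length - 1))
        (gp k (r * w.prod⁻¹) * (f (w.take (m + j - v.length - 1) ++ g :: v.drop j) *
          gp k (w.take (m + j - v.length - 1) ++ g :: v.drop j).prod) * gp k (s * v.prod⁻¹)) with hT
  have hsub : ∀ g : G, ∑ j ∈ Finset.Icc (v.length + 1 - m)
        (min v.length (w.length + v.length + 1 - m)), T j g =
      ∑ j ∈ Finset.range (v.length + 1), T j g := by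
    intro g
    refine Finset.sum_subset (fun j hj => ?_) ?_
    · rw [Finset.mem_Icc] at hj
      rw [Finset.mem_range]
      omega
    intro j hj hj'
    rw [Finset.mem_Icc] at hj'
    rw [Finset.mem_range] at hj
    simp only [hT]
    rw [hf.eq_zero_of_length, zero_mul, mul_zero, zero_mul, map_zero, smul_zero]
    simp only [List.length_append, List.length_cons, List.length_take, List.length_drop]
    omega
  refine (congrArg (inH k (HochCochain k G) (HochChain k G) N)
    (Finset.sum_congr rfl fun g _ => hsub g)).trans ?_
  rw [crossSum, splitSum, Finset.sum_comm, map_sum, ← Finset.sum_neg_distrib]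
  refine Finset.sum_congr rfl fun j hj => ?_
  have hj' := Finset.mem_range.1 hj
  have hci : (v.take j).length = j := by rw [List.length_take]; omega
  have hdi : (v.drop j).length = v.length - j := List.length_drop
  rw [splitSum_eq_term (m + j - v.length - 1), map_sum, ← Finset.sum_neg_distrib]
  · refine Finset.sum_congr rfl fun g _ => ?_
    simp only [hT, neg_one_pow_smul_eq_sg]
    generalize hp : m + j - v.length - 1 = p
    by_cases hz : f (w.take p ++ g :: v.drop j) = 0
    · simp only [hz, zero_mul, mul_zero, map_zero, smul_zero, neg_zero]
    · have hlen2 := (hf _ hz).1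
      rw [List.length_append, List.length_cons, hdi, List.length_take] at hlen2
      have hs : sg ((w.length + v.length + m - j : ℕ) : ℤ) = -sg ((w.drop p).length : ℤ) :=
        sg_congr_neg (by rw [List.length_drop]; omega)
      rw [hs, neg_smul, map_neg, map_zsmul, inH_chainAt]
      · have hprod := gp_prod_take_drop (k := k) w v s g p j
        have hw1 := gp_mul_inv k w.prod
        congr 3
        rw [← gp_mul]
        linear_combination (f (w.take p ++ g :: v.drop j) * gp k r * gp k w.prod⁻¹) * hprod +
          (f (w.take p ++ g :: v.drop j) * gp k r * gp k s) * hw1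
      · simp only [List.length_append, List.length_cons, hci, List.length_drop]
        omega
  · intro a b e ha
    refine Finset.sum_eq_zero fun g _ => ?_
    rw [hf.eq_zero_of_length, zero_mul, map_zero, smul_zero]
    have h1 := congrArg List.length e
    rw [List.length_append] at h1
    simp only [List.length_append, List.length_cons, hdi]
    omega

/-- The ternary product of a cochain between two chains, the operation dual to the bracket. -/
lemma tateTriple_chn_coch_chn {m : ℕ} {f : List G → MonoidAlgebra k G} (hf : IsCoch m f)
    (w v : List G) (ρ σ : MonoidAlgebra k G) :
    tateTriple k G (chn k w ρ) (coch k f m) (chn k v σ) =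
      -crossSum v w (fun a b c d g =>
        sg d.length • chn k (a ++ g⁻¹ :: d) (f (c ++ g :: b) * (ρ * σ))) := by
  have hzero : ((1 : G) ∈ w ∨ (1 : G) ∈ v) → ∀ ρ : MonoidAlgebra k G,
      -crossSum v w (fun a b c d g =>
        sg d.length • chn k (a ++ g⁻¹ :: d) (f (c ++ g :: b) * ρ)) = 0 := by
    intro h ρ
    rw [neg_eq_zero]
    refine crossSum_eq_zero fun a b c d g e e' => ?_
    have h' : (1 : G) ∈ a ++ g⁻¹ :: d ∨ (1 : G) ∈ c ++ g :: b := by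
      rw [← e, ← e'] at h
      simp only [List.mem_append, List.mem_cons] at h ⊢
      tauto
    rcases h' with h' | h'
    · rw [chn_of_mem h', LinearMap.zero_apply, smul_zero]
    · rw [hf.eq_zero_of_mem h', zero_mul, map_zero, smul_zero]
  refine eq_of_eq_on_chn w (((tateTriple k G).flip (coch k f m)).flip (chn k v σ)) (fun ρ =>
      -crossSum v w (fun a b c d g =>
        sg d.length • chn k (a ++ g⁻¹ :: d) (f (c ++ g :: b) * (ρ * σ)))) ?_ ?_ ?_ ?_ ρ
  · intro x y
    simp only [add_mul, mul_add, map_add, smul_add, crossSum_add, neg_add]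
  · intro c x
    simp only [smul_mul_assoc, mul_smul_comm, map_smul, smul_comm _ c, crossSum_smul, smul_neg]
  · intro h ρ
    exact hzero (Or.inl h) _
  intro hw r
  rw [LinearMap.flip_apply, LinearMap.flip_apply]
  refine eq_of_eq_on_chn v (tateTriple k G (inH k _ _ w.length (Finsupp.single _ 1)) (coch k f m))
    (fun σ => -crossSum v w (fun a b c d g =>
        sg d.length • chn k (a ++ g⁻¹ :: d) (f (c ++ g :: b) * (gp k r * σ)))) ?_ ?_ ?_ ?_ σ
  · intro x y
    simp only [mul_add, map_add, smul_add, crossSum_add, neg_add]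
  · intro c x
    simp only [mul_smul_comm, map_smul, smul_comm _ c, crossSum_smul, smul_neg]
  · intro h ρ
    exact hzero (Or.inr h) _
  intro hv s
  rcases le_or_gt m (w.length + v.length + 1) with hle | hlt
  · exact (tateTriple_inH_inC_inH_of_le hle _ _ _).trans (inH_m3HCH_coch hf hw hv r s hle)
  · rw [crossSum_eq_zero, neg_zero]
    · exact tateTriple_inH_inC_inH_of_lt hlt _ _ _
    · intro a b c d g e e'
      have h1 := congrArg List.length e
      have h2 := congrArg List.length e'
      rw [List.length_append] at h1 h2
      rw [hf.eq_zero_of_length, zero_mul, map_zero, smul_zero]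
      simp only [List.length_append, List.length_cons]
      omega

end Operations

section Operations

variable {k : Type*} [Field k] {G : Type*} [CommGroup G]

/-- The bar differential of a normalized function is normalized. -/
lemma barDelta_of_mem {M : Type*} [AddCommGroup M] {F : List G → M}
    (hF : ∀ l, (1 : G) ∈ l → F l = 0) {w : List G} (hw : (1 : G) ∈ w) : barDelta F w = 0 := by
  obtain ⟨v, u, rfl⟩ := List.append_of_mem hw
  have h1 : barDelta (fun l => F (l ++ 1 :: u)) v = 0 := by
    rw [barDelta_congr (F' := fun _ => 0) fun l _ => hF _ (by simp), barDelta_zero]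
  have h2 : barDelta (fun l => F (v ++ 1 :: l)) u = 0 := by
    rw [barDelta_congr (F' := fun _ => 0) fun l _ => hF _ (by simp), barDelta_zero]
  have h3 : lastTerm (fun a x => F (a ++ (x * 1) :: u) - F (a ++ 1 :: u)) v =
      if v = [] then 0 else F (v ++ u) := by
    rcases List.eq_nil_or_concat v with rfl | ⟨v, x, rfl⟩
    · simp
    · simp [lastTerm, hF (v ++ 1 :: u) (by simp)]
  have h4 : headTerm (fun y b => F (v ++ (1 * y) :: b) - F (v ++ 1 :: b)) u =
      if u = [] then 0 else F (v ++ u) := by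
    cases u with
    | nil => simp
    | cons y u => simp [hF (v ++ 1 :: u) (by simp)]
  rw [barDelta_append_cons, h1, h2, h3, h4]
  by_cases hv : v = []
  · by_cases hu : u = [] <;> simp [hv, hu]
  · by_cases hu : u = [] <;> simp [hv, hu]

lemma IsCoch.barDelta {n : ℕ} {f : List G → MonoidAlgebra k G} (hf : IsCoch n f) :
    IsCoch (n + 1) (barDelta f) := by
  intro l hl
  refine ⟨?_, fun g hg e => hl (barDelta_of_mem (fun l h => hf.eq_zero_of_mem h) (e ▸ hg))⟩
  by_contra h
  refine hl ?_
  rw [barDelta_congr (F' := fun _ => 0) fun l' hl' => hf.eq_zero_of_length (by omega),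
    barDelta_zero]

lemma IsCoch.conv {n m : ℕ} {f h : List G → MonoidAlgebra k G} (hf : IsCoch n f)
    (hh : IsCoch m h) : IsCoch (n + m) (conv f h) := by
  intro l hl
  refine ⟨?_, fun g hg e => hl (splitSum_eq_zero fun a b hab => ?_)⟩
  · by_contra hl'
    refine hl (splitSum_eq_zero fun a b hab => ?_)
    have := congrArg List.length hab
    rw [List.length_append] at this
    by_cases ha : a.length = n
    · rw [hh.eq_zero_of_length (by omega), mul_zero]
    · rw [hf.eq_zero_of_length ha, zero_mul]
  · subst e
    rw [← hab, List.mem_append] at hg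
    rcases hg with hg | hg
    · rw [hf.eq_zero_of_mem hg, zero_mul]
    · rw [hh.eq_zero_of_mem hg, mul_zero]

lemma inH_hochDel {w : List G} {s : ℕ} (hs : w.length = s + 1) (hw : ∀ g ∈ w, g ≠ 1) (r : G) :
    inH k (HochCochain k G) (HochChain k G) s (hochDel k G s
      (Finsupp.single (r * w.prod⁻¹, (⟨w, hs, hw⟩ : BarTuple G (s + 1))) 1)) =
      barDelta (fun l => chn k l (gp k r)) w := by
  have h0 : gp k w.prod⁻¹ * gp k w.prod = 1 := gp_inv_mul k w.prod
  have h1 : gp k (w.take 1).prod * gp k (w.drop 1).prod = gp k w.prod := by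
    rw [gp_mul, ← List.prod_append, List.take_append_drop]
  have h2 : gp k (w.take s).prod * gp k (w.drop s).prod = gp k w.prod := by
    rw [gp_mul, ← List.prod_append, List.take_append_drop]
  rw [hochDel, Finsupp.linearCombination_single, one_smul]
  change inH k (HochCochain k G) (HochChain k G) s
    (chainAt k s (w.drop 1) (gp k (r * w.prod⁻¹) * gp k (w.take 1).prod)
    + ∑ i ∈ Finset.Icc 1 s, (-1 : k) ^ i • chainAt k s (contract i w) (gp k (r * w.prod⁻¹))
    + (-1 : k) ^ (s + 1) • chainAt k s (w.take s) (gp k (w.drop s).prod * gp k (r * w.prod⁻¹))) = _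
  rw [barDelta_eq_sum _ hs, map_add, map_add, map_sum, map_smul, neg_one_pow_smul_eq_sg,
    inH_chainAt (by simp [hs]), inH_chainAt (by simp [hs]), ← gp_mul]
  push_cast
  refine congrArg₂ (· + ·) (congrArg₂ (· + ·) ?_ ?_) ?_
  · congr 1
    linear_combination (gp k r * gp k w.prod⁻¹) * h1 + gp k r * h0
  · refine Finset.sum_congr rfl fun i hi => ?_
    rw [Finset.mem_Icc] at hi
    rw [map_smul, neg_one_pow_smul_eq_sg, inH_chainAt (length_contract hi.1 hi.2 hs),
      prod_contract hi.1]
    congr 2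
    linear_combination gp k r * h0
  · congr 2
    linear_combination (gp k r * gp k w.prod⁻¹) * h2 + gp k r * h0

lemma barDelta_smul {X : Type*} [AddCommGroup X] [Module k X] (c : k) (F : List G → X)
    (w : List G) : barDelta (fun l => c • F l) w = c • barDelta F w :=
  (map_barDelta (LinearMap.lsmul k X c) F w).symm

variable (k G) in
/-- The bilinear form of the Tate-Hochschild complex. -/
def tatePair : (⨁ i, TateHoch k G i) →ₗ[k] (⨁ i, TateHoch k G i) →ₗ[k] k :=
  extend₂ (pairDeg k G)

lemma tatePair_symm (x y : ⨁ i, TateHoch k G i) : tatePair k G x y = tatePair k G y x := by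
  have : tatePair k G = (tatePair k G).flip := by
    refine DirectSum.linearMap_ext k fun i => LinearMap.ext fun x =>
      DirectSum.linearMap_ext k fun j => LinearMap.ext fun y => ?_
    refine (extend₂_lof (pairDeg k G) i j x y).trans
      (Eq.trans ?_ (extend₂_lof (pairDeg k G) j i y x).symm)
    cases i <;> cases j <;> rfl
  exact LinearMap.congr_fun (LinearMap.congr_fun this x) y

@[simp] lemma tatePair_coch_coch (f h : List G → MonoidAlgebra k G) (m n : ℕ) :
    tatePair k G (coch k f m) (coch k h n) = 0 :=
  extend₂_lof (pairDeg k G) (Int.ofNat m) (Int.ofNat n) _ _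

@[simp] lemma tatePair_chn_chn (w v : List G) (ρ σ : MonoidAlgebra k G) :
    tatePair k G (chn k w ρ) (chn k v σ) = 0 :=
  extend₂_lof (pairDeg k G) (Int.negSucc _) (Int.negSucc _) _ _

lemma tatePair_coch_chn {n : ℕ} {f : List G → MonoidAlgebra k G} (hf : IsCoch n f) (w : List G)
    (ρ : MonoidAlgebra k G) :
    tatePair k G (coch k f n) (chn k w ρ) = coeffAt k G 1 (f w * ρ) := by
  refine eq_of_eq_on_chn w (tatePair k G (coch k f n)) (fun ρ => coeffAt k G 1 (f w * ρ))
    ?_ ?_ ?_ ?_ ρ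
  · intro x y
    simp only [mul_add, map_add]
  · intro c x
    simp only [mul_smul_comm, map_smul]
  · intro h ρ
    rw [hf.eq_zero_of_mem h, zero_mul, map_zero]
  intro hw r
  refine (extend₂_lof (pairDeg k G) (Int.ofNat n) (Int.negSucc w.length) _ _).trans ?_
  refine (?_ : _ = coeffAt k G 1 (evalAt k w (fun l : BarTuple G n => f l.1 * gp k l.1.prod) *
    gp k (r * w.prod⁻¹))).trans ?_
  · change pairCH k G n w.length _ _ = _
    rw [pairCH, LinearMap.flip_apply, basisLift_single_one]
    rfl
  · rw [evalAt_mul_prod hf, ← gp_mul]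
    congr 1
    linear_combination f w * gp k r * gp_inv_mul k w.prod

lemma tatePair_chn_coch {n : ℕ} {f : List G → MonoidAlgebra k G} (hf : IsCoch n f) (w : List G)
    (ρ : MonoidAlgebra k G) :
    tatePair k G (chn k w ρ) (coch k f n) = coeffAt k G 1 (f w * ρ) := by
  rw [tatePair_symm, tatePair_coch_chn hf]

variable [Fintype G]

lemma IsCoch.sum_left {n : ℕ} {f : List G → MonoidAlgebra k G} (hf : IsCoch n f) (w : List G)
    (ρ : MonoidAlgebra k G) :
    IsCoch (n - w.length - 1) (fun u => (∑ g : G, f (u ++ g :: w)) * ρ) := by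
  intro l hl
  obtain ⟨g, -, hg⟩ := Finset.exists_ne_zero_of_sum_ne_zero (left_ne_zero_of_mul hl)
  obtain ⟨h1, h2⟩ := hf _ hg
  rw [List.length_append, List.length_cons] at h1
  exact ⟨by omega, fun x hx => h2 x (by simp [hx])⟩

lemma IsCoch.sum_right {n : ℕ} {f : List G → MonoidAlgebra k G} (hf : IsCoch n f) (w : List G)
    (ρ : MonoidAlgebra k G) :
    IsCoch (n - w.length - 1) (fun u => (∑ g : G, f (w ++ g :: u)) * ρ) := by
  intro l hl
  obtain ⟨g, -, hg⟩ := Finset.exists_ne_zero_of_sum_ne_zero (left_ne_zero_of_mul hl)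
  obtain ⟨h1, h2⟩ := hf _ hg
  rw [List.length_append, List.length_cons] at h1
  exact ⟨by omega, fun x hx => h2 x (by simp [hx])⟩

lemma IsCoch.bracket {m n : ℕ} {f h : List G → MonoidAlgebra k G} (hf : IsCoch m f)
    (hh : IsCoch n h) (w : List G) (ρ : MonoidAlgebra k G) :
    IsCoch (m + n - w.length - 2) (fun v => -(bracket f h w v * ρ)) := by
  intro l hl
  have hl' : _root_.bracket f h w l ≠ 0 := by
    intro e
    exact hl (by simp only [e, zero_mul, neg_zero])
  refine ⟨?_, fun g hg e => hl' (bracket_eq_zero_of_mem hf hh (Or.inr (e ▸ hg)))⟩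
  by_contra hlen
  by_cases h2 : l.length + w.length + 2 = m + n
  · omega
  · exact hl' (bracket_eq_zero_of_length hf hh h2)

lemma tateTriple_inC_inC (m n : ℕ) (φ : HochCochain k G m) (ψ : HochCochain k G n)
    (x : ⨁ i, TateHoch k G i) : tateTriple k G (inC k _ _ m φ) (inC k _ _ n ψ) x = 0 := by
  have : tateTriple k G (inC k _ _ m φ) (inC k _ _ n ψ) = 0 := by
    refine DirectSum.linearMap_ext k fun i => LinearMap.ext fun y => ?_
    refine (extend₃_lof (m3Deg k G) (Int.ofNat m) (Int.ofNat n) i φ ψ y).trans ?_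
    rfl
  rw [this, LinearMap.zero_apply]

lemma tateTriple_inH_inH (r s : ℕ) (η : HochChain k G r) (θ : HochChain k G s)
    (x : ⨁ i, TateHoch k G i) : tateTriple k G (inH k _ _ r η) (inH k _ _ s θ) x = 0 := by
  have : tateTriple k G (inH k _ _ r η) (inH k _ _ s θ) = 0 := by
    refine DirectSum.linearMap_ext k fun i => LinearMap.ext fun y => ?_
    refine (extend₃_lof (m3Deg k G) (Int.negSucc r) (Int.negSucc s) i η θ y).trans ?_
    rfl
  rw [this, LinearMap.zero_apply]

lemma tateTriple_mid_inC_inC (m n : ℕ) (φ : HochCochain k G m) (ψ : HochCochain k G n)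
    (x : ⨁ i, TateHoch k G i) : tateTriple k G x (inC k _ _ m φ) (inC k _ _ n ψ) = 0 := by
  have : ((tateTriple k G).flip (inC k _ _ m φ)).flip (inC k _ _ n ψ) = 0 := by
    refine DirectSum.linearMap_ext k fun i => LinearMap.ext fun y => ?_
    refine (extend₃_lof (m3Deg k G) i (Int.ofNat m) (Int.ofNat n) y φ ψ).trans ?_
    cases i <;> rfl
  exact LinearMap.congr_fun this x

lemma tateTriple_mid_inH_inH (r s : ℕ) (η : HochChain k G r) (θ : HochChain k G s)
    (x : ⨁ i, TateHoch k G i) : tateTriple k G x (inH k _ _ r η) (inH k _ _ s θ) = 0 := by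
  have : ((tateTriple k G).flip (inH k _ _ r η)).flip (inH k _ _ s θ) = 0 := by
    refine DirectSum.linearMap_ext k fun i => LinearMap.ext fun y => ?_
    refine (extend₃_lof (m3Deg k G) i (Int.negSucc r) (Int.negSucc s) y η θ).trans ?_
    cases i <;> rfl
  exact LinearMap.congr_fun this x

@[simp] lemma tateTriple_coch_coch_left (f h : List G → MonoidAlgebra k G) (m n : ℕ)
    (x : ⨁ i, TateHoch k G i) : tateTriple k G (coch k f m) (coch k h n) x = 0 :=
  tateTriple_inC_inC m n _ _ x

@[simp] lemma tateTriple_chn_chn_left (w v : List G) (ρ σ : MonoidAlgebra k G)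
    (x : ⨁ i, TateHoch k G i) : tateTriple k G (chn k w ρ) (chn k v σ) x = 0 :=
  tateTriple_inH_inH _ _ _ _ x

@[simp] lemma tateTriple_coch_coch_right (f h : List G → MonoidAlgebra k G) (m n : ℕ)
    (x : ⨁ i, TateHoch k G i) : tateTriple k G x (coch k f m) (coch k h n) = 0 :=
  tateTriple_mid_inC_inC m n _ _ x

@[simp] lemma tateTriple_chn_chn_right (w v : List G) (ρ σ : MonoidAlgebra k G)
    (x : ⨁ i, TateHoch k G i) : tateTriple k G x (chn k w ρ) (chn k v σ) = 0 :=
  tateTriple_mid_inH_inH _ _ _ _ x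

/-- In twisted coordinates the Hochschild differential is the bar differential with trivial
coefficients. -/
lemma tateDiff_coch {n : ℕ} {f : List G → MonoidAlgebra k G} (hf : IsCoch n f) :
    tateDiff k G (coch k f n) = coch k (barDelta f) (n + 1) := by
  refine (extend₁_lof _ (Int.ofNat n) _).trans
    (congrArg (inC k (HochCochain k G) (HochChain k G) (n + 1)) ?_)
  funext l
  have hp : ∀ i ∈ Finset.Icc 1 n, (-1 : k) ^ i • evalAt k (contract i l.1)
      (fun l : BarTuple G n => f l.1 * gp k l.1.prod) =
      sg i • f (contract i l.1) * gp k l.1.prod := by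
    intro i hi
    rw [evalAt_mul_prod hf, neg_one_pow_smul_eq_sg, prod_contract (Finset.mem_Icc.1 hi).1,
      smul_mul_assoc]
  have h1 : gp k (l.1.take 1).prod * gp k (l.1.drop 1).prod = gp k l.1.prod := by
    rw [gp_mul, ← List.prod_append, List.take_append_drop]
  have h2 : gp k (l.1.take n).prod * gp k (l.1.drop n).prod = gp k l.1.prod := by
    rw [gp_mul, ← List.prod_append, List.take_append_drop]
  change gp k (l.1.take 1).prod * evalAt k (l.1.drop 1) _
    + ∑ i ∈ Finset.Icc 1 n, (-1 : k) ^ i • evalAt k (contract i l.1) _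
    + (-1 : k) ^ (n + 1) • (evalAt k (l.1.take n) _ * gp k (l.1.drop n).prod) = _
  rw [Finset.sum_congr rfl hp, evalAt_mul_prod hf, evalAt_mul_prod hf, ← Finset.sum_mul,
    neg_one_pow_smul_eq_sg, barDelta_eq_sum f l.2.1, add_mul, add_mul, smul_mul_assoc]
  push_cast
  congr 1
  · congr 1
    linear_combination f (l.1.drop 1) * h1
  · congr 1
    linear_combination f (l.1.take n) * h2

open Classical in
variable (k G) in
/-- The cochain of degree `0` which is the trace of a chain `(ρ)` of degree `0`; it vanishes for
chains `(ρ, w)` of positive length. -/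
def normFun (w : List G) (ρ : MonoidAlgebra k G) (u : List G) : MonoidAlgebra k G :=
  if u = [] ∧ w = [] then Fintype.card G • ρ else 0

lemma isCoch_normFun (w : List G) (ρ : MonoidAlgebra k G) : IsCoch 0 (normFun k G w ρ) := by
  intro l hl
  by_cases h : l = []
  · simp [h]
  · simp [normFun, h] at hl

lemma normFun_add (w : List G) (ρ σ : MonoidAlgebra k G) :
    normFun k G w (ρ + σ) = fun u => normFun k G w ρ u + normFun k G w σ u := by
  funext u
  simp only [normFun]
  split_ifs <;> simp

lemma normFun_smul (c : k) (w : List G) (ρ : MonoidAlgebra k G) :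
    normFun k G w (c • ρ) = fun u => c • normFun k G w ρ u := by
  funext u
  simp only [normFun]
  split_ifs
  · rw [smul_comm]
  · simp

lemma hochTrace_single (x : G × BarTuple G 0) (l : BarTuple G 0) :
    hochTrace k G (Finsupp.single x 1) l = ∑ g : G, gp k g * gp k x.1 * gp k g⁻¹ := by
  rw [hochTrace, Finsupp.linearCombination_single, one_smul]

lemma tateDiff_inH_nil (r : G) (h : ([] : List G).length = 0 ∧ ∀ g ∈ ([] : List G), g ≠ 1) :
    tateDiff k G (inH k (HochCochain k G) (HochChain k G) 0
      (Finsupp.single (r, (⟨[], h⟩ : BarTuple G 0)) 1)) =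
      coch k (normFun k G [] (gp k r)) 0 := by
  refine (extend₁_lof _ (Int.negSucc 0) _).trans
    (congrArg (inC k (HochCochain k G) (HochChain k G) 0) ?_)
  funext l
  have hl : l.1 = [] := List.length_eq_zero_iff.1 l.2.1
  have : ∀ g : G, gp k g * gp k r * gp k g⁻¹ = gp k r := by
    intro g
    linear_combination gp k r * gp_mul_inv k g
  refine (?_ : _ = ∑ g : G, gp k g * gp k r * gp k g⁻¹).trans ?_
  · exact hochTrace_single (r, (⟨[], h⟩ : BarTuple G 0)) l
  · simp only [this, normFun, hl]
    simp

lemma tateDiff_inH_succ (s : ℕ) (η : HochChain k G (s + 1)) :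
    tateDiff k G (inH k (HochCochain k G) (HochChain k G) (s + 1) η) =
      sg (s + 1 : ℕ) • inH k (HochCochain k G) (HochChain k G) s (hochDel k G s η) := by
  refine (extend₁_lof _ (Int.negSucc (s + 1)) _).trans ?_
  refine (map_smul (inH k (HochCochain k G) (HochChain k G) s) ((-1 : k) ^ (s + 1))
    (hochDel k G s η)).trans ?_
  rw [neg_one_pow_smul_eq_sg]

lemma tateDiff_chn (w : List G) (ρ : MonoidAlgebra k G) :
    tateDiff k G (chn k w ρ) =
      sg w.length • barDelta (fun l => chn k l ρ) w + coch k (normFun k G w ρ) 0 := by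
  refine eq_of_eq_on_chn w (tateDiff k G) (fun ρ =>
    sg w.length • barDelta (fun l => chn k l ρ) w + coch k (normFun k G w ρ) 0) ?_ ?_ ?_ ?_ ρ
  · intro x y
    simp only [map_add, barDelta_add, smul_add, normFun_add, coch_add]
    abel
  · intro c x
    simp only [map_smul, normFun_smul, coch_smul, smul_add]
    rw [barDelta_smul, smul_comm c]
  · intro h ρ
    rw [barDelta_of_mem (fun l hl => by rw [chn_of_mem hl, LinearMap.zero_apply]) h, smul_zero,
      zero_add]
    refine coch_eq_zero fun l _ => ?_
    rw [normFun, if_neg]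
    rintro ⟨-, rfl⟩
    simp at h
  intro hw r
  cases w with
  | nil =>
    rw [barDelta_nil, smul_zero, zero_add]
    simpa using tateDiff_inH_nil (k := k) r (⟨rfl, hw⟩)
  | cons x w =>
    have hz : coch k (normFun k G (x :: w) (gp k r)) 0 = 0 :=
      coch_eq_zero fun l _ => by simp [normFun]
    rw [hz, add_zero]
    refine (tateDiff_inH_succ w.length _).trans ?_
    rw [← inH_hochDel (w := x :: w) (s := w.length) rfl hw r]
    rfl

end Operations

/-! ### Homogeneous elements, generators and cyclicity -/

section Homogeneous

variable {k : Type*} [Field k] {G : Type*} [CommGroup G]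

/-- The homogeneous elements of degree `d`. -/
def homog (V : ℤ → Type*) [∀ i, AddCommGroup (V i)] [∀ i, Module k (V i)] (d : ℤ) :
    Submodule k (⨁ i, V i) :=
  LinearMap.range (DirectSum.lof k ℤ V d)

variable (k G) in
/-- The homogeneous elements of degree `d` of the Tate-Hochschild complex. -/
abbrev tateHomog (d : ℤ) : Submodule k (⨁ i, TateHoch k G i) := homog (TateHoch k G) d

lemma inC_mem_homog {n : ℕ} (φ : HochCochain k G n) {d : ℤ} (h : d = n) :
    inC k (HochCochain k G) (HochChain k G) n φ ∈ tateHomog k G d := by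
  subst h
  exact ⟨φ, rfl⟩

lemma inH_mem_homog {s : ℕ} (η : HochChain k G s) {d : ℤ} (h : d = -s - 1) :
    inH k (HochCochain k G) (HochChain k G) s η ∈ tateHomog k G d := by
  obtain rfl : d = Int.negSucc s := by rw [h, Int.negSucc_eq]; ring
  exact ⟨η, rfl⟩

/-- `x` is a cochain or a basis chain, of degree `d`. -/
inductive IsGen : ℤ → (⨁ i, TateHoch k G i) → Prop
  | coch (n : ℕ) (f : List G → MonoidAlgebra k G) (hf : IsCoch n f) : IsGen n (coch k f n)
  | chn (w : List G) (ρ : MonoidAlgebra k G) : IsGen (-w.length - 1) (chn k w ρ)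

lemma IsGen.mem_homog {d : ℤ} {x : ⨁ i, TateHoch k G i} (h : IsGen d x) : x ∈ tateHomog k G d := by
  cases h with
  | coch n f hf => exact inC_mem_homog _ rfl
  | chn w ρ => exact inH_mem_homog _ rfl

lemma isGen_inC {n : ℕ} (φ : HochCochain k G n) :
    IsGen n (inC k (HochCochain k G) (HochChain k G) n φ) := by
  rw [inC_eq_coch]
  exact IsGen.coch n _ (isCoch_evalAt φ)

lemma inH_mem_span {s : ℕ} (η : HochChain k G s) :
    inH k (HochCochain k G) (HochChain k G) s η ∈
      Submodule.span k {x | IsGen (-s - 1) x} := by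
  induction η using Finsupp.induction_linear with
  | zero => rw [map_zero]; exact zero_mem _
  | add x y hx hy => rw [map_add]; exact add_mem hx hy
  | single x c =>
    obtain ⟨g, ⟨l, rfl, hl⟩⟩ := x
    have h1 : inH k (HochCochain k G) (HochChain k G) l.length
        (Finsupp.single (g, (⟨l, rfl, hl⟩ : BarTuple G l.length)) c) =
        c • chn k l (gp k (g * l.prod)) := by
      rw [chn_gp hl, ← map_smul, Finsupp.smul_single, mul_inv_cancel_right, smul_eq_mul, mul_one]
    exact h1 ▸ Submodule.smul_mem _ _ (Submodule.subset_span (IsGen.chn l _))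

lemma homog_le_span (d : ℤ) : tateHomog k G d ≤ Submodule.span k {x | IsGen d x} := by
  rintro _ ⟨v, rfl⟩
  match d, v with
  | .ofNat n, v => exact Submodule.subset_span (isGen_inC (n := n) v)
  | .negSucc s, v =>
    have h := inH_mem_span (s := s) v
    have e : (-s - 1 : ℤ) = Int.negSucc s := by rw [Int.negSucc_eq]; ring
    rw [e] at h
    exact h

lemma coeffAt_zsmul (g : G) (n : ℤ) (x : MonoidAlgebra k G) :
    coeffAt k G g (n • x) = n • coeffAt k G g x := map_zsmul _ _ _

/-- Two linear functions which agree on the generators agree on all homogeneous elements. -/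
lemma eq_of_eq_on_gen {X : Type*} [AddCommGroup X] [Module k X] {d : ℤ}
    {F F' : (⨁ i, TateHoch k G i) → X} (hF : IsLinearMap k F) (hF' : IsLinearMap k F')
    (h : ∀ x, IsGen d x → F x = F' x) {x : ⨁ i, TateHoch k G i} (hx : x ∈ tateHomog k G d) :
    F x = F' x := by
  have h1 : ∀ x ∈ Submodule.span k {x | IsGen d x}, hF.mk' F x = hF'.mk' F' x := fun x hx =>
    LinearMap.eqOn_span (f := hF.mk' F) (g := hF'.mk' F') (fun y hy => h y hy) hx
  exact h1 x (homog_le_span d hx)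

variable [Fintype G]

lemma tateDiff_mem {a : ℤ} {x : ⨁ i, TateHoch k G i} (hx : x ∈ tateHomog k G a) {d : ℤ}
    (hd : d = a + 1) : tateDiff k G x ∈ tateHomog k G d := by
  obtain ⟨v, rfl⟩ := hx
  rw [tateDiff, splicedDifferential, extend₁_lof]
  match a, v with
  | .ofNat n, v => exact inC_mem_homog _ (by rw [hd]; rfl)
  | .negSucc 0, v => exact inC_mem_homog _ (by rw [hd]; rfl)
  | .negSucc (s + 1), v => exact inH_mem_homog _ (by rw [hd, Int.negSucc_eq]; push_cast; ring)

lemma tateCup_mem {a b : ℤ} {x y : ⨁ i, TateHoch k G i} (hx : x ∈ tateHomog k G a)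
    (hy : y ∈ tateHomog k G b) {d : ℤ} (hd : d = a + b) : tateCup k G x y ∈ tateHomog k G d := by
  obtain ⟨v, rfl⟩ := hx
  obtain ⟨u, rfl⟩ := hy
  match a, b, v, u with
  | .ofNat n, .ofNat m, v, u =>
    rw [tateCup, extend₂_lof]
    exact inC_mem_homog _ (by rw [hd]; rfl)
  | .ofNat n, .negSucc t, v, u =>
    have e1 := Int.negSucc_eq t
    have e2 : Int.ofNat n = (n : ℤ) := rfl
    rcases le_or_gt n t with h | h
    · exact (tateCup_inC_inH_of_le h v u) ▸ inH_mem_homog _ (by omega)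
    · exact (tateCup_inC_inH_of_lt h v u) ▸ inC_mem_homog _ (by omega)
  | .negSucc t, .ofNat n, v, u =>
    have e1 := Int.negSucc_eq t
    have e2 : Int.ofNat n = (n : ℤ) := rfl
    rcases le_or_gt n t with h | h
    · exact (tateCup_inH_inC_of_le h u v) ▸ inH_mem_homog _ (by omega)
    · exact (tateCup_inH_inC_of_lt h u v) ▸ inC_mem_homog _ (by omega)
  | .negSucc s, .negSucc t, v, u =>
    rw [tateCup, extend₂_lof]
    exact inH_mem_homog _ (by rw [hd, Int.negSucc_eq, Int.negSucc_eq]; push_cast; ring)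

lemma tateTriple_mem {a b c : ℤ} {x y z : ⨁ i, TateHoch k G i} (hx : x ∈ tateHomog k G a)
    (hy : y ∈ tateHomog k G b) (hz : z ∈ tateHomog k G c) {d : ℤ} (hd : d = a + b + c - 1) :
    tateTriple k G x y z ∈ tateHomog k G d := by
  obtain ⟨v, rfl⟩ := hx
  obtain ⟨u, rfl⟩ := hy
  obtain ⟨t, rfl⟩ := hz
  match a, b, c, v, u, t with
  | .ofNat m, .negSucc r, .ofNat n, v, u, t =>
    have e1 := Int.negSucc_eq r
    have e2 : Int.ofNat n = (n : ℤ) := rfl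
    have e3 : Int.ofNat m = (m : ℤ) := rfl
    rcases le_or_gt (r + 2) (m + n) with h | h
    · exact (tateTriple_inC_inH_inC_of_le h v u t) ▸ inC_mem_homog _ (by omega)
    · exact (tateTriple_inC_inH_inC_of_lt h v u t) ▸ zero_mem _
  | .negSucc r, .ofNat m, .negSucc s, v, u, t =>
    have e1 := Int.negSucc_eq r
    have e2 := Int.negSucc_eq s
    have e3 : Int.ofNat m = (m : ℤ) := rfl
    rcases le_or_gt m (r + s + 1) with h | h
    · exact (tateTriple_inH_inC_inH_of_le h v u t) ▸ inH_mem_homog _ (by omega)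
    · exact (tateTriple_inH_inC_inH_of_lt h v u t) ▸ zero_mem _
  | .ofNat m, .ofNat n, c, v, u, t =>
    exact (tateTriple_inC_inC m n v u _) ▸ zero_mem _
  | .negSucc r, .negSucc s, c, v, u, t =>
    exact (tateTriple_inH_inH r s v u _) ▸ zero_mem _
  | a, .ofNat m, .ofNat n, v, u, t =>
    exact (tateTriple_mid_inC_inC m n u t _) ▸ zero_mem _
  | a, .negSucc r, .negSucc s, v, u, t =>
    exact (tateTriple_mid_inH_inH r s u t _) ▸ zero_mem _

lemma tateDiff_cyclic_gen {d₀ d₁ : ℤ} {x₀ x₁ : ⨁ i, TateHoch k G i} (h₀ : IsGen d₀ x₀)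
    (h₁ : IsGen d₁ x₁) :
    tatePair k G x₀ (tateDiff k G x₁) = sg (d₀ + 1) • tatePair k G (tateDiff k G x₀) x₁ := by
  have key : ∀ (n : ℕ) (f : List G → MonoidAlgebra k G) (_ : IsCoch n f) (w : List G)
      (ρ : MonoidAlgebra k G), tatePair k G (coch k f n) (tateDiff k G (chn k w ρ)) =
        sg w.length • coeffAt k G 1 (barDelta f w * ρ) := by
    intro n f hf w ρ
    rw [tateDiff_chn, map_add, tatePair_coch_coch, add_zero, map_zsmul, map_barDelta]
    simp only [tatePair_coch_chn hf]
    have h1 := map_barDelta (AddMonoidHom.mulRight ρ) f w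
    simp only [AddMonoidHom.coe_mulRight] at h1
    rw [← map_barDelta (coeffAt k G 1), h1]
  cases h₀ with
  | coch n f hf =>
    cases h₁ with
    | coch m h hh => simp [tateDiff_coch hf, tateDiff_coch hh]
    | chn w ρ =>
      rw [key n f hf, tateDiff_coch hf, tatePair_coch_chn hf.barDelta, ← coeffAt_zsmul,
        ← coeffAt_zsmul, ← smul_mul_assoc, ← smul_mul_assoc]
      have := hf.barDelta.sg_smul w
      push_cast at this
      rw [this]
  | chn w ρ =>
    cases h₁ with
    | coch n f hf =>
      rw [tatePair_symm _ (coch k f n), key n f hf, tateDiff_coch hf,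
        tatePair_chn_coch hf.barDelta, smul_smul, ← sg_add]
      rw [sg_congr (b := 0) (by omega), sg_zero, one_smul]
    | chn v σ =>
      rw [tateDiff_chn, tateDiff_chn, map_add, map_add, LinearMap.add_apply, map_zsmul, map_zsmul,
        LinearMap.smul_apply, map_barDelta, tatePair_chn_coch (isCoch_normFun _ _),
        tatePair_coch_chn (isCoch_normFun _ _)]
      have : tatePair k G (barDelta (fun l => chn k l ρ) w) (chn k v σ) = 0 := by
        rw [tatePair_symm, map_barDelta]
        simp
      rw [this]
      simp only [tatePair_chn_chn, barDelta_zero, smul_zero, zero_add, normFun]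
      by_cases h : w = [] ∧ v = []
      · rw [if_pos h, if_pos ⟨h.2, h.1⟩]
        simp only [h.1, List.length_nil, Nat.cast_zero, neg_zero]
        rw [sg_congr (b := 0) (by omega), sg_zero, one_smul]
        congr 1
        ring
      · rw [if_neg h, if_neg fun h' => h h'.symm]
        simp

lemma tateDiff_cyclic {d₀ d₁ : ℤ} {x₀ x₁ : ⨁ i, TateHoch k G i} (h₀ : x₀ ∈ tateHomog k G d₀)
    (h₁ : x₁ ∈ tateHomog k G d₁) :
    tatePair k G x₀ (tateDiff k G x₁) = sg (d₀ + 1) • tatePair k G (tateDiff k G x₀) x₁ := by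
  refine eq_of_eq_on_gen (F := fun x₀ => tatePair k G x₀ (tateDiff k G x₁))
    (F' := fun x₀ => sg (d₀ + 1) • tatePair k G (tateDiff k G x₀) x₁)
    ⟨by simp, by simp⟩ ⟨by simp, by intros; simp; ring⟩ (fun x₀ h₀ => ?_) h₀
  exact eq_of_eq_on_gen (F := fun x₁ => tatePair k G x₀ (tateDiff k G x₁))
    (F' := fun x₁ => sg (d₀ + 1) • tatePair k G (tateDiff k G x₀) x₁)
    ⟨by simp, by simp⟩ ⟨by simp, by intros; simp; ring⟩
    (fun x₁ h₁ => tateDiff_cyclic_gen h₀ h₁) h₁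

lemma tateCup_cyclic_gen {d₀ d₁ d₂ : ℤ} {x₀ x₁ x₂ : ⨁ i, TateHoch k G i} (h₀ : IsGen d₀ x₀)
    (h₁ : IsGen d₁ x₁) (h₂ : IsGen d₂ x₂) :
    tatePair k G x₀ (tateCup k G x₁ x₂) = tatePair k G (tateCup k G x₀ x₁) x₂ := by
  cases h₀ with
  | coch l e he =>
    cases h₁ with
    | coch m f hf =>
      cases h₂ with
      | coch n h hh =>
        rw [tateCup_coch_coch hf hh, tateCup_coch_coch he hf]
        simp
      | chn w ρ =>
        rw [tateCup_coch_chn hf, tateCup_coch_coch he hf, tatePair_coch_chn (he.conv hf), map_add,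
          tatePair_coch_coch, add_zero, map_splitSum, conv, splitSum_mul_right, map_splitSum]
        refine splitSum_congr fun a b _ => ?_
        rw [tatePair_coch_chn he, mul_assoc]
    | chn w ρ =>
      cases h₂ with
      | coch n h hh =>
        rw [tateCup_chn_coch hh, tateCup_coch_chn he, tatePair_symm _ (coch k h n), map_add,
          map_add, tatePair_coch_coch, tatePair_coch_coch, add_zero, add_zero, map_splitSum,
          map_splitSum]
        refine splitSum_congr fun a b _ => ?_
        rw [tatePair_coch_chn he, tatePair_coch_chn hh]
        congr 1
        ring
      | chn v σ =>
        rw [tateCup_chn_chn, tateCup_coch_chn he, tatePair_symm _ (chn k v σ), map_add, map_sum,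
          map_splitSum, tatePair_chn_coch (he.sum_left w ρ)]
        simp only [tatePair_chn_chn, splitSum_zero, zero_add, Finset.sum_mul, map_sum]
        refine Finset.sum_congr rfl fun g _ => ?_
        rw [tatePair_coch_chn he, mul_assoc]
  | chn u τ =>
    cases h₁ with
    | coch m f hf =>
      cases h₂ with
      | coch n h hh =>
        rw [tateCup_coch_coch hf hh, tateCup_chn_coch hf, tatePair_chn_coch (hf.conv hh),
          tatePair_symm _ (coch k h n), map_add, tatePair_coch_coch, add_zero, map_splitSum, conv,
          splitSum_mul_right, map_splitSum]
        refine splitSum_congr fun a b _ => ?_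
        rw [tatePair_coch_chn hh]
        congr 1
        ring
      | chn w ρ =>
        rw [tateCup_coch_chn hf, tateCup_chn_coch hf, tatePair_symm _ (chn k w ρ), map_add, map_add,
          map_splitSum, map_splitSum, tatePair_chn_coch (hf.sum_left w ρ),
          tatePair_chn_coch (hf.sum_right u τ)]
        simp only [tatePair_chn_chn, splitSum_zero, zero_add]
        congr 1
        ring
    | chn w ρ =>
      cases h₂ with
      | coch n h hh =>
        rw [tateCup_chn_coch hh, tateCup_chn_chn, tatePair_symm _ (coch k h n), map_add, map_sum,
          map_splitSum, tatePair_chn_coch (hh.sum_right w ρ)]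
        simp only [tatePair_chn_chn, splitSum_zero, zero_add, Finset.sum_mul, map_sum]
        refine Finset.sum_congr rfl fun g _ => ?_
        rw [tatePair_coch_chn hh]
        congr 1
        ring
      | chn v σ =>
        rw [tateCup_chn_chn, tateCup_chn_chn, tatePair_symm _ (chn k v σ), map_sum, map_sum]
        simp

lemma tateCup_cyclic {d₀ d₁ d₂ : ℤ} {x₀ x₁ x₂ : ⨁ i, TateHoch k G i}
    (h₀ : x₀ ∈ tateHomog k G d₀) (h₁ : x₁ ∈ tateHomog k G d₁) (h₂ : x₂ ∈ tateHomog k G d₂) :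
    tatePair k G x₀ (tateCup k G x₁ x₂) = tatePair k G (tateCup k G x₀ x₁) x₂ := by
  refine eq_of_eq_on_gen (F := fun x₀ => tatePair k G x₀ (tateCup k G x₁ x₂))
    (F' := fun x₀ => tatePair k G (tateCup k G x₀ x₁) x₂)
    ⟨by simp, by simp⟩ ⟨by simp, by simp⟩ (fun x₀ h₀ => ?_) h₀
  refine eq_of_eq_on_gen (F := fun x₁ => tatePair k G x₀ (tateCup k G x₁ x₂))
    (F' := fun x₁ => tatePair k G (tateCup k G x₀ x₁) x₂)
    ⟨by simp, by simp⟩ ⟨by simp, by simp⟩ (fun x₁ h₁ => ?_) h₁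
  exact eq_of_eq_on_gen (F := fun x₂ => tatePair k G x₀ (tateCup k G x₁ x₂))
    (F' := fun x₂ => tatePair k G (tateCup k G x₀ x₁) x₂)
    ⟨by simp, by simp⟩ ⟨by simp, by simp⟩ (fun x₂ h₂ => tateCup_cyclic_gen h₀ h₁ h₂) h₂

lemma bracket_eq_crossSum {R : Type*} [CommRing R] (f h : List G → R) (w v : List G) :
    bracket f h w v = crossSum w v fun c d a b g =>
      sg a.length • (f (a ++ g :: d) * h (c ++ g⁻¹ :: b)) := by
  rw [bracket, crossSum, splitSum_comm]
  rfl

lemma crossSum_inv {M : Type*} [AddCommGroup M] (v w : List G)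
    (F : List G → List G → List G → List G → G → M) :
    crossSum v w F = crossSum v w fun a b c d g => F a b c d g⁻¹ := by
  rw [crossSum_swap, crossSum, splitSum_comm]
  rfl

lemma tateTriple_cyclic_chn_coch {l m : ℕ} {e f : List G → MonoidAlgebra k G} (he : IsCoch l e)
    (hf : IsCoch m f) (u w : List G) (τ ρ : MonoidAlgebra k G) :
    tatePair k G (chn k u τ) (tateTriple k G (coch k e l) (chn k w ρ) (coch k f m)) =
      sg u.length •
        tatePair k G (tateTriple k G (chn k u τ) (coch k e l) (chn k w ρ)) (coch k f m) := by
  rw [tateTriple_chn_coch_chn he, tateTriple_coch_chn_coch he hf,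
    tatePair_chn_coch (he.bracket hf w ρ), tatePair_symm _ (coch k f m), map_neg, map_crossSum,
    bracket_eq_crossSum, neg_mul, map_neg, crossSum_mul_right, crossSum_mul_right,
    map_crossSum, smul_neg, ← crossSum_zsmul]
  congr 1
  refine crossSum_congr fun c d a b g _ hab => ?_
  rw [map_zsmul, tatePair_coch_chn hf, smul_smul, ← hab, List.length_append, ← sg_add,
    ← coeffAt_zsmul, smul_mul_assoc, smul_mul_assoc]
  congr 2
  · exact sg_congr (by push_cast; omega)
  · ring

lemma tateTriple_cyclic_coch_chn {l m : ℕ} {e f : List G → MonoidAlgebra k G} (he : IsCoch l e)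
    (hf : IsCoch m f) (w v : List G) (ρ σ : MonoidAlgebra k G) :
    tatePair k G (coch k e l) (tateTriple k G (chn k w ρ) (coch k f m) (chn k v σ)) =
      sg (l + 1) •
        tatePair k G (tateTriple k G (coch k e l) (chn k w ρ) (coch k f m)) (chn k v σ) := by
  rw [tateTriple_chn_coch_chn hf, tateTriple_coch_chn_coch he hf,
    tatePair_coch_chn (he.bracket hf w ρ), map_neg, map_crossSum, bracket, crossSum_inv,
    neg_mul, map_neg, crossSum_mul_right, crossSum_mul_right, map_crossSum,
    smul_neg, ← crossSum_zsmul]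
  congr 1
  refine crossSum_congr fun a b c d g _ _ => ?_
  rw [map_zsmul, tatePair_coch_chn he, ← coeffAt_zsmul, ← coeffAt_zsmul]
  congr 1
  have h1 := he.sg_smul (a ++ g :: d)
  simp only [inv_inv]
  have h2 : sg (l + 1) • sg a.length • e (a ++ g :: d) = sg d.length • e (a ++ g :: d) := by
    rw [smul_smul, ← sg_add, show (l + 1 + a.length : ℤ) = (1 + a.length) + l by ring, sg_add,
      mul_smul, h1, smul_smul, ← sg_add]
    congr 1
    refine sg_congr ?_
    simp only [List.length_append, List.length_cons]
    push_cast
    omega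
  rw [← smul_mul_assoc, ← h2]
  simp only [smul_mul_assoc, mul_assoc]

lemma tatePair_chn_tateTriple {m : ℕ} {f : List G → MonoidAlgebra k G} (hf : IsCoch m f)
    (u w v : List G) (τ ρ σ : MonoidAlgebra k G) :
    tatePair k G (chn k u τ) (tateTriple k G (chn k w ρ) (coch k f m) (chn k v σ)) = 0 := by
  rw [tateTriple_chn_coch_chn hf, map_neg, map_crossSum, neg_eq_zero]
  refine crossSum_eq_zero fun a b c d g _ _ => ?_
  rw [map_zsmul, tatePair_chn_chn, smul_zero]

lemma tateTriple_cyclic_gen {d₀ d₁ d₂ d₃ : ℤ} {x₀ x₁ x₂ x₃ : ⨁ i, TateHoch k G i}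
    (h₀ : IsGen d₀ x₀) (h₁ : IsGen d₁ x₁) (h₂ : IsGen d₂ x₂) (h₃ : IsGen d₃ x₃) :
    tatePair k G x₀ (tateTriple k G x₁ x₂ x₃) =
      sg (d₀ + 1) • tatePair k G (tateTriple k G x₀ x₁ x₂) x₃ := by
  cases h₁ with
  | coch l e he =>
    cases h₂ with
    | coch m f hf => simp
    | chn w ρ =>
      cases h₀ with
      | coch n h hh =>
        cases h₃ with
        | coch p q hq => simp [tateTriple_coch_chn_coch he hq]
        | chn v σ => simp
      | chn u τ =>
        cases h₃ with
        | coch p q hq =>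
          rw [tateTriple_cyclic_chn_coch he hq,
            sg_congr (a := -u.length - 1 + 1) (b := u.length) (by omega)]
        | chn v σ =>
          rw [tatePair_symm _ (chn k v σ), tatePair_chn_tateTriple he, tateTriple_chn_chn_right]
          simp
  | chn w ρ =>
    cases h₂ with
    | chn v σ => simp
    | coch m f hf =>
      cases h₀ with
      | coch l e he =>
        cases h₃ with
        | coch p q hq => simp [tateTriple_coch_chn_coch he hf]
        | chn v σ => exact tateTriple_cyclic_coch_chn he hf w v ρ σ
      | chn u τ =>
        cases h₃ with
        | coch p q hq => simp
        | chn v σ => simp [tatePair_chn_tateTriple hf]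

lemma tateTriple_cyclic {d₀ d₁ d₂ d₃ : ℤ} {x₀ x₁ x₂ x₃ : ⨁ i, TateHoch k G i}
    (h₀ : x₀ ∈ tateHomog k G d₀) (h₁ : x₁ ∈ tateHomog k G d₁) (h₂ : x₂ ∈ tateHomog k G d₂)
    (h₃ : x₃ ∈ tateHomog k G d₃) :
    tatePair k G x₀ (tateTriple k G x₁ x₂ x₃) =
      sg (d₀ + 1) • tatePair k G (tateTriple k G x₀ x₁ x₂) x₃ := by
  refine eq_of_eq_on_gen (F := fun x₀ => tatePair k G x₀ (tateTriple k G x₁ x₂ x₃))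
    (F' := fun x₀ => sg (d₀ + 1) • tatePair k G (tateTriple k G x₀ x₁ x₂) x₃)
    ⟨by simp, by simp⟩ ⟨by simp, by intros; simp; ring⟩ (fun x₀ h₀ => ?_) h₀
  refine eq_of_eq_on_gen (F := fun x₁ => tatePair k G x₀ (tateTriple k G x₁ x₂ x₃))
    (F' := fun x₁ => sg (d₀ + 1) • tatePair k G (tateTriple k G x₀ x₁ x₂) x₃)
    ⟨by simp, by simp⟩ ⟨by simp, by intros; simp; ring⟩ (fun x₁ h₁ => ?_) h₁
  refine eq_of_eq_on_gen (F := fun x₂ => tatePair k G x₀ (tateTriple k G x₁ x₂ x₃))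
    (F' := fun x₂ => sg (d₀ + 1) • tatePair k G (tateTriple k G x₀ x₁ x₂) x₃)
    ⟨by simp, by simp⟩ ⟨by simp, by intros; simp; ring⟩ (fun x₂ h₂ => ?_) h₂
  exact eq_of_eq_on_gen (F := fun x₃ => tatePair k G x₀ (tateTriple k G x₁ x₂ x₃))
    (F' := fun x₃ => sg (d₀ + 1) • tatePair k G (tateTriple k G x₀ x₁ x₂) x₃)
    ⟨by simp, by simp⟩ ⟨by simp, by intros; simp; ring⟩
    (fun x₃ h₃ => tateTriple_cyclic_gen h₀ h₁ h₂ h₃) h₃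

end Homogeneous

/-! ### Rotation of the Stasheff identities -/

section Rotation

variable {k : Type*} [Field k] {G : Type*} [CommGroup G]

lemma pairCH_eq_zero {n s : ℕ} (h : n ≠ s) : pairCH k G n s = 0 := by
  have h1 : (fun x : G × BarTuple G s => (symmForm k G).flip (gp k x.1) ∘ₗ
      (evalAt k x.2.1 : HochCochain k G n →ₗ[k] _)) = 0 := by
    funext x
    rw [evalAt, dif_neg (fun h' => h (h'.1.symm.trans x.2.2.1)), LinearMap.comp_zero]
    rfl
  rw [pairCH, h1]
  ext
  simp [basisLift]

lemma IsGen.eq_coch {d : ℤ} {x : ⨁ i, TateHoch k G i} (h : IsGen d x) (hd : 0 ≤ d) :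
    ∃ (n : ℕ) (f : List G → MonoidAlgebra k G), IsCoch n f ∧ d = n ∧ x = _root_.coch k f n := by
  cases h with
  | coch n f hf => exact ⟨n, f, hf, rfl, rfl⟩
  | chn w ρ => omega

lemma IsGen.eq_chn {d : ℤ} {x : ⨁ i, TateHoch k G i} (h : IsGen d x) (hd : d < 0) :
    ∃ (w : List G) (ρ : MonoidAlgebra k G), d = -w.length - 1 ∧ x = _root_.chn k w ρ := by
  cases h with
  | coch n f hf => omega
  | chn w ρ => exact ⟨w, ρ, rfl, rfl⟩

/-- A function of cyclic words of homogeneous elements which is linear in the first letter and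
whose vanishing is invariant under rotation vanishes if it vanishes on the generators. -/
lemma eq_zero_of_rotation {T : List (ℤ × ⨁ i, TateHoch k G i) → k}
    (hlin : ∀ d L, ∃ F : (⨁ i, TateHoch k G i) →ₗ[k] k, ∀ x, T ((d, x) :: L) = F x)
    (hrot : ∀ e L, (∀ p ∈ e :: L, p.2 ∈ tateHomog k G p.1) → T (L ++ [e]) = 0 → T (e :: L) = 0)
    (hgen : ∀ L, (∀ p ∈ L, IsGen p.1 p.2) → T L = 0)
    {L : List (ℤ × ⨁ i, TateHoch k G i)} (hL : ∀ p ∈ L, p.2 ∈ tateHomog k G p.1) : T L = 0 := by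
  suffices ∀ L' : List (ℤ × ⨁ i, TateHoch k G i), (∀ p ∈ L', IsGen p.1 p.2) →
      T (L ++ L') = 0 by simpa using this [] (by simp)
  induction L with
  | nil => exact fun L' h => hgen L' h
  | cons e L ih =>
    intro L' h'
    obtain ⟨d, x⟩ := e
    obtain ⟨F, hF⟩ := hlin d (L ++ L')
    rw [List.cons_append, hF]
    refine eq_of_eq_on_gen (F := F) (F' := fun _ => 0) F.isLinear ⟨by simp, by simp⟩
      (fun y hy => ?_) (hL (d, x) List.mem_cons_self)
    rw [← hF]
    -- The first letter is now a generator; it is moved to the end of the word.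
    refine hrot _ _ ?_ ?_
    · intro p hp
      rcases List.mem_cons.1 hp with rfl | hp
      · exact hy.mem_homog
      · rcases List.mem_append.1 hp with hp | hp
        · exact hL p (List.mem_cons_of_mem _ hp)
        · exact (h' p hp).mem_homog
    · rw [List.append_assoc]
      refine ih (fun p hp => hL p (List.mem_cons_of_mem _ hp)) _ fun p hp => ?_
      rcases List.mem_append.1 hp with hp | hp
      · exact h' p hp
      · rw [List.mem_singleton.1 hp]
        exact hy

lemma tatePair_eq_zero {a b : ℤ} {x y : ⨁ i, TateHoch k G i} (hx : x ∈ tateHomog k G a)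
    (hy : y ∈ tateHomog k G b) (h : a + b ≠ -1) : tatePair k G x y = 0 := by
  obtain ⟨v, rfl⟩ := hx
  obtain ⟨u, rfl⟩ := hy
  refine (extend₂_lof (pairDeg k G) a b v u).trans ?_
  match a, b, v, u with
  | .ofNat n, .negSucc s, v, u =>
    have e1 := Int.negSucc_eq s
    have e2 : Int.ofNat n = (n : ℤ) := rfl
    change pairCH k G n s v u = 0
    rw [pairCH_eq_zero (by omega)]
    rfl
  | .negSucc s, .ofNat n, v, u =>
    have e1 := Int.negSucc_eq s
    have e2 : Int.ofNat n = (n : ℤ) := rfl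
    change pairCH k G n s u v = 0
    rw [pairCH_eq_zero (by omega)]
    rfl
  | .ofNat n, .ofNat m, v, u => rfl
  | .negSucc n, .negSucc m, v, u => rfl

variable [Fintype G]

/-- The ternary product of homogeneous elements vanishes unless the signs of the degrees
alternate, in which case the product lies on the same side as the outer factors. -/
lemma tateTriple_eq_zero {a b c : ℤ} {x y z : ⨁ i, TateHoch k G i} (hx : x ∈ tateHomog k G a)
    (hy : y ∈ tateHomog k G b) (hz : z ∈ tateHomog k G c)
    (h : ¬((0 ≤ a ∧ b < 0 ∧ 0 ≤ c ∧ 0 ≤ a + b + c - 1) ∨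
      (a < 0 ∧ 0 ≤ b ∧ c < 0 ∧ a + b + c - 1 < 0))) : tateTriple k G x y z = 0 := by
  obtain ⟨v, rfl⟩ := hx
  obtain ⟨u, rfl⟩ := hy
  obtain ⟨t, rfl⟩ := hz
  match a, b, c, v, u, t with
  | .ofNat m, .negSucc r, .ofNat n, v, u, t =>
    have e1 := Int.negSucc_eq r
    have e2 : Int.ofNat n = (n : ℤ) := rfl
    have e3 : Int.ofNat m = (m : ℤ) := rfl
    exact tateTriple_inC_inH_inC_of_lt (by omega) v u t
  | .negSucc r, .ofNat m, .negSucc s, v, u, t =>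
    have e1 := Int.negSucc_eq r
    have e2 := Int.negSucc_eq s
    have e3 : Int.ofNat m = (m : ℤ) := rfl
    exact tateTriple_inH_inC_inH_of_lt (by omega) v u t
  | .ofNat m, .ofNat n, c, v, u, t => exact tateTriple_inC_inC m n v u _
  | .negSucc r, .negSucc s, c, v, u, t => exact tateTriple_inH_inH r s v u _
  | a, .ofNat m, .ofNat n, v, u, t => exact tateTriple_mid_inC_inC m n u t _
  | a, .negSucc r, .negSucc s, v, u, t => exact tateTriple_mid_inH_inH r s u t _

lemma eq_zero_of_sg_smul {M : Type*} [AddCommGroup M] {n : ℤ} {x y : M} (h : x = sg n • y)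
    (hx : x = 0) : y = 0 := by
  have h1 : sg n • x = y := by rw [h, smul_smul, sg_mul_self, one_smul]
  rw [← h1, hx, smul_zero]

variable (k G)

/-- The Stasheff expression in two elements; the first has degree `d₁`. -/
def stasheffTwo (d₁ : ℤ) (x₁ x₂ : ⨁ i, TateHoch k G i) : ⨁ i, TateHoch k G i :=
  -tateCup k G (tateDiff k G x₁) x₂ - sg d₁ • tateCup k G x₁ (tateDiff k G x₂)
    + tateDiff k G (tateCup k G x₁ x₂)

/-- The Stasheff expression in three elements; the first two have degrees `d₁` and `d₂`. -/
def stasheffThree (d₁ d₂ : ℤ) (x₁ x₂ x₃ : ⨁ i, TateHoch k G i) : ⨁ i, TateHoch k G i :=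
  tateTriple k G (tateDiff k G x₁) x₂ x₃ + sg d₁ • tateTriple k G x₁ (tateDiff k G x₂) x₃
    + sg (d₁ + d₂) • tateTriple k G x₁ x₂ (tateDiff k G x₃)
    + (tateCup k G (tateCup k G x₁ x₂) x₃ - tateCup k G x₁ (tateCup k G x₂ x₃))
    + tateDiff k G (tateTriple k G x₁ x₂ x₃)

/-- The Stasheff expression in four elements; the first has degree `d₁`. -/
def stasheffFour (d₁ : ℤ) (x₁ x₂ x₃ x₄ : ⨁ i, TateHoch k G i) : ⨁ i, TateHoch k G i :=
  tateTriple k G (tateCup k G x₁ x₂) x₃ x₄ - tateTriple k G x₁ (tateCup k G x₂ x₃) x₄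
    + tateTriple k G x₁ x₂ (tateCup k G x₃ x₄)
    - tateCup k G (tateTriple k G x₁ x₂ x₃) x₄
    - sg d₁ • tateCup k G x₁ (tateTriple k G x₂ x₃ x₄)

/-- The Stasheff expression in five elements; the first two have degrees `d₁` and `d₂`. -/
def stasheffFive (d₁ d₂ : ℤ) (x₁ x₂ x₃ x₄ x₅ : ⨁ i, TateHoch k G i) : ⨁ i, TateHoch k G i :=
  tateTriple k G (tateTriple k G x₁ x₂ x₃) x₄ x₅
    + sg d₁ • tateTriple k G x₁ (tateTriple k G x₂ x₃ x₄) x₅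
    + sg (d₁ + d₂) • tateTriple k G x₁ x₂ (tateTriple k G x₃ x₄ x₅)

variable {k G}

lemma stasheffTwo_rotate {d₀ d₁ d₂ : ℤ} {x₀ x₁ x₂ : ⨁ i, TateHoch k G i}
    (h₀ : x₀ ∈ tateHomog k G d₀) (h₁ : x₁ ∈ tateHomog k G d₁) (h₂ : x₂ ∈ tateHomog k G d₂) :
    tatePair k G x₀ (stasheffTwo k G d₁ x₁ x₂) =
      sg d₀ • tatePair k G x₂ (stasheffTwo k G d₀ x₀ x₁) := by
  rw [tatePair_symm x₂]
  simp only [stasheffTwo, map_add, map_sub, map_neg, map_zsmul, LinearMap.add_apply,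
    LinearMap.sub_apply, LinearMap.neg_apply, LinearMap.smul_apply]
  rw [tateCup_cyclic h₀ (tateDiff_mem h₁ rfl) h₂, tateCup_cyclic h₀ h₁ (tateDiff_mem h₂ rfl),
    tateDiff_cyclic (tateCup_mem h₀ h₁ rfl) h₂, tateDiff_cyclic h₀ (tateCup_mem h₁ h₂ rfl),
    tateCup_cyclic (tateDiff_mem h₀ rfl) h₁ h₂]
  have e1 : sg d₁ * sg (d₀ + d₁ + 1) = -sg d₀ := by
    rw [← sg_add]; exact sg_congr_neg (by omega)
  have e2 : sg (d₀ + 1) = -sg d₀ := sg_congr_neg (by omega)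
  simp only [smul_add, smul_sub, smul_neg, smul_smul, e1, e2, sg_mul_self]
  module

lemma stasheffThree_rotate {d₀ d₁ d₂ d₃ : ℤ} {x₀ x₁ x₂ x₃ : ⨁ i, TateHoch k G i}
    (h₀ : x₀ ∈ tateHomog k G d₀) (h₁ : x₁ ∈ tateHomog k G d₁) (h₂ : x₂ ∈ tateHomog k G d₂)
    (h₃ : x₃ ∈ tateHomog k G d₃) :
    tatePair k G x₀ (stasheffThree k G d₁ d₂ x₁ x₂ x₃) =
      sg 1 • tatePair k G x₃ (stasheffThree k G d₀ d₁ x₀ x₁ x₂) := by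
  rw [tatePair_symm x₃]
  simp only [stasheffThree, map_add, map_sub, map_zsmul, LinearMap.add_apply,
    LinearMap.sub_apply, LinearMap.smul_apply]
  rw [tateTriple_cyclic h₀ (tateDiff_mem h₁ rfl) h₂ h₃,
    tateTriple_cyclic h₀ h₁ (tateDiff_mem h₂ rfl) h₃,
    tateTriple_cyclic h₀ h₁ h₂ (tateDiff_mem h₃ rfl),
    tateDiff_cyclic (tateTriple_mem h₀ h₁ h₂ rfl) h₃,
    tateDiff_cyclic h₀ (tateTriple_mem h₁ h₂ h₃ rfl),
    tateTriple_cyclic (tateDiff_mem h₀ rfl) h₁ h₂ h₃,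
    tateCup_cyclic h₀ (tateCup_mem h₁ h₂ rfl) h₃, tateCup_cyclic h₀ h₁ (tateCup_mem h₂ h₃ rfl),
    tateCup_cyclic (tateCup_mem h₀ h₁ rfl) h₂ h₃]
  have e1 : sg d₁ * sg (d₀ + 1) = -sg (d₀ + d₁) := by
    rw [← sg_add]; exact sg_congr_neg (by omega)
  have e2 : sg (d₀ + 1) = -sg d₀ := sg_congr_neg (by omega)
  have e3 : sg (d₁ + d₂) * (sg (d₀ + 1) * sg (d₀ + d₁ + d₂ - 1 + 1)) = -1 := by
    rw [← sg_add, ← sg_add, ← sg_one]; exact sg_congr (by omega)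
  have e4 : sg (d₀ + 1) * sg (d₀ + 1 + 1) = -1 := by
    rw [← sg_add, ← sg_one]; exact sg_congr (by omega)
  simp only [smul_smul, e1, e3, e4, sg_one]
  rw [e2]
  module

lemma stasheffFour_rotate {d₀ d₁ d₂ d₃ d₄ : ℤ} {x₀ x₁ x₂ x₃ x₄ : ⨁ i, TateHoch k G i}
    (h₀ : x₀ ∈ tateHomog k G d₀) (h₁ : x₁ ∈ tateHomog k G d₁) (h₂ : x₂ ∈ tateHomog k G d₂)
    (h₃ : x₃ ∈ tateHomog k G d₃) (h₄ : x₄ ∈ tateHomog k G d₄) :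
    tatePair k G x₀ (stasheffFour k G d₁ x₁ x₂ x₃ x₄) =
      sg d₀ • tatePair k G x₄ (stasheffFour k G d₀ x₀ x₁ x₂ x₃) := by
  rw [tatePair_symm x₄]
  simp only [stasheffFour, map_add, map_sub, map_zsmul, LinearMap.add_apply,
    LinearMap.sub_apply, LinearMap.smul_apply]
  rw [tateTriple_cyclic h₀ (tateCup_mem h₁ h₂ rfl) h₃ h₄,
    tateTriple_cyclic h₀ h₁ (tateCup_mem h₂ h₃ rfl) h₄,
    tateTriple_cyclic h₀ h₁ h₂ (tateCup_mem h₃ h₄ rfl),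
    tateCup_cyclic (tateTriple_mem h₀ h₁ h₂ rfl) h₃ h₄,
    tateCup_cyclic h₀ (tateTriple_mem h₁ h₂ h₃ rfl) h₄,
    tateCup_cyclic h₀ h₁ (tateTriple_mem h₂ h₃ h₄ rfl),
    tateTriple_cyclic (tateCup_mem h₀ h₁ rfl) h₂ h₃ h₄]
  have e1 : sg d₁ * sg (d₀ + d₁ + 1) = -sg d₀ := by
    rw [← sg_add]; exact sg_congr_neg (by omega)
  have e2 : sg (d₀ + 1) = -sg d₀ := sg_congr_neg (by omega)
  simp only [smul_add, smul_sub, smul_smul, e1, e2, sg_mul_self]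
  module

lemma stasheffFive_rotate {d₀ d₁ d₂ d₃ d₄ d₅ : ℤ} {x₀ x₁ x₂ x₃ x₄ x₅ : ⨁ i, TateHoch k G i}
    (h₀ : x₀ ∈ tateHomog k G d₀) (h₁ : x₁ ∈ tateHomog k G d₁) (h₂ : x₂ ∈ tateHomog k G d₂)
    (h₃ : x₃ ∈ tateHomog k G d₃) (h₄ : x₄ ∈ tateHomog k G d₄) (h₅ : x₅ ∈ tateHomog k G d₅) :
    tatePair k G x₀ (stasheffFive k G d₁ d₂ x₁ x₂ x₃ x₄ x₅) =
      sg 1 • tatePair k G x₅ (stasheffFive k G d₀ d₁ x₀ x₁ x₂ x₃ x₄) := by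
  rw [tatePair_symm x₅]
  simp only [stasheffFive, map_add, map_zsmul, LinearMap.add_apply, LinearMap.smul_apply]
  rw [tateTriple_cyclic h₀ (tateTriple_mem h₁ h₂ h₃ rfl) h₄ h₅,
    tateTriple_cyclic h₀ h₁ (tateTriple_mem h₂ h₃ h₄ rfl) h₅,
    tateTriple_cyclic h₀ h₁ h₂ (tateTriple_mem h₃ h₄ h₅ rfl),
    tateTriple_cyclic (tateTriple_mem h₀ h₁ h₂ rfl) h₃ h₄ h₅]
  have e1 : sg d₁ * sg (d₀ + 1) = -sg (d₀ + d₁) := by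
    rw [← sg_add]; exact sg_congr_neg (by omega)
  have e2 : sg (d₀ + 1) = -sg d₀ := sg_congr_neg (by omega)
  have e3 : sg (d₁ + d₂) * (sg (d₀ + 1) * sg (d₀ + d₁ + d₂ - 1 + 1)) = -1 := by
    rw [← sg_add, ← sg_add, ← sg_one]; exact sg_congr (by omega)
  simp only [smul_smul, e1, e3, sg_one]
  rw [e2]
  module

/-- The cyclic function `⟨x₀, S₂(x₁, x₂)⟩` attached to the Stasheff expression `S₂`. -/
def cyclicTwo : List (ℤ × ⨁ i, TateHoch k G i) → k
  | [x₀, x₁, x₂] => tatePair k G x₀.2 (stasheffTwo k G x₁.1 x₁.2 x₂.2)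
  | _ => 0

/-- The cyclic function `⟨x₀, S₃(x₁, x₂, x₃)⟩` attached to the Stasheff expression `S₃`. -/
def cyclicThree : List (ℤ × ⨁ i, TateHoch k G i) → k
  | [x₀, x₁, x₂, x₃] => tatePair k G x₀.2 (stasheffThree k G x₁.1 x₂.1 x₁.2 x₂.2 x₃.2)
  | _ => 0

/-- The cyclic function `⟨x₀, S₄(x₁, …, x₄)⟩` attached to the Stasheff expression `S₄`. -/
def cyclicFour : List (ℤ × ⨁ i, TateHoch k G i) → k
  | [x₀, x₁, x₂, x₃, x₄] => tatePair k G x₀.2 (stasheffFour k G x₁.1 x₁.2 x₂.2 x₃.2 x₄.2)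
  | _ => 0

/-- The cyclic function `⟨x₀, S₅(x₁, …, x₅)⟩` attached to the Stasheff expression `S₅`. -/
def cyclicFive : List (ℤ × ⨁ i, TateHoch k G i) → k
  | [x₀, x₁, x₂, x₃, x₄, x₅] =>
    tatePair k G x₀.2 (stasheffFive k G x₁.1 x₂.1 x₁.2 x₂.2 x₃.2 x₄.2 x₅.2)
  | _ => 0

lemma cyclicTwo_rotate (e : ℤ × ⨁ i, TateHoch k G i) (L : List (ℤ × ⨁ i, TateHoch k G i))
    (h : ∀ p ∈ e :: L, p.2 ∈ tateHomog k G p.1) (h' : cyclicTwo (L ++ [e]) = 0) :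
    cyclicTwo (e :: L) = 0 := by
  rcases L with - | ⟨a, - | ⟨b, - | ⟨c, L⟩⟩⟩ <;> try rfl
  simp only [List.forall_mem_cons] at h
  exact eq_zero_of_sg_smul (stasheffTwo_rotate h.2.1 h.2.2.1 h.1) h'

lemma cyclicThree_rotate (e : ℤ × ⨁ i, TateHoch k G i) (L : List (ℤ × ⨁ i, TateHoch k G i))
    (h : ∀ p ∈ e :: L, p.2 ∈ tateHomog k G p.1) (h' : cyclicThree (L ++ [e]) = 0) :
    cyclicThree (e :: L) = 0 := by
  rcases L with - | ⟨a, - | ⟨b, - | ⟨c, - | ⟨d, L⟩⟩⟩⟩ <;> try rfl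
  simp only [List.forall_mem_cons] at h
  exact eq_zero_of_sg_smul (stasheffThree_rotate h.2.1 h.2.2.1 h.2.2.2.1 h.1) h'

lemma cyclicFour_rotate (e : ℤ × ⨁ i, TateHoch k G i) (L : List (ℤ × ⨁ i, TateHoch k G i))
    (h : ∀ p ∈ e :: L, p.2 ∈ tateHomog k G p.1) (h' : cyclicFour (L ++ [e]) = 0) :
    cyclicFour (e :: L) = 0 := by
  rcases L with - | ⟨a, - | ⟨b, - | ⟨c, - | ⟨d, - | ⟨f, L⟩⟩⟩⟩⟩ <;> try rfl
  simp only [List.forall_mem_cons] at h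
  exact eq_zero_of_sg_smul (stasheffFour_rotate h.2.1 h.2.2.1 h.2.2.2.1 h.2.2.2.2.1 h.1) h'

lemma cyclicFive_rotate (e : ℤ × ⨁ i, TateHoch k G i) (L : List (ℤ × ⨁ i, TateHoch k G i))
    (h : ∀ p ∈ e :: L, p.2 ∈ tateHomog k G p.1) (h' : cyclicFive (L ++ [e]) = 0) :
    cyclicFive (e :: L) = 0 := by
  rcases L with - | ⟨a, - | ⟨b, - | ⟨c, - | ⟨d, - | ⟨f, - | ⟨g, L⟩⟩⟩⟩⟩⟩ <;> try rfl
  simp only [List.forall_mem_cons] at h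
  exact eq_zero_of_sg_smul
    (stasheffFive_rotate h.2.1 h.2.2.1 h.2.2.2.1 h.2.2.2.2.1 h.2.2.2.2.2.1 h.1) h'

lemma cyclicTwo_linear (d : ℤ) (L : List (ℤ × ⨁ i, TateHoch k G i)) :
    ∃ F : (⨁ i, TateHoch k G i) →ₗ[k] k, ∀ x, cyclicTwo ((d, x) :: L) = F x := by
  rcases L with - | ⟨a, - | ⟨b, - | ⟨c, L⟩⟩⟩
  case cons.cons.nil => exact ⟨(tatePair k G).flip _, fun x => rfl⟩
  all_goals exact ⟨0, fun x => rfl⟩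

lemma cyclicThree_linear (d : ℤ) (L : List (ℤ × ⨁ i, TateHoch k G i)) :
    ∃ F : (⨁ i, TateHoch k G i) →ₗ[k] k, ∀ x, cyclicThree ((d, x) :: L) = F x := by
  rcases L with - | ⟨a, - | ⟨b, - | ⟨c, - | ⟨e, L⟩⟩⟩⟩
  case cons.cons.cons.nil => exact ⟨(tatePair k G).flip _, fun x => rfl⟩
  all_goals exact ⟨0, fun x => rfl⟩

lemma cyclicFour_linear (d : ℤ) (L : List (ℤ × ⨁ i, TateHoch k G i)) :
    ∃ F : (⨁ i, TateHoch k G i) →ₗ[k] k, ∀ x, cyclicFour ((d, x) :: L) = F x := by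
  rcases L with - | ⟨a, - | ⟨b, - | ⟨c, - | ⟨e, - | ⟨f, L⟩⟩⟩⟩⟩
  case cons.cons.cons.cons.nil => exact ⟨(tatePair k G).flip _, fun x => rfl⟩
  all_goals exact ⟨0, fun x => rfl⟩

lemma cyclicFive_linear (d : ℤ) (L : List (ℤ × ⨁ i, TateHoch k G i)) :
    ∃ F : (⨁ i, TateHoch k G i) →ₗ[k] k, ∀ x, cyclicFive ((d, x) :: L) = F x := by
  rcases L with - | ⟨a, - | ⟨b, - | ⟨c, - | ⟨e, - | ⟨f, - | ⟨g, L⟩⟩⟩⟩⟩⟩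
  case cons.cons.cons.cons.cons.nil => exact ⟨(tatePair k G).flip _, fun x => rfl⟩
  all_goals exact ⟨0, fun x => rfl⟩

end Rotation

/-! ### The Stasheff identities in two elements -/

section StasheffTwo

variable {k : Type*} [Field k] {G : Type*} [CommGroup G]

lemma barDelta_mul_right {R : Type*} [CommRing R] (f : List G → R) (r : R) (w : List G) :
    barDelta (fun l => f l * r) w = barDelta f w * r :=
  (map_barDelta (AddMonoidHom.mulRight r) f w).symm

lemma barDelta_mul_left {R : Type*} [CommRing R] (f : List G → R) (r : R) (w : List G) :
    barDelta (fun l => r * f l) w = r * barDelta f w :=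
  (map_barDelta (AddMonoidHom.mulLeft r) f w).symm

lemma IsCoch.barDelta_conv {n : ℕ} {f : List G → MonoidAlgebra k G} (hf : IsCoch n f)
    (h : List G → MonoidAlgebra k G) (w : List G) :
    _root_.barDelta (_root_.conv f h) w =
      _root_.conv (_root_.barDelta f) h w + sg n • _root_.conv f (_root_.barDelta h) w := by
  change _root_.barDelta (fun u => splitSum u fun a b => f a * h b) w = _
  rw [barDelta_splitSum]
  simp only [barDelta_mul_right, barDelta_mul_left]
  congr 1
  rw [_root_.conv, ← splitSum_zsmul]
  refine splitSum_congr fun a b _ => ?_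
  rw [← smul_mul_assoc, ← smul_mul_assoc, hf.sg_smul]

variable [Fintype G]

/-- For two cochains, the identity says that the bar differential is a derivation. -/
lemma stasheffTwo_coch_coch {n m : ℕ} {f h : List G → MonoidAlgebra k G} (hf : IsCoch n f)
    (hh : IsCoch m h) : stasheffTwo k G n (coch k f n) (coch k h m) = 0 := by
  rw [stasheffTwo, tateDiff_coch hf, tateDiff_coch hh, tateCup_coch_coch hf.barDelta hh,
    tateCup_coch_coch hf hh.barDelta, tateCup_coch_coch hf hh, tateDiff_coch (hf.conv hh),
    show n + 1 + m = n + m + 1 by omega, ← add_assoc n m 1, ← coch_neg, ← coch_zsmul,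
    sub_eq_add_neg, ← coch_neg, ← coch_add, ← coch_add]
  refine coch_eq_zero fun w _ => ?_
  rw [hf.barDelta_conv h w]
  abel

lemma tateCup_normFun_chn (w v : List G) (ρ σ : MonoidAlgebra k G) :
    tateCup k G (coch k (normFun k G w ρ) 0) (chn k v σ) =
      if w = [] then Fintype.card G • chn k v (ρ * σ) else 0 := by
  classical
  rw [tateCup_coch_chn (isCoch_normFun w ρ), coch_eq_zero, add_zero]
  · have h1 : ∀ a b : List G, chn k a (normFun k G w ρ b * σ) =
        if b = [] then (if w = [] then Fintype.card G • chn k a (ρ * σ) else 0) else 0 := by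
      intro a b
      by_cases hb : b = [] <;> by_cases hw : w = [] <;>
        simp [normFun, hb, hw, -nsmul_eq_mul]
    simp only [h1, splitSum_ite_right]
  · intro l _
    simp [normFun]

lemma tateCup_chn_normFun (w v : List G) (ρ σ : MonoidAlgebra k G) :
    tateCup k G (chn k v σ) (coch k (normFun k G w ρ) 0) =
      if w = [] then Fintype.card G • chn k v (ρ * σ) else 0 := by
  classical
  rw [tateCup_chn_coch (isCoch_normFun w ρ), coch_eq_zero, add_zero]
  · have h1 : ∀ a b : List G, chn k b (normFun k G w ρ a * σ) =
        if a = [] then (if w = [] then Fintype.card G • chn k b (ρ * σ) else 0) else 0 := by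
      intro a b
      by_cases ha : a = [] <;> by_cases hw : w = [] <;>
        simp [normFun, ha, hw, -nsmul_eq_mul]
    simp only [h1, splitSum_ite_left]
  · intro l _
    simp [normFun]

lemma tateCup_barDelta_chn (w v : List G) (ρ σ : MonoidAlgebra k G) :
    tateCup k G (barDelta (fun l => chn k l ρ) w) (chn k v σ) =
      barDelta (fun l => ∑ g : G, chn k (v ++ g :: l) (ρ * σ)) w := by
  refine (map_barDelta ((tateCup k G).flip (chn k v σ)) (fun l => chn k l ρ) w).trans ?_
  simp only [LinearMap.flip_apply, tateCup_chn_chn]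

lemma tateCup_chn_barDelta (w v : List G) (ρ σ : MonoidAlgebra k G) :
    tateCup k G (chn k w ρ) (barDelta (fun l => chn k l σ) v) =
      barDelta (fun l => ∑ g : G, chn k (l ++ g :: w) (ρ * σ)) v := by
  rw [map_barDelta]
  simp only [tateCup_chn_chn]

/-- For two chains, the identity is the coderivation property `sum_barDelta_append_cons`; the norm
terms there are the products with the degree `0` part of the differentials. -/
lemma stasheffTwo_chn_chn (w v : List G) (ρ σ : MonoidAlgebra k G) :
    stasheffTwo k G (-w.length - 1) (chn k w ρ) (chn k v σ) = 0 := by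
  classical
  have h1 : ∀ g : G, normFun k G (v ++ g :: w) (ρ * σ) = fun _ => 0 := by
    intro g
    funext u
    simp [normFun]
  have h2 : ∀ g : G, sg (v ++ g :: w).length = -(sg v.length * sg w.length) := by
    intro g
    rw [← sg_add]
    exact sg_congr_neg (by simp only [List.length_append, List.length_cons]; push_cast; omega)
  have h3 : sg (-w.length - 1) = -sg w.length := sg_congr_neg (by omega)
  have h4 := sum_barDelta_append_cons (fun l => chn k l (ρ * σ)) v w
  rw [stasheffTwo, tateDiff_chn, tateDiff_chn, tateCup_chn_chn, map_sum]
  simp only [map_add, LinearMap.add_apply, map_zsmul, LinearMap.smul_apply, tateCup_normFun_chn,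
    tateCup_chn_normFun, tateCup_barDelta_chn, tateCup_chn_barDelta, tateDiff_chn, h1, h2, h3,
    Finset.sum_add_distrib, ← Finset.smul_sum, h4]
  simp only [coch_zero, Finset.sum_const_zero, mul_comm σ ρ]
  have e1 : sg v.length * sg v.length = 1 := sg_mul_self _
  have e2 : sg v.length * (sg w.length * sg v.length) = sg w.length := by
    rw [mul_left_comm, e1, mul_one]
  by_cases hv : v = [] <;> by_cases hw : w = [] <;>
    simp [hv, hw, smul_add, smul_sub, smul_smul, e1, e2, mul_comm]
  abel

lemma tateDiff_tateDiff {d : ℤ} {x : ⨁ i, TateHoch k G i} (hx : x ∈ tateHomog k G d) :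
    tateDiff k G (tateDiff k G x) = 0 := by
  refine eq_of_eq_on_gen (F := fun x => tateDiff k G (tateDiff k G x)) (F' := fun _ => 0)
    ⟨by simp, by simp⟩ ⟨by simp, by simp⟩ (fun x h => ?_) hx
  cases h with
  | coch n f hf =>
    rw [tateDiff_coch hf, tateDiff_coch hf.barDelta]
    exact coch_eq_zero fun l _ => barDelta_barDelta f l
  | chn w ρ =>
    classical
    rw [tateDiff_chn, map_add, map_zsmul, map_barDelta, tateDiff_coch (isCoch_normFun w ρ)]
    simp only [tateDiff_chn]
    have h1 : ∀ l, barDelta (normFun k G w ρ) l = 0 := by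
      intro l
      refine Eq.trans ?_ (barDelta_ite_nil (if w = [] then Fintype.card G • ρ else 0) l)
      congr 1
      funext u
      by_cases hu : u = [] <;> by_cases hw : w = [] <;> simp [normFun, hu, hw]
    have h2 : barDelta (fun l => coch k (normFun k G l ρ) 0) w = 0 := by
      refine Eq.trans ?_ (barDelta_ite_nil (coch k (normFun k G [] ρ) 0) w)
      congr 1
      funext u
      by_cases hu : u = []
      · simp [hu]
      · rw [if_neg hu]
        exact coch_eq_zero fun l _ => by simp [normFun, hu]
    rw [barDelta_add, barDelta_sg_smul, barDelta_barDelta, h2, coch_eq_zero fun l _ => h1 l]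
    simp

/-- The Stasheff identity in two generators of the same kind. Up to rotation, three generators
always have two adjacent ones of the same kind, so that this case suffices. -/
lemma stasheffTwo_eq_zero {d₁ d₂ : ℤ} {x₁ x₂ : ⨁ i, TateHoch k G i} (h₁ : IsGen d₁ x₁)
    (h₂ : IsGen d₂ x₂) (h : 0 ≤ d₁ ↔ 0 ≤ d₂) : stasheffTwo k G d₁ x₁ x₂ = 0 := by
  rcases le_or_gt 0 d₁ with h' | h'
  · obtain ⟨n, f, hf, rfl, rfl⟩ := h₁.eq_coch h'
    obtain ⟨m, f', hf', rfl, rfl⟩ := h₂.eq_coch (h.1 h')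
    exact stasheffTwo_coch_coch hf hf'
  · obtain ⟨w, ρ, rfl, rfl⟩ := h₁.eq_chn h'
    obtain ⟨v, σ, rfl, rfl⟩ := h₂.eq_chn (by omega)
    exact stasheffTwo_chn_chn w v ρ σ

lemma cyclicTwo_gen (L : List (ℤ × ⨁ i, TateHoch k G i)) (h : ∀ p ∈ L, IsGen p.1 p.2) :
    cyclicTwo L = 0 := by
  rcases L with - | ⟨a, - | ⟨b, - | ⟨c, - | ⟨e, L⟩⟩⟩⟩ <;> try rfl
  have key : ∀ a b c : ℤ × ⨁ i, TateHoch k G i, IsGen b.1 b.2 → IsGen c.1 c.2 →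
      (0 ≤ b.1 ↔ 0 ≤ c.1) → cyclicTwo [a, b, c] = 0 := fun a b c h₁ h₂ h' => by
    rw [cyclicTwo, stasheffTwo_eq_zero h₁ h₂ h', map_zero]
  have hom : ∀ p ∈ [a, b, c], p.2 ∈ tateHomog k G p.1 := fun p hp => (h p hp).mem_homog
  simp only [List.forall_mem_cons] at h hom
  obtain ⟨ha, hb, hc, -⟩ := h
  by_cases h₁ : 0 ≤ b.1 ↔ 0 ≤ c.1
  · exact key a b c hb hc h₁
  refine cyclicTwo_rotate a [b, c] (by simp [hom]) ?_
  by_cases h₂ : 0 ≤ c.1 ↔ 0 ≤ a.1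
  · exact key b c a hc ha h₂
  exact cyclicTwo_rotate b [c, a] (by simp [hom]) (key c a b ha hb (by tauto))

end StasheffTwo

/-! ### The Stasheff identities in three elements -/

section StasheffThree

variable {k : Type*} [Field k] {G : Type*} [CommGroup G]

lemma coch_sum {ι : Type*} (s : Finset ι) (F : ι → List G → MonoidAlgebra k G) (n : ℕ) :
    coch k (fun l => ∑ i ∈ s, F i l) n = ∑ i ∈ s, coch k (F i) n := by
  simp only [coch, ← map_sum, Finset.sum_mul]
  congr 1
  funext l
  rw [Finset.sum_apply]

lemma IsCoch.apply_append_cons {f : List G → MonoidAlgebra k G} (hf : IsCoch 0 f)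
    (a b : List G) (g : G) : f (a ++ g :: b) = 0 := hf.eq_zero_of_length (by simp)

variable [Fintype G]

lemma tateTriple_coch_zero_right {n : ℕ} {f h : List G → MonoidAlgebra k G} (hf : IsCoch n f)
    (hh : IsCoch 0 h) (w : List G) (ρ : MonoidAlgebra k G) :
    tateTriple k G (coch k f n) (chn k w ρ) (coch k h 0) = 0 := by
  rw [tateTriple_coch_chn_coch hf hh]
  refine coch_eq_zero fun v _ => ?_
  rw [bracket, crossSum_eq_zero fun a b c d g _ _ => by rw [hh.apply_append_cons]; simp]
  simp

lemma tateTriple_coch_zero_mid {f : List G → MonoidAlgebra k G} (hf : IsCoch 0 f)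
    (w v : List G) (ρ σ : MonoidAlgebra k G) :
    tateTriple k G (chn k w ρ) (coch k f 0) (chn k v σ) = 0 := by
  rw [tateTriple_chn_coch_chn hf, neg_eq_zero]
  exact crossSum_eq_zero fun a b c d g _ _ => by rw [hf.apply_append_cons]; simp

lemma tateTriple_barDelta_mid (F : List G → ⨁ i, TateHoch k G i) (w : List G)
    (x y : ⨁ i, TateHoch k G i) :
    tateTriple k G x (barDelta F w) y = barDelta (fun l => tateTriple k G x (F l) y) w :=
  map_barDelta ((tateTriple k G x).flip y) F w

/-- For three cochains, the identity is associativity of concatenation. -/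
lemma stasheffThree_coch_coch_coch {l m n : ℕ} {f h e : List G → MonoidAlgebra k G}
    (hf : IsCoch l f) (hh : IsCoch m h) (he : IsCoch n e) (d₁ d₂ : ℤ) :
    stasheffThree k G d₁ d₂ (coch k f l) (coch k h m) (coch k e n) = 0 := by
  have h1 : conv (conv f h) e = conv f (conv h e) := by
    funext w
    simp only [conv, splitSum_mul_right, splitSum_mul_left, ← mul_assoc]
    exact splitSum_assoc w fun a b c => f a * h b * e c
  rw [stasheffThree, tateDiff_coch hf, tateDiff_coch hh, tateCup_coch_coch hf hh,
    tateCup_coch_coch hh he, tateCup_coch_coch (hf.conv hh) he,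
    tateCup_coch_coch hf (hh.conv he), h1, add_assoc l m n]
  simp

/-- For three chains the ternary products vanish, and the product is associative. -/
lemma stasheffThree_chn_chn_chn (u w v : List G) (τ ρ σ : MonoidAlgebra k G) (d₁ d₂ : ℤ) :
    stasheffThree k G d₁ d₂ (chn k u τ) (chn k w ρ) (chn k v σ) = 0 := by
  have h1 : tateTriple k G (chn k u τ) (tateDiff k G (chn k w ρ)) (chn k v σ) = 0 := by
    rw [tateDiff_chn, map_add, LinearMap.add_apply, map_zsmul, LinearMap.smul_apply,
      tateTriple_barDelta_mid, tateTriple_coch_zero_mid (isCoch_normFun w ρ)]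
    simp
  have h2 : tateCup k G (tateCup k G (chn k u τ) (chn k w ρ)) (chn k v σ) =
      tateCup k G (chn k u τ) (tateCup k G (chn k w ρ) (chn k v σ)) := by
    simp only [tateCup_chn_chn, map_sum, LinearMap.sum_apply, List.append_assoc,
      List.cons_append, mul_assoc]
    rw [Finset.sum_comm]
  rw [stasheffThree, h1, h2]
  simp

/-- For a cochain and two chains the ternary products vanish: the product is associative. -/
lemma stasheffThree_coch_chn_chn {m : ℕ} {f : List G → MonoidAlgebra k G} (hf : IsCoch m f)
    (w v : List G) (ρ σ : MonoidAlgebra k G) (d₁ d₂ : ℤ) :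
    stasheffThree k G d₁ d₂ (coch k f m) (chn k w ρ) (chn k v σ) = 0 := by
  have h1 : tateTriple k G (coch k f m) (tateDiff k G (chn k w ρ)) (chn k v σ) = 0 := by
    rw [tateDiff_chn, map_add, LinearMap.add_apply, map_zsmul, LinearMap.smul_apply,
      tateTriple_barDelta_mid]
    simp
  have h2 : tateTriple k G (coch k f m) (chn k w ρ) (tateDiff k G (chn k v σ)) = 0 := by
    rw [tateDiff_chn, map_add, map_zsmul, map_barDelta,
      tateTriple_coch_zero_right hf (isCoch_normFun v σ)]
    simp
  have h3 : tateCup k G (tateCup k G (coch k f m) (chn k w ρ)) (chn k v σ) =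
      tateCup k G (coch k f m) (tateCup k G (chn k w ρ) (chn k v σ)) := by
    have e1 : ∀ F : List G → List G → ⨁ i, TateHoch k G i,
        tateCup k G (splitSum w F) (chn k v σ) =
          splitSum w fun a b => tateCup k G (F a b) (chn k v σ) := fun F =>
      map_splitSum ((tateCup k G).flip (chn k v σ)) w F
    rw [tateCup_coch_chn hf, tateCup_chn_chn, map_sum, map_add, LinearMap.add_apply, e1,
      tateCup_coch_chn (hf.sum_left w ρ)]
    simp only [tateCup_chn_chn, tateCup_coch_chn hf, splitSum_append_cons, splitSum_sum,
      Finset.sum_add_distrib]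
    rw [add_comm (∑ g : G, splitSum v _), ← add_assoc]
    refine congrArg₂ (· + ·) (congrArg₂ (· + ·) ?_ ?_) ?_
    · simp only [mul_assoc]
    · rw [← splitSum_sum]
      refine splitSum_congr fun a b _ => ?_
      rw [Finset.sum_mul, Finset.sum_mul, map_sum]
      simp only [mul_assoc]
    · have e2 : ∀ g : G, m - (v ++ g :: w).length - 1 = m - w.length - 1 - v.length - 1 := by
        intro g
        simp only [List.length_append, List.length_cons]
        omega
      simp only [e2, ← coch_sum]
      refine coch_congr fun u _ => ?_
      simp only [Finset.sum_mul, List.append_assoc, List.cons_append, mul_assoc]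
      rw [Finset.sum_comm]
  rw [stasheffThree, h1, h2, h3]
  simp

/-- The part of `⟨(v, τ), S₃(f, (w, ρ), h)⟩` which comes from the cup product. -/
lemma tatePair_associator {m n : ℕ} {f h : List G → MonoidAlgebra k G} (hf : IsCoch m f)
    (hh : IsCoch n h) (w v : List G) (ρ τ : MonoidAlgebra k G) :
    tatePair k G (chn k v τ)
      (tateCup k G (tateCup k G (coch k f m) (chn k w ρ)) (coch k h n) -
        tateCup k G (coch k f m) (tateCup k G (chn k w ρ) (coch k h n))) =
    coeffAt k G 1 ((splitSum w (fun c d => ∑ g : G, f d * h (c ++ g :: v))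
      - splitSum v (fun a b => ∑ g : G, f a * h (w ++ g :: b))
      + splitSum v (fun a b => ∑ g : G, f (a ++ g :: w) * h b)
      - splitSum w (fun c d => ∑ g : G, f (v ++ g :: d) * h c)) * (ρ * τ)) := by
  have e1 : ∀ F : List G → List G → ⨁ i, TateHoch k G i,
      tateCup k G (splitSum w F) (coch k h n) =
        splitSum w fun a b => tateCup k G (F a b) (coch k h n) := fun F =>
    map_splitSum ((tateCup k G).flip (coch k h n)) w F
  have c1 : ∀ (a : List G) (x : MonoidAlgebra k G), tatePair k G (chn k v τ)
      (tateCup k G (chn k a x) (coch k h n)) =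
        coeffAt k G 1 ((∑ g : G, h (a ++ g :: v)) * x * τ) := by
    intro a x
    rw [tateCup_chn_coch hh, map_add, map_splitSum, tatePair_chn_coch (hh.sum_right a x)]
    simp
  have c2 : ∀ (a : List G) (x : MonoidAlgebra k G), tatePair k G (chn k v τ)
      (tateCup k G (coch k f m) (chn k a x)) =
        coeffAt k G 1 ((∑ g : G, f (v ++ g :: a)) * x * τ) := by
    intro a x
    rw [tateCup_coch_chn hf, map_add, map_splitSum, tatePair_chn_coch (hf.sum_left a x)]
    simp
  have t1 : tatePair k G (chn k v τ)
      (tateCup k G (tateCup k G (coch k f m) (chn k w ρ)) (coch k h n)) =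
      coeffAt k G 1 ((splitSum w (fun c d => ∑ g : G, f d * h (c ++ g :: v)) +
        splitSum v (fun a b => ∑ g : G, f (a ++ g :: w) * h b)) * (ρ * τ)) := by
    rw [tateCup_coch_chn hf, map_add, LinearMap.add_apply, e1, map_add, map_splitSum,
      tateCup_coch_coch (hf.sum_left w ρ) hh, tatePair_chn_coch ((hf.sum_left w ρ).conv hh),
      add_mul, map_add]
    simp only [c1, conv, splitSum_mul_right, map_splitSum]
    refine congrArg₂ (· + ·) (splitSum_congr fun a b _ => ?_) (splitSum_congr fun a b _ => ?_)
    · rw [← Finset.mul_sum]; congr 1; ring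
    · rw [← Finset.sum_mul]; congr 1; ring
  have t2 : tatePair k G (chn k v τ)
      (tateCup k G (coch k f m) (tateCup k G (chn k w ρ) (coch k h n))) =
      coeffAt k G 1 ((splitSum w (fun c d => ∑ g : G, f (v ++ g :: d) * h c) +
        splitSum v (fun a b => ∑ g : G, f a * h (w ++ g :: b))) * (ρ * τ)) := by
    rw [tateCup_chn_coch hh, map_add, map_add, map_splitSum, map_splitSum,
      tateCup_coch_coch hf (hh.sum_right w ρ), tatePair_chn_coch (hf.conv (hh.sum_right w ρ)),
      add_mul, map_add]
    simp only [c2, conv, splitSum_mul_right, map_splitSum]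
    refine congrArg₂ (· + ·) (splitSum_congr fun a b _ => ?_) (splitSum_congr fun a b _ => ?_)
    · rw [← Finset.sum_mul]; congr 1; ring
    · rw [← Finset.mul_sum]; congr 1; ring
  rw [map_sub, t1, t2, ← map_sub]
  congr 1
  ring

/-- Pairing the ternary product with a chain evaluates the bracket at two words. -/
lemma tatePair_tateTriple_coch {m n : ℕ} {f h : List G → MonoidAlgebra k G} (hf : IsCoch m f)
    (hh : IsCoch n h) (w v : List G) (ρ τ : MonoidAlgebra k G) :
    tatePair k G (chn k v τ) (tateTriple k G (coch k f m) (chn k w ρ) (coch k h n)) =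
      coeffAt k G 1 (-bracket f h w v * (ρ * τ)) := by
  rw [tateTriple_coch_chn_coch hf hh, tatePair_chn_coch (hf.bracket hh w ρ)]
  congr 1
  ring

/-- Since `f` is supported on words of length `m`, the sign `(-1)^|a|` of the bracket can be
expressed by `(-1)^|c|`. -/
lemma sg_smul_bracket {m : ℕ} {f : List G → MonoidAlgebra k G} (hf : IsCoch m f)
    (h : List G → MonoidAlgebra k G) (w v : List G) :
    sg (m + w.length + 1) • bracket f h w v =
      crossSum v w (fun a b c d g => sg c.length • (f (a ++ g :: d) * h (c ++ g⁻¹ :: b))) := by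
  rw [bracket, ← crossSum_zsmul]
  refine crossSum_congr fun a b c d g _ hw => ?_
  have h1 := hf.sg_smul (a ++ g :: d)
  rw [← smul_mul_assoc, ← smul_mul_assoc, ← smul_mul_assoc]
  congr 1
  rw [smul_smul, ← sg_add, show (m + w.length + 1 + a.length : ℤ) = (w.length + 1 + a.length) + m by
    ring, sg_add, mul_smul, h1, smul_smul, ← sg_add, ← hw]
  congr 1
  refine sg_congr ?_
  simp only [List.length_append, List.length_cons]
  push_cast
  omega

/-- For a chain between two cochains, the identity is `crossSum_barDelta` for the function
`K(a, b) = f(a) h(b)`. -/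
lemma stasheffThree_coch_chn_coch {m n : ℕ} {f h : List G → MonoidAlgebra k G} (hf : IsCoch m f)
    (hh : IsCoch n h) (w v : List G) (ρ τ : MonoidAlgebra k G) :
    tatePair k G (chn k v τ)
      (stasheffThree k G m (-w.length - 1) (coch k f m) (chn k w ρ) (coch k h n)) = 0 := by
  have t2 : tatePair k G (chn k v τ)
      (tateTriple k G (coch k f m) (tateDiff k G (chn k w ρ)) (coch k h n)) =
      coeffAt k G 1 (-(sg w.length • barDelta (fun l => bracket f h l v) w) * (ρ * τ)) := by
    rw [tateDiff_chn, map_add, LinearMap.add_apply, tateTriple_coch_coch_left, add_zero,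
      map_zsmul, LinearMap.smul_apply, tateTriple_barDelta_mid, map_zsmul, map_barDelta]
    simp only [tatePair_tateTriple_coch hf hh]
    rw [← map_barDelta (coeffAt k G 1), barDelta_mul_right, barDelta_neg, ← coeffAt_zsmul]
    congr 1
    rw [← smul_mul_assoc, smul_neg]
  have t6 : tatePair k G (chn k v τ)
      (tateDiff k G (tateTriple k G (coch k f m) (chn k w ρ) (coch k h n))) =
      coeffAt k G 1 (-barDelta (fun l => bracket f h w l) v * (ρ * τ)) := by
    rw [tateTriple_coch_chn_coch hf hh, tateDiff_coch (hf.bracket hh w ρ),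
      tatePair_chn_coch (hf.bracket hh w ρ).barDelta, barDelta_neg, barDelta_mul_right]
    congr 1
    ring
  have key := crossSum_barDelta v w fun a b => f a * h b
  have k1 : crossSum v w (fun a b c d g =>
        sg a.length • barDelta (fun l => f l * h (c ++ g⁻¹ :: b)) (a ++ g :: d)
        + sg c.length • barDelta (fun l => f (a ++ g :: d) * h l) (c ++ g⁻¹ :: b)) =
      bracket (barDelta f) h w v + sg (m + w.length + 1) • bracket f (barDelta h) w v := by
    rw [sg_smul_bracket hf, crossSum_add, bracket]
    simp only [barDelta_mul_right, barDelta_mul_left]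
  have k2 : barDelta (fun w => crossSum v w (fun a b c d g =>
        sg c.length • (f (a ++ g :: d) * h (c ++ g⁻¹ :: b)))) w =
      sg (m + w.length) • barDelta (fun l => bracket f h l v) w := by
    rw [← barDelta_zsmul]
    refine barDelta_congr fun l hl => ?_
    rw [← sg_smul_bracket hf, ← hl]
    congr 1
  have k3 : barDelta (fun v => crossSum v w (fun a b c d g =>
        sg a.length • (f (a ++ g :: d) * h (c ++ g⁻¹ :: b)))) v =
      barDelta (fun l => bracket f h w l) v := rfl
  rw [k1, k2, k3] at key
  simp only [stasheffThree, map_add, map_zsmul]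
  rw [tateDiff_coch hf, tateDiff_coch hh, tatePair_tateTriple_coch hf.barDelta hh,
    tatePair_tateTriple_coch hf hh.barDelta, t2, t6, tatePair_associator hf hh,
    ← coeffAt_zsmul, ← coeffAt_zsmul, ← map_add, ← map_add, ← map_add, ← map_add,
    ← smul_mul_assoc, ← smul_mul_assoc, ← add_mul, ← add_mul, ← add_mul, ← add_mul]
  have e1 : sg (m + w.length + 1) = -sg (m + w.length) := sg_congr_neg (by omega)
  have e2 : sg (m + (-w.length - 1)) = -sg (m + w.length) := sg_congr_neg (by omega)
  rw [e1] at key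
  rw [e2, smul_neg, smul_smul, ← sg_add]
  convert map_zero (coeffAt k G 1)
  convert zero_mul (ρ * τ)
  rw [neg_smul] at key
  rw [neg_smul]
  linear_combination (exp := 1) -key

end StasheffThree

/-! ### The Stasheff identities in four and five elements -/

section StasheffFourFive

variable {k : Type*} [Field k] {G : Type*} [CommGroup G] [Fintype G]

/-- The sign patterns for which the Stasheff identity in three elements is checked directly. -/
def DirectThree (a b c d : ℤ) : Prop :=
  (0 ≤ b ∧ 0 ≤ c ∧ 0 ≤ d) ∨ (b < 0 ∧ c < 0 ∧ d < 0) ∨ (0 ≤ b ∧ c < 0 ∧ d < 0) ∨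
    (a < 0 ∧ 0 ≤ b ∧ c < 0 ∧ 0 ≤ d)

lemma directThree_rotate (a b c d : ℤ) : DirectThree a b c d ∨ DirectThree b c d a ∨
    DirectThree c d a b ∨ DirectThree d a b c := by
  rcases le_or_gt 0 a with sa | sa <;> rcases le_or_gt 0 b with sb | sb <;>
    rcases le_or_gt 0 c with sc | sc <;> rcases le_or_gt 0 d with sd | sd <;>
    simp [DirectThree, sa, sb, sc, sd, not_le_of_gt, not_lt_of_ge]

lemma cyclicThree_gen (L : List (ℤ × ⨁ i, TateHoch k G i)) (h : ∀ p ∈ L, IsGen p.1 p.2) :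
    cyclicThree L = 0 := by
  rcases L with - | ⟨a, - | ⟨b, - | ⟨c, - | ⟨d, - | ⟨e, L⟩⟩⟩⟩⟩ <;> try rfl
  have key : ∀ a b c d : ℤ × ⨁ i, TateHoch k G i, IsGen a.1 a.2 → IsGen b.1 b.2 →
      IsGen c.1 c.2 → IsGen d.1 d.2 →
      DirectThree a.1 b.1 c.1 d.1 → cyclicThree [a, b, c, d] = 0 := by
    rintro ⟨i, x⟩ ⟨j, y⟩ ⟨l, z⟩ ⟨m, t⟩ ha hb hc hd
      (⟨h₁, h₂, h₃⟩ | ⟨h₁, h₂, h₃⟩ | ⟨h₁, h₂, h₃⟩ | ⟨h₀, h₁, h₂, h₃⟩) <;> dsimp only at *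
    · obtain ⟨p, f, hf, rfl, rfl⟩ := hb.eq_coch h₁
      obtain ⟨q, f', hf', rfl, rfl⟩ := hc.eq_coch h₂
      obtain ⟨r, f'', hf'', rfl, rfl⟩ := hd.eq_coch h₃
      rw [cyclicThree, stasheffThree_coch_coch_coch hf hf' hf'', map_zero]
    · obtain ⟨u, ρ, rfl, rfl⟩ := hb.eq_chn h₁
      obtain ⟨v, σ, rfl, rfl⟩ := hc.eq_chn h₂
      obtain ⟨w, τ, rfl, rfl⟩ := hd.eq_chn h₃
      rw [cyclicThree, stasheffThree_chn_chn_chn, map_zero]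
    · obtain ⟨p, f, hf, rfl, rfl⟩ := hb.eq_coch h₁
      obtain ⟨v, σ, rfl, rfl⟩ := hc.eq_chn h₂
      obtain ⟨w, τ, rfl, rfl⟩ := hd.eq_chn h₃
      rw [cyclicThree, stasheffThree_coch_chn_chn hf, map_zero]
    · obtain ⟨u, ρ, rfl, rfl⟩ := ha.eq_chn h₀
      obtain ⟨p, f, hf, rfl, rfl⟩ := hb.eq_coch h₁
      obtain ⟨v, σ, rfl, rfl⟩ := hc.eq_chn h₂
      obtain ⟨r, f', hf', rfl, rfl⟩ := hd.eq_coch h₃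
      simp only [cyclicThree]
      exact stasheffThree_coch_chn_coch hf hf' v u σ ρ
  have hom : ∀ p ∈ [a, b, c, d], p.2 ∈ tateHomog k G p.1 := fun p hp => (h p hp).mem_homog
  simp only [List.forall_mem_cons] at h hom
  obtain ⟨ha, hb, hc, hd, -⟩ := h
  have rot₁ := cyclicThree_rotate a [b, c, d] (by simp [hom])
  have rot₂ := cyclicThree_rotate b [c, d, a] (by simp [hom])
  have rot₃ := cyclicThree_rotate c [d, a, b] (by simp [hom])
  rcases directThree_rotate a.1 b.1 c.1 d.1 with h | h | h | h
  · exact key a b c d ha hb hc hd h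
  · exact rot₁ (key b c d a hb hc hd ha h)
  · exact rot₁ (rot₂ (key c d a b hc hd ha hb h))
  · exact rot₁ (rot₂ (rot₃ (key d a b c hd ha hb hc h)))

lemma bracket_smul_left {R : Type*} [CommRing R] (f h : List G → R) (r : R) (w v : List G) :
    bracket (fun l => -(f l * r)) h w v = -(bracket f h w v * r) := by
  rw [← mul_neg, bracket, bracket, crossSum_mul_right]
  refine crossSum_congr fun a b c d g _ _ => ?_
  rw [smul_mul_assoc]
  congr 1
  ring

lemma bracket_smul_right {R : Type*} [CommRing R] (f h : List G → R) (r : R) (w v : List G) :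
    bracket f (fun l => -(h l * r)) w v = -(bracket f h w v * r) := by
  rw [← mul_neg, bracket, bracket, crossSum_mul_right]
  refine crossSum_congr fun a b c d g _ _ => ?_
  rw [smul_mul_assoc]
  congr 1
  ring

/-- This case of the identity is the derivation property `bracket_conv`, paired with a chain. -/
lemma stasheffFour_coch_coch_chn_coch {m n p : ℕ} {f h e : List G → MonoidAlgebra k G}
    (hf : IsCoch m f) (hh : IsCoch n h) (he : IsCoch p e) (w v : List G)
    (ρ τ : MonoidAlgebra k G) :
    tatePair k G (chn k v τ)
      (stasheffFour k G m (coch k f m) (coch k h n) (chn k w ρ) (coch k e p)) = 0 := by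
  have t1 : tatePair k G (chn k v τ)
      (tateTriple k G (coch k f m) (tateCup k G (coch k h n) (chn k w ρ)) (coch k e p)) =
      coeffAt k G 1 (-splitSum w (fun a b => h b * bracket f e a v) * (ρ * τ)) := by
    have e1 : ∀ F : List G → List G → ⨁ i, TateHoch k G i,
        tateTriple k G (coch k f m) (splitSum w F) (coch k e p) =
          splitSum w fun a b => tateTriple k G (coch k f m) (F a b) (coch k e p) := fun F =>
      map_splitSum ((tateTriple k G (coch k f m)).flip (coch k e p)) w F
    rw [tateCup_coch_chn hh, map_add, LinearMap.add_apply, tateTriple_coch_coch_left, add_zero, e1,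
      map_splitSum]
    simp only [tatePair_tateTriple_coch hf he]
    rw [← splitSum_neg, splitSum_mul_right, map_splitSum]
    refine splitSum_congr fun a b _ => congrArg (coeffAt k G 1) ?_
    ring
  have t2 : tatePair k G (chn k v τ)
      (tateCup k G (coch k f m) (tateTriple k G (coch k h n) (chn k w ρ) (coch k e p))) =
      coeffAt k G 1 (-splitSum v (fun a b => f a * bracket h e w b) * (ρ * τ)) := by
    rw [tateTriple_coch_chn_coch hh he, tateCup_coch_coch hf (hh.bracket he w ρ),
      tatePair_chn_coch (hf.conv (hh.bracket he w ρ)), conv, splitSum_mul_right, ← splitSum_neg,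
      splitSum_mul_right]
    congr 1
    refine splitSum_congr fun a b _ => ?_
    ring
  simp only [stasheffFour, map_add, map_sub, map_zsmul]
  rw [tateCup_coch_coch hf hh, tatePair_tateTriple_coch (hf.conv hh) he, t1, t2,
    tateTriple_coch_coch_left, tateTriple_coch_coch_left, bracket_conv, ← coeffAt_zsmul]
  -- The sign is constant on the words `a` with `f a ≠ 0`.
  have e2 : splitSum v (fun a b => sg a.length • (f a * bracket h e w b)) =
      sg m • splitSum v (fun a b => f a * bracket h e w b) := by
    rw [← splitSum_zsmul]
    refine splitSum_congr fun a b _ => ?_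
    rw [← smul_mul_assoc, ← smul_mul_assoc, hf.sg_smul]
  rw [e2, LinearMap.map_zero, LinearMap.map_zero, LinearMap.zero_apply, LinearMap.map_zero,
    ← map_sub, add_zero, sub_zero, ← map_sub]
  convert map_zero (coeffAt k G 1)
  rw [← smul_mul_assoc, smul_neg]
  ring

/-- This case of the identity holds because a decomposition of the word `v x w` cuts it either
to the right or to the left of the letter `x`. -/
lemma stasheffFour_chn_coch_chn_chn {m : ℕ} {f : List G → MonoidAlgebra k G} (hf : IsCoch m f)
    (u w v : List G) (τ ρ σ : MonoidAlgebra k G) (d₁ : ℤ) :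
    stasheffFour k G d₁ (chn k u τ) (coch k f m) (chn k w ρ) (chn k v σ) = 0 := by
  have t1 : tateTriple k G (chn k u τ) (tateCup k G (coch k f m) (chn k w ρ)) (chn k v σ) =
      -∑ x : G, crossSum v u (fun a b c d g =>
        sg d.length • chn k (a ++ g⁻¹ :: d) (f (c ++ g :: (b ++ x :: w)) * (τ * ρ * σ))) := by
    have e1 : ∀ F : List G → List G → ⨁ i, TateHoch k G i,
        tateTriple k G (chn k u τ) (splitSum w F) (chn k v σ) =
          splitSum w fun a b => tateTriple k G (chn k u τ) (F a b) (chn k v σ) := fun F =>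
      map_splitSum ((tateTriple k G (chn k u τ)).flip (chn k v σ)) w F
    rw [tateCup_coch_chn hf, map_add, LinearMap.add_apply, e1,
      tateTriple_chn_coch_chn (hf.sum_left w ρ)]
    simp only [tateTriple_chn_chn_left, splitSum_zero, zero_add, crossSum, ← splitSum_sum]
    refine congrArg Neg.neg ?_
    refine splitSum_congr fun a b _ => splitSum_congr fun c d _ => ?_
    rw [Finset.sum_comm]
    refine Finset.sum_congr rfl fun g _ => ?_
    rw [← Finset.smul_sum, ← map_sum, Finset.sum_mul, Finset.sum_mul]
    simp only [List.append_assoc, List.cons_append, mul_assoc, mul_left_comm ρ τ]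
  have t2 : tateTriple k G (chn k u τ) (coch k f m) (tateCup k G (chn k w ρ) (chn k v σ)) =
      -∑ x : G, crossSum v u (fun a b c d g =>
        sg d.length • chn k (a ++ g⁻¹ :: d) (f (c ++ g :: (b ++ x :: w)) * (τ * ρ * σ)))
      - ∑ x : G, crossSum w u (fun a b c d g =>
        sg d.length • chn k (v ++ x :: (a ++ g⁻¹ :: d)) (f (c ++ g :: b) * (τ * ρ * σ))) := by
    rw [tateCup_chn_chn, map_sum]
    simp only [tateTriple_chn_coch_chn hf]
    rw [Finset.sum_neg_distrib, neg_sub_left, ← Finset.sum_add_distrib]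
    refine congrArg Neg.neg ?_
    refine Finset.sum_congr rfl fun x _ => ?_
    simp only [crossSum, splitSum_append_cons, List.append_assoc, List.cons_append, mul_assoc]
    rw [add_comm]
  have t3 : tateCup k G (tateTriple k G (chn k u τ) (coch k f m) (chn k w ρ)) (chn k v σ) =
      -∑ x : G, crossSum w u (fun a b c d g =>
        sg d.length • chn k (v ++ x :: (a ++ g⁻¹ :: d)) (f (c ++ g :: b) * (τ * ρ * σ))) := by
    rw [tateTriple_chn_coch_chn hf, map_neg, LinearMap.neg_apply]
    refine congrArg Neg.neg ((map_crossSum ((tateCup k G).flip (chn k v σ)) w u _).trans ?_)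
    simp only [map_zsmul, LinearMap.flip_apply, tateCup_chn_chn, crossSum, ← splitSum_sum,
      Finset.smul_sum]
    refine splitSum_congr fun a b _ => splitSum_congr fun c d _ => ?_
    rw [Finset.sum_comm]
    simp only [mul_assoc]
  rw [stasheffFour, t1, t2, t3, tateTriple_chn_chn_right, tateTriple_chn_chn_right]
  simp only [map_zero, smul_zero]
  abel

lemma stasheffFour_mem {d₁ d₂ d₃ d₄ : ℤ} {x₁ x₂ x₃ x₄ : ⨁ i, TateHoch k G i}
    (h₁ : x₁ ∈ tateHomog k G d₁) (h₂ : x₂ ∈ tateHomog k G d₂)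
    (h₃ : x₃ ∈ tateHomog k G d₃) (h₄ : x₄ ∈ tateHomog k G d₄) :
    stasheffFour k G d₁ x₁ x₂ x₃ x₄ ∈ tateHomog k G (d₁ + d₂ + d₃ + d₄ - 1) := by
  refine sub_mem (sub_mem (add_mem (sub_mem ?_ ?_) ?_) ?_) (zsmul_mem ?_ _)
  · exact tateTriple_mem (tateCup_mem h₁ h₂ rfl) h₃ h₄ (by ring)
  · exact tateTriple_mem h₁ (tateCup_mem h₂ h₃ rfl) h₄ (by ring)
  · exact tateTriple_mem h₁ h₂ (tateCup_mem h₃ h₄ rfl) (by ring)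
  · exact tateCup_mem (tateTriple_mem h₁ h₂ h₃ rfl) h₄ (by ring)
  · exact tateCup_mem h₁ (tateTriple_mem h₂ h₃ h₄ rfl) (by ring)

lemma stasheffFive_mem {d₁ d₂ d₃ d₄ d₅ : ℤ} {x₁ x₂ x₃ x₄ x₅ : ⨁ i, TateHoch k G i}
    (h₁ : x₁ ∈ tateHomog k G d₁) (h₂ : x₂ ∈ tateHomog k G d₂) (h₃ : x₃ ∈ tateHomog k G d₃)
    (h₄ : x₄ ∈ tateHomog k G d₄) (h₅ : x₅ ∈ tateHomog k G d₅) :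
    stasheffFive k G d₁ d₂ x₁ x₂ x₃ x₄ x₅ ∈ tateHomog k G (d₁ + d₂ + d₃ + d₄ + d₅ - 2) := by
  refine add_mem (add_mem ?_ (zsmul_mem ?_ _)) (zsmul_mem ?_ _)
  · exact tateTriple_mem (tateTriple_mem h₁ h₂ h₃ rfl) h₄ h₅ (by ring)
  · exact tateTriple_mem h₁ (tateTriple_mem h₂ h₃ h₄ rfl) h₅ (by ring)
  · exact tateTriple_mem h₁ h₂ (tateTriple_mem h₃ h₄ h₅ rfl) (by ring)

/-- The only case of the identity in five elements with nonzero terms is the double Jacobi identity,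
paired with a chain. -/
lemma stasheffFive_coch_chn_coch_chn_coch {l m n : ℕ} {f h e : List G → MonoidAlgebra k G}
    (hf : IsCoch l f) (hh : IsCoch m h) (he : IsCoch n e) (w u v : List G)
    (ρ σ τ : MonoidAlgebra k G) :
    tatePair k G (chn k v τ) (stasheffFive k G l (-w.length - 1) (coch k f l) (chn k w ρ)
      (coch k h m) (chn k u σ) (coch k e n)) = 0 := by
  have t2 : tatePair k G (chn k v τ) (tateTriple k G (coch k f l)
      (tateTriple k G (chn k w ρ) (coch k h m) (chn k u σ)) (coch k e n)) =
      coeffAt k G 1 (crossSum u w (fun a b c d g =>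
        sg d.length • (h (c ++ g :: b) * bracket f e (a ++ g⁻¹ :: d) v)) * (ρ * σ * τ)) := by
    have e1 : ∀ F : List G → List G → List G → List G → G → ⨁ i, TateHoch k G i,
        tateTriple k G (coch k f l) (crossSum u w F) (coch k e n) =
          crossSum u w fun a b c d g => tateTriple k G (coch k f l) (F a b c d g) (coch k e n) :=
      fun F => map_crossSum ((tateTriple k G (coch k f l)).flip (coch k e n)) u w F
    rw [tateTriple_chn_coch_chn hh, map_neg, LinearMap.neg_apply, e1, map_neg, map_crossSum,
      crossSum_mul_right, map_crossSum, ← neg_one_zsmul, ← crossSum_zsmul]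
    refine crossSum_congr fun a b c d g _ _ => ?_
    rw [map_zsmul, LinearMap.smul_apply, map_zsmul, tatePair_tateTriple_coch hf he,
      ← coeffAt_zsmul, ← coeffAt_zsmul, smul_mul_assoc, smul_comm]
    congr 2
    rw [neg_one_zsmul]
    ring
  simp only [stasheffFive, map_add, map_zsmul]
  rw [t2, tateTriple_coch_chn_coch hf hh, tateTriple_coch_chn_coch hh he,
    tatePair_tateTriple_coch (hf.bracket hh w ρ) he, tatePair_tateTriple_coch hf
    (hh.bracket he u σ), bracket_smul_left, bracket_smul_right, ← coeffAt_zsmul, ← coeffAt_zsmul,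
    ← map_add, ← map_add]
  convert map_zero (coeffAt k G 1)
  have key := bracket_jacobi f h e w u v l hf.sg_smul
  have e2 : sg (l + (-w.length - 1)) = sg (l + w.length + 1) := sg_congr (by omega)
  rw [e2, ← smul_mul_assoc, ← smul_mul_assoc, neg_neg, neg_neg, ← smul_mul_assoc]
  linear_combination (ρ * σ * τ) * key

/-- The alternating sign pattern `- + - + - +`. -/
def Alternate (a b c d e f : ℤ) : Prop :=
  a < 0 ∧ 0 ≤ b ∧ c < 0 ∧ 0 ≤ d ∧ e < 0 ∧ 0 ≤ f

/-- A nonzero term of the Stasheff identity in five elements forces the six signs to alternate. -/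
lemma cyclicFive_gen (L : List (ℤ × ⨁ i, TateHoch k G i)) (h : ∀ p ∈ L, IsGen p.1 p.2) :
    cyclicFive L = 0 := by
  rcases L with - | ⟨a, - | ⟨b, - | ⟨c, - | ⟨d, - | ⟨e, - | ⟨f, - | ⟨g, L⟩⟩⟩⟩⟩⟩⟩ <;> try rfl
  have key : ∀ a b c d e f : ℤ × ⨁ i, TateHoch k G i, IsGen a.1 a.2 → IsGen b.1 b.2 →
      IsGen c.1 c.2 → IsGen d.1 d.2 → IsGen e.1 e.2 → IsGen f.1 f.2 →
      Alternate a.1 b.1 c.1 d.1 e.1 f.1 → cyclicFive [a, b, c, d, e, f] = 0 := by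
    rintro ⟨i₀, x₀⟩ ⟨i₁, x₁⟩ ⟨i₂, x₂⟩ ⟨i₃, x₃⟩ ⟨i₄, x₄⟩ ⟨i₅, x₅⟩ h₀ h₁ h₂ h₃ h₄ h₅
      ⟨s₀, s₁, s₂, s₃, s₄, s₅⟩
    dsimp only at *
    obtain ⟨v, τ, rfl, rfl⟩ := h₀.eq_chn s₀
    obtain ⟨l, f, hf, rfl, rfl⟩ := h₁.eq_coch s₁
    obtain ⟨w, ρ, rfl, rfl⟩ := h₂.eq_chn s₂
    obtain ⟨m, f', hf', rfl, rfl⟩ := h₃.eq_coch s₃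
    obtain ⟨u, σ, rfl, rfl⟩ := h₄.eq_chn s₄
    obtain ⟨n, f'', hf'', rfl, rfl⟩ := h₅.eq_coch s₅
    simp only [cyclicFive]
    exact stasheffFive_coch_chn_coch_chn_coch hf hf' hf'' w u v ρ σ τ
  have hom : ∀ p ∈ [a, b, c, d, e, f], p.2 ∈ tateHomog k G p.1 := fun p hp => (h p hp).mem_homog
  simp only [List.forall_mem_cons] at h hom
  obtain ⟨ha, hb, hc, hd, he, hf, -⟩ := h
  by_contra h'
  have n₀ := mt (key a b c d e f ha hb hc hd he hf) h'
  have n₁ := mt (key b c d e f a hb hc hd he hf ha)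
    (mt (cyclicFive_rotate a [b, c, d, e, f] (by simp [hom])) h')
  obtain ⟨ma, mb, mc, md, me, mf, -⟩ := hom
  -- The form pairs only elements whose degrees have the sum `-1`.
  have deg : a.1 + b.1 + c.1 + d.1 + e.1 + f.1 = 1 := by
    by_contra hd
    refine h' ?_
    simp only [cyclicFive]
    exact tatePair_eq_zero ma (stasheffFive_mem mb mc md me mf) (by omega)
  refine h' ?_
  rw [cyclicFive, stasheffFive]
  have z₁ : tateTriple k G (tateTriple k G b.2 c.2 d.2) e.2 f.2 = 0 := by
    by_cases hz : tateTriple k G b.2 c.2 d.2 = 0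
    · rw [hz]; simp
    by_contra hz'
    have s := not_not.1 (mt (tateTriple_eq_zero mb mc md) hz)
    have s' := not_not.1 (mt (tateTriple_eq_zero (tateTriple_mem mb mc md rfl) me mf) hz')
    rcases s with s | s
    · exact n₀ ⟨by omega, by omega, by omega, by omega, by omega, by omega⟩
    · exact n₁ ⟨by omega, by omega, by omega, by omega, by omega, by omega⟩
  have z₂ : tateTriple k G b.2 (tateTriple k G c.2 d.2 e.2) f.2 = 0 := by
    by_cases hz : tateTriple k G c.2 d.2 e.2 = 0
    · rw [hz]; simp
    by_contra hz'
    have s := not_not.1 (mt (tateTriple_eq_zero mc md me) hz)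
    have s' := not_not.1 (mt (tateTriple_eq_zero mb (tateTriple_mem mc md me rfl) mf) hz')
    rcases s with s | s
    · exact n₁ ⟨by omega, by omega, by omega, by omega, by omega, by omega⟩
    · exact n₀ ⟨by omega, by omega, by omega, by omega, by omega, by omega⟩
  have z₃ : tateTriple k G b.2 c.2 (tateTriple k G d.2 e.2 f.2) = 0 := by
    by_cases hz : tateTriple k G d.2 e.2 f.2 = 0
    · rw [hz]; simp
    by_contra hz'
    have s := not_not.1 (mt (tateTriple_eq_zero md me mf) hz)
    have s' := not_not.1 (mt (tateTriple_eq_zero mb mc (tateTriple_mem md me mf rfl)) hz')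
    rcases s with s | s
    · exact n₀ ⟨by omega, by omega, by omega, by omega, by omega, by omega⟩
    · exact n₁ ⟨by omega, by omega, by omega, by omega, by omega, by omega⟩
  rw [z₁, z₂, z₃]
  simp

/-- The cyclic sign patterns `- + + - +` and `+ - - + -`: the signs alternate except between the
second and the third place. -/
def AlternateOnce (a b c d e : ℤ) : Prop :=
  (a < 0 ∧ 0 ≤ b ∧ 0 ≤ c ∧ d < 0 ∧ 0 ≤ e) ∨ (0 ≤ a ∧ b < 0 ∧ c < 0 ∧ 0 ≤ d ∧ e < 0)

/-- If a cyclic word of five degrees is not, up to rotation, one of the two patterns in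
`AlternateOnce`, then no ternary product in the Stasheff expression meets the sign condition of
`tateTriple_eq_zero`. -/
lemma not_alternating {a b c d e : ℤ} (deg : a + b + c + d + e = 0)
    (h₁ : ¬AlternateOnce a b c d e) (h₂ : ¬AlternateOnce b c d e a)
    (h₃ : ¬AlternateOnce c d e a b) (h₄ : ¬AlternateOnce d e a b c)
    (h₅ : ¬AlternateOnce e a b c d) :
    ¬((0 ≤ b + c ∧ d < 0 ∧ 0 ≤ e ∧ 0 ≤ b + c + d + e - 1) ∨
      (b + c < 0 ∧ 0 ≤ d ∧ e < 0 ∧ b + c + d + e - 1 < 0)) ∧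
    ¬((0 ≤ b ∧ c + d < 0 ∧ 0 ≤ e ∧ 0 ≤ b + (c + d) + e - 1) ∨
      (b < 0 ∧ 0 ≤ c + d ∧ e < 0 ∧ b + (c + d) + e - 1 < 0)) ∧
    ¬((0 ≤ b ∧ c < 0 ∧ 0 ≤ d + e ∧ 0 ≤ b + c + (d + e) - 1) ∨
      (b < 0 ∧ 0 ≤ c ∧ d + e < 0 ∧ b + c + (d + e) - 1 < 0)) ∧
    ¬((0 ≤ b ∧ c < 0 ∧ 0 ≤ d ∧ 0 ≤ b + c + d - 1) ∨
      (b < 0 ∧ 0 ≤ c ∧ d < 0 ∧ b + c + d - 1 < 0)) ∧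
    ¬((0 ≤ c ∧ d < 0 ∧ 0 ≤ e ∧ 0 ≤ c + d + e - 1) ∨
      (c < 0 ∧ 0 ≤ d ∧ e < 0 ∧ c + d + e - 1 < 0)) := by
  rcases le_or_gt 0 a with sa | sa <;> rcases le_or_gt 0 b with sb | sb <;>
    rcases le_or_gt 0 c with sc | sc <;> rcases le_or_gt 0 d with sd | sd <;>
    rcases le_or_gt 0 e with se | se <;>
    first
    | exact absurd (by unfold AlternateOnce; omega) h₁
    | exact absurd (by unfold AlternateOnce; omega) h₂
    | exact absurd (by unfold AlternateOnce; omega) h₃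
    | exact absurd (by unfold AlternateOnce; omega) h₄
    | exact absurd (by unfold AlternateOnce; omega) h₅
    | (refine ⟨?_, ?_, ?_, ?_, ?_⟩ <;> omega)

/-- A nonzero ternary product in the Stasheff identity in four elements forces one of the patterns
`AlternateOnce`, up to rotation. -/
lemma cyclicFour_gen (L : List (ℤ × ⨁ i, TateHoch k G i)) (h : ∀ p ∈ L, IsGen p.1 p.2) :
    cyclicFour L = 0 := by
  rcases L with - | ⟨a, - | ⟨b, - | ⟨c, - | ⟨d, - | ⟨e, - | ⟨g, L⟩⟩⟩⟩⟩⟩ <;> try rfl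
  have key : ∀ a b c d e : ℤ × ⨁ i, TateHoch k G i, IsGen a.1 a.2 → IsGen b.1 b.2 →
      IsGen c.1 c.2 → IsGen d.1 d.2 → IsGen e.1 e.2 →
      ((a.1 < 0 ∧ 0 ≤ b.1 ∧ 0 ≤ c.1 ∧ d.1 < 0 ∧ 0 ≤ e.1) ∨
        (b.1 < 0 ∧ 0 ≤ c.1 ∧ d.1 < 0 ∧ e.1 < 0)) → cyclicFour [a, b, c, d, e] = 0 := by
    rintro ⟨i₀, x₀⟩ ⟨i₁, x₁⟩ ⟨i₂, x₂⟩ ⟨i₃, x₃⟩ ⟨i₄, x₄⟩ h₀ h₁ h₂ h₃ h₄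
      (⟨s₀, s₁, s₂, s₃, s₄⟩ | ⟨s₁, s₂, s₃, s₄⟩) <;> dsimp only at *
    · obtain ⟨v, τ, rfl, rfl⟩ := h₀.eq_chn s₀
      obtain ⟨l, f, hf, rfl, rfl⟩ := h₁.eq_coch s₁
      obtain ⟨m, f', hf', rfl, rfl⟩ := h₂.eq_coch s₂
      obtain ⟨w, ρ, rfl, rfl⟩ := h₃.eq_chn s₃
      obtain ⟨n, f'', hf'', rfl, rfl⟩ := h₄.eq_coch s₄
      simp only [cyclicFour]
      exact stasheffFour_coch_coch_chn_coch hf hf' hf'' w v ρ τ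
    · obtain ⟨u, τ, rfl, rfl⟩ := h₁.eq_chn s₁
      obtain ⟨l, f, hf, rfl, rfl⟩ := h₂.eq_coch s₂
      obtain ⟨w, ρ, rfl, rfl⟩ := h₃.eq_chn s₃
      obtain ⟨v, σ, rfl, rfl⟩ := h₄.eq_chn s₄
      rw [cyclicFour, stasheffFour_chn_coch_chn_chn hf, map_zero]
  have key' : ∀ a b c d e : ℤ × ⨁ i, TateHoch k G i, IsGen a.1 a.2 → IsGen b.1 b.2 →
      IsGen c.1 c.2 → IsGen d.1 d.2 → IsGen e.1 e.2 → AlternateOnce a.1 b.1 c.1 d.1 e.1 →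
      cyclicFour [a, b, c, d, e] = 0 := by
    rintro a b c d e ha hb hc hd he (h | ⟨h₀, h₁, h₂, h₃, h₄⟩)
    · exact key a b c d e ha hb hc hd he (Or.inl h)
    · have hom : a.2 ∈ tateHomog k G a.1 ∧ b.2 ∈ tateHomog k G b.1 ∧ c.2 ∈ tateHomog k G c.1 ∧
          d.2 ∈ tateHomog k G d.1 ∧ e.2 ∈ tateHomog k G e.1 :=
        ⟨ha.mem_homog, hb.mem_homog, hc.mem_homog, hd.mem_homog, he.mem_homog⟩
      refine cyclicFour_rotate a [b, c, d, e] (by simp [hom]) ?_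
      refine cyclicFour_rotate b [c, d, e, a] (by simp [hom]) ?_
      refine cyclicFour_rotate c [d, e, a, b] (by simp [hom]) ?_
      exact key d e a b c hd he ha hb hc (Or.inr ⟨h₄, h₀, h₁, h₂⟩)
  have hom : ∀ p ∈ [a, b, c, d, e], p.2 ∈ tateHomog k G p.1 := fun p hp => (h p hp).mem_homog
  simp only [List.forall_mem_cons] at h hom
  obtain ⟨ha, hb, hc, hd, he, -⟩ := h
  by_contra h'
  have r₁ := mt (cyclicFour_rotate a [b, c, d, e] (by simp [hom])) h'
  have r₂ := mt (cyclicFour_rotate b [c, d, e, a] (by simp [hom])) r₁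
  have r₃ := mt (cyclicFour_rotate c [d, e, a, b] (by simp [hom])) r₂
  have r₄ := mt (cyclicFour_rotate d [e, a, b, c] (by simp [hom])) r₃
  have n₀ := mt (key' a b c d e ha hb hc hd he) h'
  have n₁ := mt (key' b c d e a hb hc hd he ha) r₁
  have n₂ := mt (key' c d e a b hc hd he ha hb) r₂
  have n₃ := mt (key' d e a b c hd he ha hb hc) r₃
  have n₄ := mt (key' e a b c d he ha hb hc hd) r₄
  obtain ⟨ma, mb, mc, md, me, -⟩ := hom
  -- The form pairs only elements whose degrees have the sum `-1`.
  have deg : a.1 + b.1 + c.1 + d.1 + e.1 = 0 := by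
    by_contra hd
    refine h' ?_
    simp only [cyclicFour]
    exact tatePair_eq_zero ma (stasheffFour_mem mb mc md me) (by omega)
  obtain ⟨c₁, c₂, c₃, c₄, c₅⟩ := not_alternating deg n₀ n₁ n₂ n₃ n₄
  refine h' ?_
  rw [cyclicFour, stasheffFour, tateTriple_eq_zero (tateCup_mem mb mc rfl) md me c₁,
    tateTriple_eq_zero mb (tateCup_mem mc md rfl) me c₂,
    tateTriple_eq_zero mb mc (tateCup_mem md me rfl) c₃, tateTriple_eq_zero mb mc md c₄,
    tateTriple_eq_zero mc md me c₅]
  simp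

end StasheffFourFive

/-! ### The cyclic A-infinity-algebra of Tate-Hochschild cochains -/

section TateHochschildCyclic

variable {k : Type*} [Field k] {G : Type*} [CommGroup G]

lemma tatePair_eq_component {i j : ℤ} (h : i + j = -1) (x : ⨁ i, TateHoch k G i)
    {y : ⨁ i, TateHoch k G i} (hy : y ∈ tateHomog k G j) :
    tatePair k G x y = tatePair k G (DirectSum.lof k ℤ (TateHoch k G) i (x i)) y := by
  induction x using DirectSum.induction_on with
  | zero => simp
  | of l v =>
    change tatePair k G (DirectSum.lof k ℤ (TateHoch k G) l v) y =
      tatePair k G (DirectSum.lof k ℤ (TateHoch k G) i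
        (DirectSum.lof k ℤ (TateHoch k G) l v i)) y
    by_cases e : l = i
    · subst e
      rw [DirectSum.lof_apply]
    · have h0 : DirectSum.lof k ℤ (TateHoch k G) l v i = 0 :=
        DirectSum.of_eq_of_ne _ _ _ (Ne.symm e)
      rw [tatePair_eq_zero ⟨v, rfl⟩ hy (by omega), h0, map_zero, LinearMap.map_zero,
        LinearMap.zero_apply]
  | add x x' hx hx' =>
    rw [map_add, LinearMap.add_apply, hx, hx', DirectSum.add_apply, map_add, map_add,
      LinearMap.add_apply]

lemma tatePair_inC_single {n : ℕ} (φ : HochCochain k G n) (g : G) (l : BarTuple G n) :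
    tatePair k G (inC k _ _ n φ) (inH k (HochCochain k G) (HochChain k G) n
      (Finsupp.single (g, l) 1)) = coeffAt k G 1 (φ l * gp k g) := by
  refine (extend₂_lof (pairDeg k G) (Int.ofNat n) (Int.negSucc n) _ _).trans ?_
  change pairCH k G n n φ (Finsupp.single (g, l) 1) = _
  have : evalAt k l.1 φ = φ l := by rw [evalAt, dif_pos l.2]; rfl
  rw [pairCH, LinearMap.flip_apply, basisLift_single_one]
  simp [symmForm, this]

lemma coeffAt_one_mul_gp (x : MonoidAlgebra k G) (g : G) :
    coeffAt k G 1 (x * gp k g⁻¹) = coeffAt k G g x := by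
  induction x using monoidAlgebra_induction with
  | add x y hx hy => rw [add_mul, map_add, map_add, hx, hy]
  | smul c x hx => rw [smul_mul_assoc, map_smul, map_smul, hx]
  | gp h =>
    rw [gp_mul]
    by_cases e : h = g
    · simp [coeffAt, e]
    · have : h * g⁻¹ ≠ 1 := fun h' => e (mul_inv_eq_one.1 h')
      simp [coeffAt, e, this]

lemma eq_zero_of_coeffAt {x : MonoidAlgebra k G} (h : ∀ g, coeffAt k G g x = 0) : x = 0 := by
  have : MonoidAlgebra.coeffLinearEquiv k x = 0 := Finsupp.ext h
  simpa using this

lemma inC_eq_zero {n : ℕ} (φ : HochCochain k G n)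
    (h : ∀ y ∈ tateHomog k G (-n - 1), tatePair k G (inC k _ _ n φ) y = 0) : φ = 0 := by
  funext l
  refine eq_zero_of_coeffAt fun g => ?_
  rw [← coeffAt_one_mul_gp, ← tatePair_inC_single]
  exact h _ (inH_mem_homog _ rfl)

lemma inH_eq_zero {s : ℕ} (η : HochChain k G s)
    (h : ∀ y ∈ tateHomog k G s, tatePair k G (inH k _ _ s η) y = 0) : η = 0 := by
  classical
  refine Finsupp.ext fun ⟨g, l⟩ => ?_
  have key : ∀ θ : HochChain k G s, tatePair k G
      (inC k _ _ s (fun l' => if l' = l then gp k g⁻¹ else 0)) (inH k _ _ s θ) = θ (g, l) := by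
    intro θ
    induction θ using Finsupp.induction_linear with
    | zero => simp
    | add x y hx hy => rw [map_add, map_add, hx, hy, Finsupp.add_apply]
    | single a c =>
      obtain ⟨g', l'⟩ := a
      rw [← mul_one c, ← smul_eq_mul, ← Finsupp.smul_single, map_smul, map_smul,
        tatePair_inC_single]
      by_cases e : l' = l
      · subst e
        rw [if_pos rfl, mul_comm, coeffAt_one_mul_gp]
        by_cases e' : g' = g <;> simp [coeffAt, e']
      · simp [e]
  rw [Finsupp.zero_apply, ← key, tatePair_symm]
  exact h _ (inC_mem_homog _ rfl)

/-- The form separates the elements of the total space, already when paired with homogeneous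
elements. -/
lemma tatePair_separating (x : ⨁ i, TateHoch k G i)
    (h : ∀ (d : ℤ), ∀ y ∈ tateHomog k G d, tatePair k G x y = 0) : x = 0 := by
  refine DFinsupp.ext fun i => ?_
  match i with
  | .ofNat n =>
    refine inC_eq_zero (n := n) (x (.ofNat n)) fun y hy => ?_
    refine (tatePair_eq_component (i := .ofNat n) ?_ x hy).symm.trans (h _ y hy)
    have : Int.ofNat n = (n : ℤ) := rfl
    omega
  | .negSucc s =>
    refine inH_eq_zero (s := s) (x (.negSucc s)) fun y hy => ?_
    refine (tatePair_eq_component (i := .negSucc s) ?_ x hy).symm.trans (h _ y hy)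
    have := Int.negSucc_eq s
    omega

lemma tatePair_nondegenerate : (tatePair k G).Nondegenerate := by
  refine ⟨fun x hx => tatePair_separating x fun d y _ => hx y, fun y hy => ?_⟩
  exact tatePair_separating y fun d x _ => (tatePair_symm _ _).trans (hy x)

variable [Fintype G]

lemma stasheffTwo_homog {d : ℕ → ℤ} {x : ℕ → ⨁ i, TateHoch k G i}
    (hx : ∀ i, x i ∈ tateHomog k G (d i)) : stasheffTwo k G (d 0) (x 0) (x 1) = 0 := by
  refine tatePair_separating _ fun c y hy => (tatePair_symm _ _).trans ?_
  exact eq_zero_of_rotation cyclicTwo_linear cyclicTwo_rotate cyclicTwo_gen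
    (L := [(c, y), (d 0, x 0), (d 1, x 1)]) (by simp [hy, hx])

lemma stasheffThree_homog {d : ℕ → ℤ} {x : ℕ → ⨁ i, TateHoch k G i}
    (hx : ∀ i, x i ∈ tateHomog k G (d i)) :
    stasheffThree k G (d 0) (d 1) (x 0) (x 1) (x 2) = 0 := by
  refine tatePair_separating _ fun c y hy => (tatePair_symm _ _).trans ?_
  exact eq_zero_of_rotation cyclicThree_linear cyclicThree_rotate cyclicThree_gen
    (L := [(c, y), (d 0, x 0), (d 1, x 1), (d 2, x 2)]) (by simp [hy, hx])

lemma stasheffFour_homog {d : ℕ → ℤ} {x : ℕ → ⨁ i, TateHoch k G i}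
    (hx : ∀ i, x i ∈ tateHomog k G (d i)) :
    stasheffFour k G (d 0) (x 0) (x 1) (x 2) (x 3) = 0 := by
  refine tatePair_separating _ fun c y hy => (tatePair_symm _ _).trans ?_
  exact eq_zero_of_rotation cyclicFour_linear cyclicFour_rotate cyclicFour_gen
    (L := [(c, y), (d 0, x 0), (d 1, x 1), (d 2, x 2), (d 3, x 3)]) (by simp [hy, hx])

lemma stasheffFive_homog {d : ℕ → ℤ} {x : ℕ → ⨁ i, TateHoch k G i}
    (hx : ∀ i, x i ∈ tateHomog k G (d i)) :
    stasheffFive k G (d 0) (d 1) (x 0) (x 1) (x 2) (x 3) (x 4) = 0 := by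
  refine tatePair_separating _ fun c y hy => (tatePair_symm _ _).trans ?_
  exact eq_zero_of_rotation cyclicFive_linear cyclicFive_rotate cyclicFive_gen
    (L := [(c, y), (d 0, x 0), (d 1, x 1), (d 2, x 2), (d 3, x 3), (d 4, x 4)])
    (by simp [hy, hx])

lemma tateHochschild_m_one (x : Fin 1 → ⨁ i, TateHoch k G i) :
    (tateHochschild k G).m 1 x = tateDiff k G (x 0) := rfl

lemma tateHochschild_m_two (x : Fin 2 → ⨁ i, TateHoch k G i) :
    (tateHochschild k G).m 2 x = tateCup k G (x 0) (x 1) := rfl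

lemma tateHochschild_m_three (x : Fin 3 → ⨁ i, TateHoch k G i) :
    (tateHochschild k G).m 3 x = tateTriple k G (x 0) (x 1) (x 2) := rfl

lemma tateHochschild_m_eq_zero {p : ℕ} (hp : 4 ≤ p) : (tateHochschild k G).m p = 0 := by
  obtain ⟨q, rfl⟩ := Nat.exists_eq_add_of_le' hp
  rfl

/-- The Stasheff sum of the Tate-Hochschild cochain complex has no nonzero terms for more than
five elements. -/
lemma tateHochschild_stasheff_of_lt {n : ℕ} (hn : 5 < n) (d : ℕ → ℤ)
    (x : ℕ → ⨁ i, TateHoch k G i) :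
    ∑ s ∈ Finset.Icc 1 n, ∑ r ∈ Finset.range (n - s + 1),
      (((r : ℤ) + s * ((n : ℤ) - s - r)
          + (2 - (s : ℤ)) * ∑ i ∈ Finset.range r, d i).negOnePow) •
        (tateHochschild k G).m (n - s + 1) (fun i : Fin (n - s + 1) =>
          if (i : ℕ) < r then x i
          else if (i : ℕ) = r then (tateHochschild k G).m s (fun j : Fin s => x (r + j))
          else x (i + s - 1)) = 0 := by
  refine Finset.sum_eq_zero fun s hs => Finset.sum_eq_zero fun r hr => ?_
  rcases le_or_gt 4 s with h | h
  · rw [MultilinearMap.map_coord_zero _ (⟨r, Finset.mem_range.1 hr⟩ : Fin (n - s + 1)), smul_zero]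
    simp [tateHochschild_m_eq_zero h]
  · rw [tateHochschild_m_eq_zero (p := n - s + 1) (by omega)]
    simp

lemma tateHochschild_stasheff (n : ℕ) (hn : 1 ≤ n) (d : ℕ → ℤ)
    (x : ℕ → ⨁ i, TateHoch k G i) (hx : ∀ i, x i ∈ tateHomog k G (d i)) :
    ∑ s ∈ Finset.Icc 1 n, ∑ r ∈ Finset.range (n - s + 1),
      (((r : ℤ) + s * ((n : ℤ) - s - r)
          + (2 - (s : ℤ)) * ∑ i ∈ Finset.range r, d i).negOnePow) •
        (tateHochschild k G).m (n - s + 1) (fun i : Fin (n - s + 1) =>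
          if (i : ℕ) < r then x i
          else if (i : ℕ) = r then (tateHochschild k G).m s (fun j : Fin s => x (r + j))
          else x (i + s - 1)) = 0 := by
  rcases le_or_gt n 5 with h | h
  swap
  · exact tateHochschild_stasheff_of_lt h d x
  simp only [negOnePow_smul_eq_sg]
  have e2 : sg 2 = 1 := (sg_congr (by norm_num)).trans sg_zero
  have e3 : sg 3 = -1 := (sg_congr (by norm_num)).trans sg_one
  have e4 : sg 4 = 1 := (sg_congr (by norm_num)).trans sg_zero
  have e6 : sg 6 = 1 := (sg_congr (by norm_num)).trans sg_zero
  have en : ∀ a, sg (-a) = sg a := fun a => sg_congr (by omega)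
  interval_cases n
  · simp only [Finset.Icc_self, Finset.sum_singleton]
    dsimp only [Nat.reduceSub, Nat.reduceAdd]
    simp [tateHochschild_m_one, tateDiff_tateDiff (hx 0)]
  · have h2 := stasheffTwo_homog hx
    simp only [Finset.sum_Icc_succ_top (show 1 ≤ 1 + 1 by norm_num), Finset.Icc_self,
      Finset.sum_singleton]
    dsimp only [Nat.reduceSub, Nat.reduceAdd]
    simp [Finset.sum_range_succ, tateHochschild_m_one, tateHochschild_m_two, sg_add]
    rw [← h2, stasheffTwo]
    abel
  · have h3 := stasheffThree_homog hx
    simp only [Finset.sum_Icc_succ_top (show 1 ≤ 1 + 1 by norm_num),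
      Finset.sum_Icc_succ_top (show 1 ≤ 2 + 1 by norm_num), Finset.Icc_self,
      Finset.sum_singleton]
    dsimp only [Nat.reduceSub, Nat.reduceAdd]
    simp [Finset.sum_range_succ, tateHochschild_m_one, tateHochschild_m_two,
      tateHochschild_m_three, sg_add]
    rw [← h3, stasheffThree]
    simp only [e2, sg_add]
    module
  · have h3 := stasheffFour_homog hx
    simp only [Finset.sum_Icc_succ_top (show 1 ≤ 1 + 1 by norm_num),
      Finset.sum_Icc_succ_top (show 1 ≤ 2 + 1 by norm_num),
      Finset.sum_Icc_succ_top (show 1 ≤ 3 + 1 by norm_num), Finset.Icc_self,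
      Finset.sum_singleton]
    dsimp only [Nat.reduceSub, Nat.reduceAdd]
    simp [Finset.sum_range_succ, tateHochschild_m_one, tateHochschild_m_two,
      tateHochschild_m_three, sg_add, tateHochschild_m_eq_zero]
    rw [← h3, stasheffFour]
    simp only [e2, e3, e4, en]
    module
  · have h3 := stasheffFive_homog hx
    simp only [Finset.sum_Icc_succ_top (show 1 ≤ 1 + 1 by norm_num),
      Finset.sum_Icc_succ_top (show 1 ≤ 2 + 1 by norm_num),
      Finset.sum_Icc_succ_top (show 1 ≤ 3 + 1 by norm_num),
      Finset.sum_Icc_succ_top (show 1 ≤ 4 + 1 by norm_num), Finset.Icc_self,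
      Finset.sum_singleton]
    dsimp only [Nat.reduceSub, Nat.reduceAdd]
    simp [Finset.sum_range_succ, tateHochschild_m_one, tateHochschild_m_two,
      tateHochschild_m_three, sg_add, tateHochschild_m_eq_zero]
    rw [← h3, stasheffFive]
    simp only [e2, e3, e6, en, sg_add]
    module

theorem tateHochschild_isCyclicAInfinity : (tateHochschild k G).IsCyclicAInfinity where
  degree p hp d v := by
    rcases le_or_gt 4 p with h | h
    · rw [tateHochschild_m_eq_zero h]
      exact zero_mem _
    interval_cases p
    · exact tateDiff_mem ⟨v 0, rfl⟩ (by simp; ring)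
    · exact tateCup_mem ⟨v 0, rfl⟩ ⟨v 1, rfl⟩ (by simp)
    · exact tateTriple_mem ⟨v 0, rfl⟩ ⟨v 1, rfl⟩ ⟨v 2, rfl⟩
        (by simp [Fin.sum_univ_three]; ring)
  stasheff n hn d v x hx := tateHochschild_stasheff n hn d x fun i => ⟨v i, (hx i).symm⟩
  pair_degree i j v w h := tatePair_eq_zero ⟨v, rfl⟩ ⟨w, rfl⟩ h
  pair_symm := tatePair_symm
  pair_nondegenerate := tatePair_nondegenerate
  cyclic p hp d v x hx := by
    have hx' : ∀ i, x i ∈ tateHomog k G (d i) := fun i => ⟨v i, (hx i).symm⟩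
    rw [negOnePow_smul_eq_sg]
    rcases le_or_gt 4 p with h | h
    · rw [tateHochschild_m_eq_zero h]
      simp
    interval_cases p
    · refine (tateDiff_cyclic (hx' 0) (hx' 1)).trans (congrArg (· • _) (sg_congr ?_))
      push_cast
      omega
    · refine (tateCup_cyclic (hx' 0) (hx' 1) (hx' 2)).trans ?_
      rw [sg_congr (b := 0) (by push_cast; omega), sg_zero, one_smul]
      rfl
    · refine (tateTriple_cyclic (hx' 0) (hx' 1) (hx' 2) (hx' 3)).trans
        (congrArg (· • _) (sg_congr ?_))
      push_cast
      omega

end TateHochschildCyclic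

/-! ### Transport of the cyclic structure along strict morphisms -/

section Transport

variable {k : Type*} [Field k] {V : ℤ → Type*} [∀ i, AddCommGroup (V i)] [∀ i, Module k (V i)]
  {W : ℤ → Type*} [∀ i, AddCommGroup (W i)] [∀ i, Module k (W i)]

lemma lmap_injective {f : ∀ i, V i →ₗ[k] W i} (hf : ∀ i, Function.Injective (f i)) :
    Function.Injective (DirectSum.lmap f) := by
  intro x y h
  refine DFinsupp.ext fun i => hf i ?_
  have := congrArg (fun z : ⨁ i, W i => z i) h
  simpa only [DirectSum.lmap_apply] using this

/-- If two graded maps compose to the identity of the total space, they do so in each degree. -/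
lemma leftInverse_of_lmap {f : ∀ i, V i →ₗ[k] W i} {g : ∀ i, W i →ₗ[k] V i}
    (h : ∀ x, DirectSum.lmap g (DirectSum.lmap f x) = x) (i : ℤ) :
    Function.LeftInverse (g i) (f i) := by
  intro v
  have := congrArg (fun x : ⨁ i, V i => x i) (h (DirectSum.lof k ℤ V i v))
  simpa only [DirectSum.lmap_apply, DirectSum.lof_apply] using this

lemma mem_homog_of_lmap_mem {f : ∀ i, V i →ₗ[k] W i} (hf : ∀ i, Function.Injective (f i))
    {d : ℤ} {x : ⨁ i, V i} (h : DirectSum.lmap f x ∈ homog (k := k) W d) :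
    x ∈ homog (k := k) V d := by
  obtain ⟨w, hw⟩ := h
  refine ⟨x d, DFinsupp.ext fun i => ?_⟩
  by_cases e : d = i
  · subst e
    exact DirectSum.lof_apply k d (x d)
  · refine (DirectSum.of_eq_of_ne _ _ _ (Ne.symm e)).trans (hf i ?_).symm
    have h1 : (DirectSum.lof k ℤ W d w) i = 0 := DirectSum.of_eq_of_ne _ _ _ (Ne.symm e)
    rw [hw, DirectSum.lmap_apply] at h1
    rw [h1, map_zero]

/-- A cyclic A-infinity structure restricts along an injective strict morphism, provided that the
restricted form is nondegenerate. -/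
theorem AInfData.IsStrictMorphism.isCyclicAInfinity {A : AInfData k V} {B : AInfData k W}
    {f : ∀ i, V i →ₗ[k] W i} (h : A.IsStrictMorphism B f) (hf : ∀ i, Function.Injective (f i))
    (hB : B.IsCyclicAInfinity) (hA : A.pair.Nondegenerate) : A.IsCyclicAInfinity where
  degree p hp d v := by
    refine mem_homog_of_lmap_mem hf ?_
    rw [h.map_m p hp]
    simp only [DirectSum.lmap_lof]
    exact hB.degree p hp d _
  stasheff n hn d v x hx := by
    refine lmap_injective hf ?_
    rw [map_zero, map_sum]
    refine (Finset.sum_congr rfl fun s hs => ?_).trans (hB.stasheff n hn d (fun i => f _ (v i))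
      (fun i => DirectSum.lmap f (x i)) fun i => by rw [hx, DirectSum.lmap_lof])
    rw [map_sum]
    refine Finset.sum_congr rfl fun r _ => ?_
    rw [Units.smul_def, Units.smul_def, map_zsmul, h.map_m _ (by omega)]
    refine congrArg (_ • ·) (congrArg _ (funext fun i => ?_))
    split_ifs
    · rfl
    · rw [h.map_m _ (Finset.mem_Icc.1 hs).1]
    · rfl
  pair_degree i j v w e := by
    rw [← h.map_pair, DirectSum.lmap_lof, DirectSum.lmap_lof]
    exact hB.pair_degree i j _ _ e
  pair_symm x y := by rw [← h.map_pair, ← h.map_pair, hB.pair_symm]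
  pair_nondegenerate := hA
  cyclic p hp d v x hx := by
    rw [← h.map_pair, ← h.map_pair, h.map_m p hp, h.map_m p hp]
    exact hB.cyclic p hp d (fun i => f _ (v i)) (fun i => DirectSum.lmap f (x i))
      fun i => by rw [hx, DirectSum.lmap_lof]

/-- A graded linear isomorphism is a strict morphism if its inverse is. -/
lemma AInfData.IsStrictMorphism.of_symm {A : AInfData k V} {B : AInfData k W}
    {e : ∀ i, V i ≃ₗ[k] W i} (h : B.IsStrictMorphism A fun i => (e i).symm.toLinearMap) :
    A.IsStrictMorphism B fun i => (e i).toLinearMap := by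
  have h1 : ∀ x, DirectSum.lmap (fun i => (e i).symm.toLinearMap)
      (DirectSum.lmap (fun i => (e i).toLinearMap) x) = x := fun x => by
    refine DFinsupp.ext fun i => ?_
    simp [DirectSum.lmap_apply]
  have hi := lmap_injective fun i => (e i).symm.injective
  refine ⟨fun p hp x => hi ?_, fun x y => ?_⟩
  · refine (h1 _).trans (Eq.trans ?_ (h.map_m p hp _).symm)
    simp only [h1]
  · rw [← h.map_pair, h1, h1]

end Transport

/-! ### The Tate cochain complex -/

section TateGroup

variable {k : Type*} [Field k] {G : Type*} [CommGroup G]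

/-- Linear functions on the Tate-Hochschild complex which agree on the generators are equal. -/
lemma linearMap_ext_gen {X : Type*} [AddCommGroup X] [Module k X]
    {L L' : (⨁ i, TateHoch k G i) →ₗ[k] X} (h : ∀ d x, IsGen d x → L x = L' x) : L = L' :=
  DirectSum.linearMap_ext k fun i => LinearMap.ext fun v =>
    eq_of_eq_on_gen L.isLinear L'.isLinear (h i) ⟨v, rfl⟩

/-- Linear functions on the Tate complex which agree on cochains and on basis chains are
equal. -/
lemma linearMap_ext_tateGrp {X : Type*} [AddCommGroup X] [Module k X]
    {L L' : (⨁ i, TateGrp k G i) →ₗ[k] X}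
    (hC : ∀ (n : ℕ) (φ : GrpCochain k G n), L (inC k _ (GrpChain k G) n φ) =
      L' (inC k _ (GrpChain k G) n φ))
    (hH : ∀ (w : List G) (hw : ∀ g ∈ w, g ≠ 1),
      L (inH k (GrpCochain k G) (GrpChain k G) w.length
        (Finsupp.single (⟨w, rfl, hw⟩ : BarTuple G w.length) 1)) =
      L' (inH k (GrpCochain k G) (GrpChain k G) w.length
        (Finsupp.single (⟨w, rfl, hw⟩ : BarTuple G w.length) 1))) : L = L' := by
  refine DirectSum.linearMap_ext k fun i => LinearMap.ext fun v => ?_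
  match i, v with
  | .ofNat n, v => exact hC n v
  | .negSucc s, v =>
    have : L ∘ₗ inH k (GrpCochain k G) (GrpChain k G) s =
        L' ∘ₗ inH k (GrpCochain k G) (GrpChain k G) s := by
      refine Finsupp.lhom_ext' fun ⟨w, hs, hw⟩ => LinearMap.ext_ring ?_
      subst hs
      exact hH w hw
    exact LinearMap.congr_fun this v

/-- The scalar-valued function of words given by a group cochain. -/
def scalarFun {n : ℕ} (φ : GrpCochain k G n) (l : List G) : MonoidAlgebra k G :=
  evalAt k l φ • 1

lemma isCoch_scalarFun {n : ℕ} (φ : GrpCochain k G n) : IsCoch n (scalarFun φ) := by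
  intro l hl
  by_contra h
  exact hl (by simp [scalarFun, evalAt, dif_neg h])

lemma evalAt_apply {M : Type*} [AddCommGroup M] [Module k M] {n : ℕ} (φ : BarTuple G n → M)
    (l : BarTuple G n) : evalAt k l.1 φ = φ l := by
  rw [evalAt, dif_pos l.2]
  rfl

variable (k G) in
/-- The embedding of the Tate complex in the Tate-Hochschild complex, on the total spaces. -/
def tateInclTotal : (⨁ i, TateGrp k G i) →ₗ[k] ⨁ i, TateHoch k G i :=
  DirectSum.lmap (tateIncl k G)

lemma tateInclTotal_inC {n : ℕ} (φ : GrpCochain k G n) :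
    tateInclTotal k G (inC k _ (GrpChain k G) n φ) = coch k (scalarFun φ) n := by
  refine (DirectSum.lmap_lof (tateIncl k G) (Int.ofNat n) φ).trans
    (congrArg (inC k (HochCochain k G) (HochChain k G) n) ?_)
  funext l
  rw [scalarFun, evalAt_apply, smul_mul_assoc, one_mul]
  rfl

lemma tateInclTotal_inH {w : List G} (hw : ∀ g ∈ w, g ≠ 1) :
    tateInclTotal k G (inH k (GrpCochain k G) (GrpChain k G) w.length
        (Finsupp.single (⟨w, rfl, hw⟩ : BarTuple G w.length) 1)) = chn k w 1 := by
  refine (DirectSum.lmap_lof (tateIncl k G) (Int.negSucc w.length) _).trans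
    ((congrArg (inH k (HochCochain k G) (HochChain k G) w.length)
      (?_ : _ = chainAt k w.length w (gp k w.prod⁻¹))).trans ?_)
  · exact (Finsupp.linearCombination_single k _ _).trans (one_smul _ _)
  · rw [chn_apply, one_mul]

/-- The vanishing of degenerate tuples makes this true without a condition on the letters of `w`. -/
lemma tateInclTotal_tupleAt {s : ℕ} {w : List G} (hs : w.length = s) :
    tateInclTotal k G (inH k (GrpCochain k G) (GrpChain k G) s (tupleAt k s w)) = chn k w 1 := by
  subst hs
  by_cases hw : ∀ g ∈ w, g ≠ 1
  · rw [tupleAt, dif_pos ⟨rfl, hw⟩]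
    exact tateInclTotal_inH hw
  · rw [tupleAt, dif_neg fun h => hw h.2, map_zero, map_zero, chn_of_mem, LinearMap.zero_apply]
    simpa using hw

end TateGroup

section TateGroup

variable {k : Type*} [Field k] {G : Type*} [CommGroup G]

lemma coch_ext {n : ℕ} {f f' : List G → MonoidAlgebra k G}
    (h : ∀ l : BarTuple G n, f l.1 = f' l.1) : coch k f n = coch k f' n :=
  congrArg (inC k (HochCochain k G) (HochChain k G) n) (funext fun l => by rw [h])

lemma coch_mem_range {n : ℕ} {f : List G → MonoidAlgebra k G}
    (hf : ∀ l, f l ∈ (⊥ : Subalgebra k (MonoidAlgebra k G))) :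
    coch k f n ∈ LinearMap.range (tateInclTotal k G) := by
  choose c hc using fun l => Algebra.mem_bot.1 (hf l)
  refine ⟨inC k _ (GrpChain k G) n fun l => c l.1, ?_⟩
  rw [tateInclTotal_inC]
  refine coch_ext fun l => ?_
  rw [scalarFun, evalAt_apply, ← hc, Algebra.algebraMap_eq_smul_one]

lemma chn_mem_range (w : List G) {ρ : MonoidAlgebra k G}
    (hρ : ρ ∈ (⊥ : Subalgebra k (MonoidAlgebra k G))) :
    chn k w ρ ∈ LinearMap.range (tateInclTotal k G) := by
  obtain ⟨c, rfl⟩ := Algebra.mem_bot.1 hρ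
  rw [Algebra.algebraMap_eq_smul_one, map_smul]
  exact Submodule.smul_mem _ _ ⟨_, tateInclTotal_tupleAt rfl⟩

lemma scalarFun_mem_bot {n : ℕ} (φ : GrpCochain k G n) (l : List G) :
    scalarFun φ l ∈ (⊥ : Subalgebra k (MonoidAlgebra k G)) :=
  Subalgebra.smul_mem _ (one_mem _) _

/-- The embedded Tate complex is spanned by the cochains with values in `k`, in twisted
coordinates, and by the chains with coefficient `1`. -/
lemma apply_tateInclTotal_mem {X : Type*} [AddCommGroup X] [Module k X]
    (L : (⨁ i, TateHoch k G i) →ₗ[k] X) (S : Submodule k X)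
    (hC : ∀ (n : ℕ) (f : List G → MonoidAlgebra k G), IsCoch n f →
      (∀ l, f l ∈ (⊥ : Subalgebra k (MonoidAlgebra k G))) → L (coch k f n) ∈ S)
    (hH : ∀ w : List G, L (chn k w 1) ∈ S) (x : ⨁ i, TateGrp k G i) :
    L (tateInclTotal k G x) ∈ S := by
  have : S.mkQ ∘ₗ L ∘ₗ tateInclTotal k G = 0 := by
    refine linearMap_ext_tateGrp (fun n φ => ?_) fun w hw => ?_
    · rw [LinearMap.zero_apply, LinearMap.comp_apply, LinearMap.comp_apply, tateInclTotal_inC]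
      exact (Submodule.Quotient.mk_eq_zero S).2
        (hC n _ (isCoch_scalarFun φ) (scalarFun_mem_bot φ))
    · rw [LinearMap.zero_apply, LinearMap.comp_apply, LinearMap.comp_apply, tateInclTotal_inH hw]
      exact (Submodule.Quotient.mk_eq_zero S).2 (hH w)
  exact (Submodule.Quotient.mk_eq_zero S).1 (LinearMap.congr_fun this x)

lemma tateInclTotal_grpDel {w : List G} {s : ℕ} (hs : w.length = s + 1) (hw : ∀ g ∈ w, g ≠ 1) :
    tateInclTotal k G (inH k (GrpCochain k G) (GrpChain k G) s (grpDel k G s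
      (Finsupp.single (⟨w, hs, hw⟩ : BarTuple G (s + 1)) 1))) =
      barDelta (fun l => chn k l 1) w := by
  have h : grpDel k G s (Finsupp.single (⟨w, hs, hw⟩ : BarTuple G (s + 1)) 1) =
      tupleAt k s (w.drop 1) + ∑ i ∈ Finset.Icc 1 s, (-1 : k) ^ i • tupleAt k s (contract i w)
        + (-1 : k) ^ (s + 1) • tupleAt k s (w.take s) :=
    (Finsupp.linearCombination_single k _ _).trans (one_smul _ _)
  rw [h, barDelta_eq_sum _ hs]
  simp only [map_add, map_sum, neg_one_pow_smul_eq_sg, map_zsmul]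
  rw [tateInclTotal_tupleAt (by simp [hs]), tateInclTotal_tupleAt (by simp [hs])]
  push_cast
  refine congrArg₂ (· + ·) (congrArg₂ (· + ·) rfl (Finset.sum_congr rfl fun i hi => ?_)) rfl
  rw [Finset.mem_Icc] at hi
  rw [tateInclTotal_tupleAt (length_contract hi.1 hi.2 hs)]

lemma grpDelta_apply {n : ℕ} (φ : GrpCochain k G n) (l : BarTuple G (n + 1)) :
    grpDelta k G n φ l = barDelta (fun l => evalAt k l φ) l.1 := by
  rw [barDelta_eq_sum _ l.2.1]
  simp only [← neg_one_pow_smul_eq_sg (k := k)]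
  simp [grpDelta]

variable (k G) in
/-- The projection of the Tate-Hochschild complex to the Tate complex, on the total spaces. -/
def tateProjTotal : (⨁ i, TateHoch k G i) →ₗ[k] ⨁ i, TateGrp k G i :=
  DirectSum.lmap (tateProj k G)

lemma tateProjTotal_coch (n : ℕ) (f : List G → MonoidAlgebra k G) :
    tateProjTotal k G (coch k f n) = inC k (GrpCochain k G) (GrpChain k G) n
      (fun l => coeffAt k G 1 (f l.1)) := by
  refine (DirectSum.lmap_lof (tateProj k G) (Int.ofNat n) _).trans
    (congrArg (inC k (GrpCochain k G) (GrpChain k G) n) ?_)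
  funext l
  refine (coeffAt_one_mul_gp (f l.1 * gp k l.1.prod) l.1.prod).symm.trans ?_
  rw [mul_assoc, gp_mul_inv, mul_one]

open Classical in
/-- The projection keeps the basis chains `(ρ (g₁⋯g_n)⁻¹, g₁, …, g_n)` with `ρ = 1`. -/
lemma tateProjTotal_chn_gp {w : List G} (hw : ∀ g ∈ w, g ≠ 1) (r : G) :
    tateProjTotal k G (chn k w (gp k r)) = inH k (GrpCochain k G) (GrpChain k G) w.length
        (if r = 1 then Finsupp.single (⟨w, rfl, hw⟩ : BarTuple G w.length) 1 else 0) := by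
  have h : r * w.prod⁻¹ * w.prod = r := inv_mul_cancel_right r w.prod
  conv_rhs => rw [← h]
  rw [chn_gp hw]
  refine (DirectSum.lmap_lof (tateProj k G) (Int.negSucc w.length) _).trans
    (congrArg (inH k (GrpCochain k G) (GrpChain k G) w.length) ?_)
  exact (Finsupp.linearCombination_single k _ _).trans (one_smul _ _)

lemma tateInclTotal_tateProjTotal_coch (n : ℕ) (f : List G → MonoidAlgebra k G) :
    tateInclTotal k G (tateProjTotal k G (coch k f n)) =
      coch k (fun l => coeffAt k G 1 (f l) • 1) n := by
  rw [tateProjTotal_coch, tateInclTotal_inC]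
  refine coch_ext fun l => ?_
  rw [scalarFun, evalAt_apply]

lemma tateInclTotal_tateProjTotal_chn (w : List G) (ρ : MonoidAlgebra k G) :
    tateInclTotal k G (tateProjTotal k G (chn k w ρ)) = chn k w (coeffAt k G 1 ρ • 1) := by
  by_cases hw : (1 : G) ∈ w
  · simp [chn_of_mem hw]
  replace hw : ∀ g ∈ w, g ≠ 1 := fun g hg e => hw (e ▸ hg)
  induction ρ using monoidAlgebra_induction with
  | add x y hx hy => rw [map_add, map_add, map_add, map_add, add_smul, map_add, hx, hy]
  | smul c x hx =>
    rw [map_smul, map_smul, map_smul, LinearMap.map_smul (coeffAt k G 1), smul_assoc,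
      LinearMap.map_smul (chn k w), hx]
  | gp r =>
    rw [tateProjTotal_chn_gp hw]
    by_cases e : r = 1
    · rw [if_pos e, tateInclTotal_inH hw]
      simp [coeffAt, e]
    · rw [if_neg e, map_zero, map_zero]
      simp [coeffAt, e]

lemma coeffAt_one_of_mem_bot {x : MonoidAlgebra k G}
    (hx : x ∈ (⊥ : Subalgebra k (MonoidAlgebra k G))) : coeffAt k G 1 x • 1 = x := by
  obtain ⟨c, rfl⟩ := Algebra.mem_bot.1 hx
  rw [Algebra.algebraMap_eq_smul_one, map_smul, smul_assoc]
  simp [coeffAt, ← gp_one]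

lemma tateProjTotal_tateInclTotal (x : ⨁ i, TateGrp k G i) :
    tateProjTotal k G (tateInclTotal k G x) = x := by
  refine LinearMap.congr_fun (f := tateProjTotal k G ∘ₗ tateInclTotal k G) (g := LinearMap.id)
    (linearMap_ext_tateGrp (fun n φ => ?_) fun w hw => ?_) x
  · rw [LinearMap.comp_apply, LinearMap.id_apply, tateInclTotal_inC, tateProjTotal_coch]
    refine congrArg _ (funext fun l => ?_)
    rw [scalarFun, evalAt_apply, map_smul]
    simp [coeffAt, ← gp_one]
  · rw [LinearMap.comp_apply, LinearMap.id_apply, tateInclTotal_inH hw, ← gp_one,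
      tateProjTotal_chn_gp hw, if_pos rfl]

lemma tateIncl_injective (i : ℤ) : Function.Injective (tateIncl k G i) :=
  Function.LeftInverse.injective (g := tateProj k G i)
    (leftInverse_of_lmap tateProjTotal_tateInclTotal i)

/-! ### The action of the group algebra -/

/-- The action of `kG` on `D^*(kG, kG)`, in each degree: on the values of cochains and on the
coefficients of chains. -/
def actDeg (a : MonoidAlgebra k G) : ∀ i, TateHoch k G i →ₗ[k] TateHoch k G i
  | .ofNat n => ((LinearMap.mulLeft k a).compLeft (BarTuple G n) :
        HochCochain k G n →ₗ[k] HochCochain k G n)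
  | .negSucc s => (Finsupp.linearCombination k fun x => chainAt k s x.2.1 (a * gp k x.1) :
        HochChain k G s →ₗ[k] HochChain k G s)

/-- The action of `kG` on the total space of `D^*(kG, kG)`. -/
def act (a : MonoidAlgebra k G) : (⨁ i, TateHoch k G i) →ₗ[k] ⨁ i, TateHoch k G i :=
  DirectSum.lmap (actDeg a)

lemma act_coch (a : MonoidAlgebra k G) (n : ℕ) (f : List G → MonoidAlgebra k G) :
    act a (coch k f n) = coch k (fun l => a * f l) n := by
  refine (DirectSum.lmap_lof (actDeg a) (Int.ofNat n) _).trans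
    (congrArg (inC k (HochCochain k G) (HochChain k G) n) (funext fun l => ?_))
  exact (mul_assoc _ _ _).symm

lemma act_chn (a : MonoidAlgebra k G) (w : List G) (ρ : MonoidAlgebra k G) :
    act a (chn k w ρ) = chn k w (a * ρ) := by
  refine eq_of_eq_on_chn w (act a) (fun ρ => chn k w (a * ρ)) ?_ ?_ ?_ ?_ ρ
  · intro x y
    rw [mul_add, map_add]
  · intro c x
    rw [mul_smul_comm, map_smul]
  · intro h ρ
    rw [chn_of_mem h, LinearMap.zero_apply]
  intro hw r
  refine (DirectSum.lmap_lof (actDeg a) (Int.negSucc w.length) _).trans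
    ((congrArg (inH k (HochCochain k G) (HochChain k G) w.length)
      (?_ : _ = chainAt k w.length w (a * gp k (r * w.prod⁻¹)))).trans ?_)
  · exact (Finsupp.linearCombination_single k _ _).trans (one_smul _ _)
  · rw [chn_apply, ← gp_mul, mul_assoc]

lemma IsCoch.act {n : ℕ} {f : List G → MonoidAlgebra k G} (hf : IsCoch n f)
    (a : MonoidAlgebra k G) : IsCoch n fun l => a * f l :=
  fun l hl => hf l (right_ne_zero_of_mul hl)

lemma act_act (a b : MonoidAlgebra k G) (x : ⨁ i, TateHoch k G i) :
    act a (act b x) = act (a * b) x := by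
  refine LinearMap.congr_fun (f := act a ∘ₗ act b) (linearMap_ext_gen fun d x hx => ?_) x
  cases hx with
  | coch n f hf => simp [act_coch, mul_assoc]
  | chn w ρ => simp [act_chn, mul_assoc]

end TateGroup

lemma splitSum_mem {α M S : Type*} [AddCommMonoid M] [SetLike S M] [AddSubmonoidClass S M] {s : S}
    {w : List α} {F : List α → List α → M} (h : ∀ a b, F a b ∈ s) : splitSum w F ∈ s :=
  sum_mem fun _ _ => h _ _

lemma crossSum_mem {G M S : Type*} [Fintype G] [AddCommGroup M] [SetLike S M]
    [AddSubmonoidClass S M] {s : S}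
    {v w : List G} {F : List G → List G → List G → List G → G → M}
    (h : ∀ a b c d g, F a b c d g ∈ s) : crossSum v w F ∈ s :=
  splitSum_mem fun _ _ => splitSum_mem fun _ _ => sum_mem fun _ _ => h _ _ _ _ _

section TateGroupCyclic

variable {k : Type*} [Field k] {G : Type*} [CommGroup G]

/-- The form of an element of the Tate complex with an element of the Tate-Hochschild complex
depends only on the projection of the latter. -/
lemma tatePair_tateInclTotal (x : ⨁ i, TateGrp k G i) (y : ⨁ i, TateHoch k G i) :
    tatePair k G (tateInclTotal k G x) y =
      tatePair k G (tateInclTotal k G x) (tateInclTotal k G (tateProjTotal k G y)) := by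
  refine sub_eq_zero.1 ?_
  refine apply_tateInclTotal_mem ((tatePair k G).flip y -
    (tatePair k G).flip (tateInclTotal k G (tateProjTotal k G y))) ⊥
    (fun n f hf hs => ?_) (fun w => ?_) x
  · refine LinearMap.congr_fun (f := tatePair k G (coch k f n) -
      tatePair k G (coch k f n) ∘ₗ tateInclTotal k G ∘ₗ tateProjTotal k G) (g := 0)
      (linearMap_ext_gen fun d y hy => ?_) y
    simp only [LinearMap.sub_apply, LinearMap.comp_apply, LinearMap.zero_apply]
    cases hy with
    | coch m h hh => rw [tateInclTotal_tateProjTotal_coch]; simp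
    | chn w ρ =>
      rw [tateInclTotal_tateProjTotal_chn, tatePair_coch_chn hf, tatePair_coch_chn hf,
        ← coeffAt_one_of_mem_bot (hs w)]
      simp [coeffAt, ← gp_one]
  · refine LinearMap.congr_fun (f := tatePair k G (chn k w 1) -
      tatePair k G (chn k w 1) ∘ₗ tateInclTotal k G ∘ₗ tateProjTotal k G) (g := 0)
      (linearMap_ext_gen fun d y hy => ?_) y
    simp only [LinearMap.sub_apply, LinearMap.comp_apply, LinearMap.zero_apply]
    cases hy with
    | coch m h hh =>
      have h' : IsCoch m fun l => coeffAt k G 1 (h l) • (1 : MonoidAlgebra k G) :=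
        fun l hl => hh l fun e => hl (by simp [e])
      rw [tateInclTotal_tateProjTotal_coch, tatePair_chn_coch hh, tatePair_chn_coch h']
      simp [coeffAt, ← gp_one]
    | chn v ρ => rw [tateInclTotal_tateProjTotal_chn]; simp

lemma tateInclTotal_tateProjTotal_of_mem {z : ⨁ i, TateHoch k G i}
    (hz : z ∈ LinearMap.range (tateInclTotal k G)) :
    tateInclTotal k G (tateProjTotal k G z) = z := by
  obtain ⟨x, rfl⟩ := hz
  rw [tateProjTotal_tateInclTotal]

variable [Fintype G]

lemma tateGroup_pair_nondegenerate : (tateGroup k G).pair.Nondegenerate := by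
  have key : ∀ x : ⨁ i, TateGrp k G i,
      (∀ y, tatePair k G (tateInclTotal k G x) (tateInclTotal k G y) = 0) → x = 0 := by
    intro x h
    have : tateInclTotal k G x = 0 := tatePair_nondegenerate.1 _ fun y => by
      rw [tatePair_tateInclTotal, h]
    rw [← tateProjTotal_tateInclTotal x, this, map_zero]
  refine ⟨fun x h => key x h, fun y h => key y fun x => ?_⟩
  rw [tatePair_symm]
  exact h x

lemma tateGroup_m_add_two (p : ℕ) (x : Fin (p + 2) → ⨁ i, TateGrp k G i) :
    (tateGroup k G).m (p + 2) x = tateProjTotal k G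
      ((tateHochschild k G).m (p + 2) fun i => tateInclTotal k G (x i)) := rfl

lemma tateInclTotal_differential (x : ⨁ i, TateGrp k G i) :
    tateInclTotal k G (splicedDifferential (grpDelta k G) (grpNorm k G) (grpDel k G) x) =
      tateDiff k G (tateInclTotal k G x) := by
  refine LinearMap.congr_fun (f := tateInclTotal k G ∘ₗ
    splicedDifferential (grpDelta k G) (grpNorm k G) (grpDel k G))
    (g := tateDiff k G ∘ₗ tateInclTotal k G)
    (linearMap_ext_tateGrp (fun n φ => ?_) fun w hw => ?_) x
  · rw [LinearMap.comp_apply, LinearMap.comp_apply, tateInclTotal_inC,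
      tateDiff_coch (isCoch_scalarFun φ)]
    refine (congrArg (tateInclTotal k G) (extend₁_lof (V := TateGrp k G) _ (Int.ofNat n) φ)).trans
      ((tateInclTotal_inC (grpDelta k G n φ)).trans (coch_ext fun l => ?_))
    rw [scalarFun, evalAt_apply, grpDelta_apply]
    exact map_barDelta (LinearMap.toSpanSingleton k (MonoidAlgebra k G) 1)
      (fun l => evalAt k l φ) l.1
  · rw [LinearMap.comp_apply, LinearMap.comp_apply, tateInclTotal_inH hw, tateDiff_chn]
    cases w with
    | nil =>
      rw [barDelta_nil, smul_zero, zero_add]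
      refine (congrArg (tateInclTotal k G)
        (extend₁_lof (V := TateGrp k G) _ (Int.negSucc 0) _)).trans
        ((tateInclTotal_inC (grpNorm k G _)).trans (coch_ext fun l => ?_))
      have hl : l.1 = [] := List.length_eq_zero_iff.1 l.2.1
      have h1 : grpNorm k G (Finsupp.single (⟨[], rfl, hw⟩ : BarTuple G 0) 1) l =
          (Fintype.card G : k) :=
        congrFun ((Finsupp.linearCombination_single k _ _).trans (one_smul _ _)) l
      rw [scalarFun, evalAt_apply, normFun, if_pos ⟨hl, rfl⟩]
      refine (congrArg (· • (1 : MonoidAlgebra k G)) h1).trans ?_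
      exact Nat.cast_smul_eq_nsmul k _ _
    | cons a w =>
      have hz : coch k (normFun k G (a :: w) 1) 0 = 0 :=
        coch_eq_zero fun l _ => if_neg (by simp)
      rw [hz, add_zero]
      refine (congrArg (tateInclTotal k G)
        (extend₁_lof (V := TateGrp k G) _ (Int.negSucc (w.length + 1)) _)).trans ?_
      have h := tateInclTotal_grpDel (k := k) (w := a :: w) (s := w.length) rfl hw
      refine (congrArg (tateInclTotal k G) (map_smul (inH k (GrpCochain k G) (GrpChain k G)
        w.length) ((-1 : k) ^ (w.length + 1)) _)).trans ?_
      rw [neg_one_pow_smul_eq_sg, map_zsmul]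
      exact congrArg _ h

lemma tateCup_mem_range (x y : ⨁ i, TateGrp k G i) :
    tateCup k G (tateInclTotal k G x) (tateInclTotal k G y) ∈
      LinearMap.range (tateInclTotal k G) := by
  refine apply_tateInclTotal_mem ((tateCup k G).flip (tateInclTotal k G y)) _
    (fun n f hf hs => ?_) (fun w => ?_) x
  · refine apply_tateInclTotal_mem (tateCup k G (coch k f n)) _
      (fun m h hh ht => ?_) (fun v => ?_) y
    · rw [tateCup_coch_coch hf hh]
      exact coch_mem_range fun l => splitSum_mem fun a b => mul_mem (hs _) (ht _)
    · rw [tateCup_coch_chn hf]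
      refine add_mem (splitSum_mem fun a b => chn_mem_range _ (mul_mem (hs _) (one_mem _)))
        (coch_mem_range fun l => mul_mem (sum_mem fun g _ => hs _) (one_mem _))
  · refine apply_tateInclTotal_mem (tateCup k G (chn k w 1)) _
      (fun m h hh ht => ?_) (fun v => ?_) y
    · rw [tateCup_chn_coch hh]
      refine add_mem (splitSum_mem fun a b => chn_mem_range _ (mul_mem (ht _) (one_mem _)))
        (coch_mem_range fun l => mul_mem (sum_mem fun g _ => ht _) (one_mem _))
    · rw [tateCup_chn_chn]
      exact sum_mem fun g _ => chn_mem_range _ (mul_mem (one_mem _) (one_mem _))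

lemma tateTriple_mem_range (x y z : ⨁ i, TateGrp k G i) :
    tateTriple k G (tateInclTotal k G x) (tateInclTotal k G y) (tateInclTotal k G z) ∈
      LinearMap.range (tateInclTotal k G) := by
  refine apply_tateInclTotal_mem (((tateTriple k G).flip (tateInclTotal k G y)).flip
    (tateInclTotal k G z)) _ (fun n f hf hs => ?_) (fun w => ?_) x
  · refine apply_tateInclTotal_mem ((tateTriple k G (coch k f n)).flip (tateInclTotal k G z)) _
      (fun m h hh ht => ?_) (fun v => ?_) y
    · simp
    · refine apply_tateInclTotal_mem (tateTriple k G (coch k f n) (chn k v 1)) _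
        (fun m h hh ht => ?_) (fun u => ?_) z
      · rw [tateTriple_coch_chn_coch hf hh]
        exact coch_mem_range fun l => neg_mem (mul_mem (crossSum_mem fun a b c d g =>
          zsmul_mem (mul_mem (hs _) (ht _)) _) (one_mem _))
      · simp
  · refine apply_tateInclTotal_mem ((tateTriple k G (chn k w 1)).flip (tateInclTotal k G z)) _
      (fun m h hh ht => ?_) (fun v => ?_) y
    · refine apply_tateInclTotal_mem (tateTriple k G (chn k w 1) (coch k h m)) _
        (fun n f hf hs => ?_) (fun u => ?_) z
      · simp
      · rw [tateTriple_chn_coch_chn hh]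
        exact neg_mem (crossSum_mem fun a b c d g =>
          zsmul_mem (chn_mem_range _ (mul_mem (ht _) (mul_mem (one_mem _) (one_mem _)))) _)
    · simp

theorem tateIncl_isStrictMorphism :
    (tateGroup k G).IsStrictMorphism (tateHochschild k G) (tateIncl k G) where
  map_m p hp x := by
    obtain rfl | h : p = 1 ∨ 2 ≤ p := by omega
    · exact tateInclTotal_differential (x 0)
    · obtain ⟨q, rfl⟩ := Nat.exists_eq_add_of_le' h
      rw [tateGroup_m_add_two]
      refine tateInclTotal_tateProjTotal_of_mem ?_
      rcases le_or_gt 4 (q + 2) with h4 | h4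
      · rw [tateHochschild_m_eq_zero h4]
        exact zero_mem _
      obtain rfl | rfl : q = 0 ∨ q = 1 := by omega
      · exact tateCup_mem_range (x 0) (x 1)
      · exact tateTriple_mem_range (x 0) (x 1) (x 2)
  map_pair _ _ := rfl

theorem tateGroup_isCyclicAInfinity : (tateGroup k G).IsCyclicAInfinity :=
  tateIncl_isStrictMorphism.isCyclicAInfinity tateIncl_injective tateHochschild_isCyclicAInfinity
    tateGroup_pair_nondegenerate

end TateGroupCyclic

/-! ### Equivariance of the operations -/

section Equivariance

variable {k : Type*} [Field k] {G : Type*} [CommGroup G]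

lemma coeffAt_one_one : coeffAt k G 1 (1 : MonoidAlgebra k G) = 1 := by
  simp [coeffAt, ← gp_one]

lemma act_one (x : ⨁ i, TateHoch k G i) : act 1 x = x := by
  refine LinearMap.congr_fun (f := act 1) (g := LinearMap.id)
    (linearMap_ext_gen fun d x hx => ?_) x
  cases hx with
  | coch n f hf => simp [act_coch]
  | chn w ρ => simp [act_chn]

lemma tatePair_act (a b : MonoidAlgebra k G) (x y : ⨁ i, TateGrp k G i) :
    tatePair k G (act a (tateInclTotal k G x)) (act b (tateInclTotal k G y)) =
      symmForm k G a b * tatePair k G (tateInclTotal k G x) (tateInclTotal k G y) := by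
  refine sub_eq_zero.1 ?_
  refine apply_tateInclTotal_mem ((tatePair k G).flip (act b (tateInclTotal k G y)) ∘ₗ act a -
    symmForm k G a b • (tatePair k G).flip (tateInclTotal k G y)) ⊥
    (fun n f hf hs => ?_) (fun w => ?_) x
  · refine apply_tateInclTotal_mem (tatePair k G (act a (coch k f n)) ∘ₗ act b -
      symmForm k G a b • tatePair k G (coch k f n)) ⊥
      (fun m h hh ht => ?_) (fun v => ?_) y
    · simp [act_coch]
    · simp only [LinearMap.sub_apply, LinearMap.comp_apply, LinearMap.smul_apply, act_coch,
        act_chn, tatePair_coch_chn (hf.act a), tatePair_coch_chn hf, Submodule.mem_bot]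
      obtain ⟨c, hc⟩ := Algebra.mem_bot.1 (hs v)
      have e : a * (c • 1) * (b * 1) = c • (a * b) := by simp
      rw [← hc, Algebra.algebraMap_eq_smul_one, e, mul_one, map_smul, map_smul, coeffAt_one_one]
      simp [symmForm, mul_comm]
  · refine apply_tateInclTotal_mem (tatePair k G (act a (chn k w 1)) ∘ₗ act b -
      symmForm k G a b • tatePair k G (chn k w 1)) ⊥
      (fun m h hh ht => ?_) (fun v => ?_) y
    · simp only [LinearMap.sub_apply, LinearMap.comp_apply, LinearMap.smul_apply, act_coch,
        act_chn, tatePair_chn_coch (hh.act b), tatePair_chn_coch hh, Submodule.mem_bot]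
      obtain ⟨c, hc⟩ := Algebra.mem_bot.1 (ht w)
      have e : b * (c • 1) * (a * 1) = c • (a * b) := by simp [mul_comm]
      rw [← hc, Algebra.algebraMap_eq_smul_one, e, mul_one, map_smul, map_smul, coeffAt_one_one]
      simp [symmForm, mul_comm]
    · simp [act_chn]

open Classical in
/-- The translates of the Tate complex by distinct elements of `G` are independent. -/
lemma tateProjTotal_act_tateInclTotal (g : G) (x : ⨁ i, TateGrp k G i) :
    tateProjTotal k G (act (gp k g) (tateInclTotal k G x)) = if g = 1 then x else 0 := by
  by_cases e : g = 1
  · rw [if_pos e, e, gp_one, act_one, tateProjTotal_tateInclTotal]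
  rw [if_neg e, ← tateProjTotal_tateInclTotal (tateProjTotal k G _)]
  have h : ∀ a ∈ (⊥ : Subalgebra k (MonoidAlgebra k G)), coeffAt k G 1 (gp k g * a) = 0 := by
    intro a ha
    rw [← coeffAt_one_of_mem_bot ha]
    simp [coeffAt, e]
  have : tateInclTotal k G (tateProjTotal k G (act (gp k g) (tateInclTotal k G x))) ∈
      (⊥ : Submodule k (⨁ i, TateHoch k G i)) := by
    refine apply_tateInclTotal_mem (tateInclTotal k G ∘ₗ tateProjTotal k G ∘ₗ act (gp k g)) ⊥
      (fun n f hf hs => ?_) (fun w => ?_) x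
    · simp only [LinearMap.comp_apply, act_coch, tateInclTotal_tateProjTotal_coch, h _ (hs _)]
      simp
    · simp only [LinearMap.comp_apply, act_chn, tateInclTotal_tateProjTotal_chn,
        h _ (one_mem _)]
      simp
  rw [(Submodule.mem_bot k).1 this, map_zero]

lemma conv_mul_mul (a b : MonoidAlgebra k G) (f h : List G → MonoidAlgebra k G) (l : List G) :
    conv (fun l => a * f l) (fun l => b * h l) l = a * b * conv f h l := by
  rw [conv, conv, splitSum, splitSum, Finset.mul_sum]
  exact Finset.sum_congr rfl fun i _ => by ring

variable [Fintype G]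

lemma tateDiff_act (a : MonoidAlgebra k G) (x : ⨁ i, TateHoch k G i) :
    tateDiff k G (act a x) = act a (tateDiff k G x) := by
  refine LinearMap.congr_fun (f := tateDiff k G ∘ₗ act a) (g := act a ∘ₗ tateDiff k G)
    (linearMap_ext_gen fun d x hx => ?_) x
  rw [LinearMap.comp_apply, LinearMap.comp_apply]
  cases hx with
  | coch n f hf =>
    rw [act_coch, tateDiff_coch (hf.act a), tateDiff_coch hf, act_coch]
    exact coch_congr fun l _ => barDelta_mul_left f a l
  | chn w ρ =>
    rw [act_chn, tateDiff_chn, tateDiff_chn, map_add, map_zsmul, map_barDelta, act_coch]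
    simp only [act_chn]
    refine congrArg (_ + ·) (coch_congr fun l _ => ?_)
    simp only [normFun]
    split_ifs
    · exact (mul_smul_comm _ _ _).symm
    · rw [mul_zero]

lemma bracket_mul_mul (a b : MonoidAlgebra k G) (f h : List G → MonoidAlgebra k G)
    (w v : List G) :
    bracket (fun l => a * f l) (fun l => b * h l) w v = a * b * bracket f h w v := by
  simp only [bracket, crossSum, splitSum, Finset.mul_sum]
  refine Finset.sum_congr rfl fun i _ => Finset.sum_congr rfl fun j _ =>
    Finset.sum_congr rfl fun g _ => ?_
  rw [mul_smul_comm]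
  congr 1
  ring

lemma tateCup_act (a b : MonoidAlgebra k G) (x y : ⨁ i, TateHoch k G i) :
    tateCup k G (act a x) (act b y) = act (a * b) (tateCup k G x y) := by
  refine LinearMap.congr_fun (f := (tateCup k G).flip (act b y) ∘ₗ act a)
    (g := act (a * b) ∘ₗ (tateCup k G).flip y) (linearMap_ext_gen fun d x hx => ?_) x
  refine LinearMap.congr_fun (f := tateCup k G (act a x) ∘ₗ act b)
    (g := act (a * b) ∘ₗ tateCup k G x) (linearMap_ext_gen fun e y hy => ?_) y
  rw [LinearMap.comp_apply, LinearMap.comp_apply]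
  cases hx with
  | coch n f hf =>
    cases hy with
    | coch m h hh =>
      rw [act_coch, act_coch, tateCup_coch_coch (hf.act a) (hh.act b), tateCup_coch_coch hf hh,
        act_coch]
      exact coch_congr fun l _ => conv_mul_mul a b f h l
    | chn w ρ =>
      rw [act_coch, act_chn, tateCup_coch_chn (hf.act a), tateCup_coch_chn hf, map_add, act_coch,
        map_splitSum]
      simp only [act_chn, ← Finset.mul_sum]
      refine congrArg₂ (· + ·) (splitSum_congr fun u v _ => congrArg _ (by ring))
        (coch_congr fun l _ => by ring)
  | chn w ρ =>
    cases hy with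
    | coch m h hh =>
      rw [act_coch, act_chn, tateCup_chn_coch (hh.act b), tateCup_chn_coch hh, map_add, act_coch,
        map_splitSum]
      simp only [act_chn, ← Finset.mul_sum]
      refine congrArg₂ (· + ·) (splitSum_congr fun u v _ => congrArg _ (by ring))
        (coch_congr fun l _ => by ring)
    | chn v σ =>
      rw [act_chn, act_chn, tateCup_chn_chn, tateCup_chn_chn, map_sum]
      simp only [act_chn]
      exact Finset.sum_congr rfl fun g _ => congrArg _ (by ring)

lemma tateTriple_act (a b c : MonoidAlgebra k G) (x y z : ⨁ i, TateHoch k G i) :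
    tateTriple k G (act a x) (act b y) (act c z) = act (a * b * c) (tateTriple k G x y z) := by
  refine LinearMap.congr_fun (f := ((tateTriple k G).flip (act b y)).flip (act c z) ∘ₗ act a)
    (g := act (a * b * c) ∘ₗ ((tateTriple k G).flip y).flip z)
    (linearMap_ext_gen fun d x hx => ?_) x
  refine LinearMap.congr_fun (f := (tateTriple k G (act a x)).flip (act c z) ∘ₗ act b)
    (g := act (a * b * c) ∘ₗ (tateTriple k G x).flip z) (linearMap_ext_gen fun d y hy => ?_) y
  refine LinearMap.congr_fun (f := tateTriple k G (act a x) (act b y) ∘ₗ act c)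
    (g := act (a * b * c) ∘ₗ tateTriple k G x y) (linearMap_ext_gen fun d z hz => ?_) z
  rw [LinearMap.comp_apply, LinearMap.comp_apply]
  cases hx with
  | coch n f hf =>
    cases hy with
    | coch m h hh => simp [act_coch]
    | chn w ρ =>
      cases hz with
      | coch p e he =>
        rw [act_coch, act_chn, act_coch, tateTriple_coch_chn_coch (hf.act a) (he.act c),
          tateTriple_coch_chn_coch hf he, act_coch]
        refine coch_congr fun l _ => ?_
        rw [bracket_mul_mul]
        ring
      | chn v σ => simp [act_chn]
  | chn w ρ =>
    cases hy with
    | coch m h hh =>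
      cases hz with
      | coch p e he => simp [act_coch]
      | chn v σ =>
        rw [act_chn, act_coch, act_chn, tateTriple_chn_coch_chn (hh.act b),
          tateTriple_chn_coch_chn hh, map_neg, map_crossSum]
        simp only [map_zsmul, act_chn]
        refine congrArg Neg.neg (crossSum_congr fun _ _ _ _ _ _ _ =>
          congrArg (_ • ·) (congrArg _ (by ring)))
    | chn v σ => simp [act_chn]

/-- The higher products are `kG`-multilinear. -/
lemma tateHochschild_m_act {p : ℕ} (hp : 1 ≤ p) (g : Fin p → G) (x : Fin p → ⨁ i, TateHoch k G i) :
    (tateHochschild k G).m p (fun i => act (gp k (g i)) (x i)) =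
      act (gp k (List.ofFn g).prod) ((tateHochschild k G).m p x) := by
  rcases le_or_gt 4 p with h | h
  · rw [tateHochschild_m_eq_zero h]
    simp
  interval_cases p
  · refine (tateDiff_act _ _).trans ?_
    simp [tateHochschild_m_one]
  · refine (tateCup_act _ _ _ _).trans ?_
    simp [tateHochschild_m_two]
  · refine (tateTriple_act _ _ _ _ _ _).trans ?_
    simp [tateHochschild_m_three, mul_assoc]

end Equivariance

/-! ### The isomorphism with the tensor product -/

section Tensor

variable {k : Type*} [Field k] {G : Type*} [CommGroup G] [Fintype G]

lemma lmap_sum {V W : ℤ → Type*} [∀ i, AddCommGroup (V i)] [∀ i, Module k (V i)]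
    [∀ i, AddCommGroup (W i)] [∀ i, Module k (W i)] {α : Type*} (s : Finset α)
    (f : α → ∀ i, V i →ₗ[k] W i) :
    DirectSum.lmap (fun i => ∑ a ∈ s, f a i) = ∑ a ∈ s, DirectSum.lmap (f a) := by
  refine DirectSum.linearMap_ext k fun i => LinearMap.ext fun v => ?_
  simp [LinearMap.sum_apply]

lemma sum_tensorIn_tensorCoeff {V : ℤ → Type*} [∀ i, AddCommGroup (V i)] [∀ i, Module k (V i)]
    (y : ⨁ i, MonoidAlgebra k G ⊗[k] V i) :
    ∑ g : G, tensorIn k G g (tensorCoeff k G g y) = y := by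
  classical
  refine LinearMap.congr_fun (f := ∑ g : G, tensorIn k G g ∘ₗ tensorCoeff k G g)
    (g := LinearMap.id) (DirectSum.linearMap_ext k fun i => TensorProduct.ext' fun a v => ?_) y
      |> fun h => by simpa [LinearMap.sum_apply] using h
  induction a using monoidAlgebra_induction with
  | add x y hx hy => rw [TensorProduct.add_tmul, map_add, map_add, hx, hy]
  | smul c x hx => rw [← TensorProduct.smul_tmul', map_smul, map_smul, hx]
  | gp h =>
    have e : DirectSum.lof k ℤ (fun i => MonoidAlgebra k G ⊗[k] V i) i (gp k h ⊗ₜ[k] v) =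
        tensorIn k G h (DirectSum.lof k ℤ V i v) := by
      simp [tensorIn]
    simp only [LinearMap.comp_apply, LinearMap.id_apply, LinearMap.sum_apply, e,
      tensorCoeff_tensorIn]
    rw [Finset.sum_eq_single h] <;> simp +contextual [eq_comm]

variable (k G) in
/-- The map `kG ⊗ Ĉ → D`, `g ⊗ α ↦ g ι(α)`, in each degree. -/
def tensorToHoch (i : ℤ) : MonoidAlgebra k G ⊗[k] TateGrp k G i →ₗ[k] TateHoch k G i :=
  ∑ g : G, actDeg (gp k g) i ∘ₗ tateIncl k G i ∘ₗ (TensorProduct.lid k _).toLinearMap ∘ₗ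
    (coeffAt k G g).rTensor _

variable (k G) in
/-- The map `D → kG ⊗ Ĉ` with components the projections of `g⁻¹ x`, in each degree. -/
def hochToTensor (i : ℤ) : TateHoch k G i →ₗ[k] MonoidAlgebra k G ⊗[k] TateGrp k G i :=
  ∑ g : G, TensorProduct.mk k (MonoidAlgebra k G) (TateGrp k G i) (gp k g) ∘ₗ tateProj k G i ∘ₗ
    actDeg (gp k g⁻¹) i

lemma lmap_tensorToHoch (y : ⨁ i, MonoidAlgebra k G ⊗[k] TateGrp k G i) :
    DirectSum.lmap (tensorToHoch k G) y =
      ∑ g : G, act (gp k g) (tateInclTotal k G (tensorCoeff k G g y)) := by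
  have := LinearMap.congr_fun (lmap_sum Finset.univ fun (g : G) i => actDeg (gp k g) i ∘ₗ
    tateIncl k G i ∘ₗ (TensorProduct.lid k (TateGrp k G i)).toLinearMap ∘ₗ
      (coeffAt k G g).rTensor _) y
  refine this.trans ?_
  rw [LinearMap.sum_apply]
  refine Finset.sum_congr rfl fun g _ => DFinsupp.ext fun i => ?_
  simp only [act, tateInclTotal, tensorCoeff, DirectSum.lmap_apply, LinearMap.comp_apply]

lemma lmap_hochToTensor (z : ⨁ i, TateHoch k G i) :
    DirectSum.lmap (hochToTensor k G) z =
      ∑ g : G, tensorIn k G g (tateProjTotal k G (act (gp k g⁻¹) z)) := by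
  have := LinearMap.congr_fun (lmap_sum Finset.univ fun (g : G) i =>
    TensorProduct.mk k (MonoidAlgebra k G) (TateGrp k G i) (gp k g) ∘ₗ tateProj k G i ∘ₗ
    actDeg (gp k g⁻¹) i) z
  refine this.trans ?_
  rw [LinearMap.sum_apply]
  refine Finset.sum_congr rfl fun g _ => DFinsupp.ext fun i => ?_
  simp only [act, tateProjTotal, tensorIn, DirectSum.lmap_apply, LinearMap.comp_apply]

lemma tensorCoeff_lmap_hochToTensor (g : G) (z : ⨁ i, TateHoch k G i) :
    tensorCoeff k G g (DirectSum.lmap (hochToTensor k G) z) =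
      tateProjTotal k G (act (gp k g⁻¹) z) := by
  classical
  rw [lmap_hochToTensor, map_sum]
  simp [tensorCoeff_tensorIn]

lemma sum_coeffAt_smul_gp (x : MonoidAlgebra k G) :
    ∑ g : G, gp k g * (coeffAt k G 1 (gp k g⁻¹ * x) • 1) = x := by
  simp only [mul_comm (gp k _⁻¹) x, coeffAt_one_mul_gp, mul_smul_comm, mul_one]
  induction x using monoidAlgebra_induction with
  | add x y hx hy => simp only [map_add, add_smul, Finset.sum_add_distrib, hx, hy]
  | smul c x hx =>
    simp only [LinearMap.map_smul (coeffAt k G _), smul_assoc, ← Finset.smul_sum, hx]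
  | gp h =>
    rw [Finset.sum_eq_single h]
    · simp [coeffAt]
    · intro g _ hg
      simp [coeffAt, hg.symm]
    · simp

/-- `D` is the sum of the translates of the image of the Tate complex. -/
lemma sum_act_tateInclTotal (z : ⨁ i, TateHoch k G i) :
    ∑ g : G, act (gp k g) (tateInclTotal k G (tateProjTotal k G (act (gp k g⁻¹) z))) = z := by
  refine LinearMap.congr_fun (f := ∑ g : G, act (gp k g) ∘ₗ tateInclTotal k G ∘ₗ
    tateProjTotal k G ∘ₗ act (gp k g⁻¹)) (g := LinearMap.id)
    (linearMap_ext_gen fun d z hz => ?_) z |> fun h => by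
      simpa [LinearMap.sum_apply] using h
  simp only [LinearMap.sum_apply, LinearMap.comp_apply, LinearMap.id_apply]
  cases hz with
  | coch n f hf =>
    simp only [act_coch, tateInclTotal_tateProjTotal_coch, ← coch_sum]
    exact coch_congr fun l _ => sum_coeffAt_smul_gp (f l)
  | chn w ρ =>
    simp only [act_chn, tateInclTotal_tateProjTotal_chn, ← map_sum, sum_coeffAt_smul_gp]

lemma lmap_tensorToHoch_lmap_hochToTensor (z : ⨁ i, TateHoch k G i) :
    DirectSum.lmap (tensorToHoch k G) (DirectSum.lmap (hochToTensor k G) z) = z := by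
  simp only [lmap_tensorToHoch, tensorCoeff_lmap_hochToTensor, sum_act_tateInclTotal]

lemma lmap_hochToTensor_lmap_tensorToHoch (y : ⨁ i, MonoidAlgebra k G ⊗[k] TateGrp k G i) :
    DirectSum.lmap (hochToTensor k G) (DirectSum.lmap (tensorToHoch k G) y) = y := by
  classical
  conv_rhs => rw [← sum_tensorIn_tensorCoeff y]
  rw [lmap_hochToTensor]
  refine Finset.sum_congr rfl fun g _ => congrArg _ ?_
  rw [lmap_tensorToHoch, map_sum, map_sum, Finset.sum_eq_single g]
  · rw [act_act, gp_mul, tateProjTotal_act_tateInclTotal, if_pos (inv_mul_cancel g)]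
  · intro h _ hg
    rw [act_act, gp_mul, tateProjTotal_act_tateInclTotal,
      if_neg fun e => hg (inv_mul_eq_one.1 e).symm]
  · simp

variable (k G) in
/-- The isomorphism `D ≅ kG ⊗ Ĉ` of graded vector spaces. -/
def hochEquivTensor (i : ℤ) : TateHoch k G i ≃ₗ[k] MonoidAlgebra k G ⊗[k] TateGrp k G i where
  __ := hochToTensor k G i
  invFun := tensorToHoch k G i
  left_inv := leftInverse_of_lmap lmap_tensorToHoch_lmap_hochToTensor i
  right_inv := leftInverse_of_lmap lmap_hochToTensor_lmap_tensorToHoch i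

theorem tensorToHoch_isStrictMorphism :
    (groupTensor k G (tateGroup k G)).IsStrictMorphism (tateHochschild k G)
      (tensorToHoch k G) where
  map_m p hp y := by
    have h1 : ∀ (g : G) (x : ⨁ i, TateGrp k G i),
        DirectSum.lmap (tensorToHoch k G) (tensorIn k G g x) =
          act (gp k g) (tateInclTotal k G x) := by
      classical
      intro g x
      simp only [lmap_tensorToHoch, tensorCoeff_tensorIn]
      rw [Finset.sum_eq_single g] <;> simp +contextual [eq_comm]
    conv_rhs => simp only [lmap_tensorToHoch]
    -- Both sides are sums over all `p`-tuples of elements of `G`.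
    rw [MultilinearMap.map_sum]
    simp only [groupTensor, _root_.sum_apply, LinearMap.compMultilinearMap_apply,
      MultilinearMap.compLinearMap_apply, map_sum, h1]
    refine Finset.sum_congr rfl fun g _ => ?_
    rw [tateHochschild_m_act hp]
    exact congrArg _ (tateIncl_isStrictMorphism.map_m p hp _)
  map_pair x y := by
    rw [lmap_tensorToHoch, lmap_tensorToHoch]
    refine (?_ : tatePair k G _ _ = _)
    simp only [groupTensor, map_sum, LinearMap.sum_apply, LinearMap.smul_apply,
      LinearMap.compl₁₂_apply, tatePair_act]
    rw [Finset.sum_comm]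
    rfl

lemma groupTensor_pair_nondegenerate :
    (groupTensor k G (tateGroup k G)).pair.Nondegenerate := by
  have hi : Function.Injective (DirectSum.lmap (tensorToHoch k G)) :=
    Function.LeftInverse.injective lmap_hochToTensor_lmap_tensorToHoch
  have hp := (tensorToHoch_isStrictMorphism (k := k) (G := G)).map_pair
  refine ⟨fun x h => hi ?_, fun y h => hi ?_⟩
  · rw [map_zero]
    refine tatePair_nondegenerate.1 _ fun z => ?_
    rw [← lmap_tensorToHoch_lmap_hochToTensor z]
    exact (hp _ _).trans (h _)
  · rw [map_zero]
    refine tatePair_nondegenerate.2 _ fun z => ?_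
    rw [← lmap_tensorToHoch_lmap_hochToTensor z]
    exact (hp _ _).trans (h _)

theorem groupTensor_isCyclicAInfinity :
    (groupTensor k G (tateGroup k G)).IsCyclicAInfinity :=
  tensorToHoch_isStrictMorphism.isCyclicAInfinity (fun i => (hochEquivTensor k G i).symm.injective)
    tateHochschild_isCyclicAInfinity groupTensor_pair_nondegenerate

variable (k G) in
/-- The isomorphism `D ≅ kG ⊗ Ĉ` of cyclic A-infinity-algebras. -/
def hochCyclicIso : (tateHochschild k G).CyclicIso (groupTensor k G (tateGroup k G)) where
  equiv := hochEquivTensor k G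
  isStrictMorphism := AInfData.IsStrictMorphism.of_symm tensorToHoch_isStrictMorphism

end Tensor

end

theorem corollary4p8 (k : Type*) [Field k] (G : Type*) [CommGroup G] [Fintype G] :
    (tateHochschild k G).IsCyclicAInfinity ∧
    (tateGroup k G).IsCyclicAInfinity ∧
    (∀ i, Function.Injective (tateIncl k G i)) ∧
    (tateGroup k G).IsStrictMorphism (tateHochschild k G) (tateIncl k G) ∧
    (groupTensor k G (tateGroup k G)).IsCyclicAInfinity ∧
    Nonempty ((tateHochschild k G).CyclicIso (groupTensor k G (tateGroup k G))) :=
  ⟨tateHochschild_isCyclicAInfinity, tateGroup_isCyclicAInfinity, tateIncl_injective,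
    tateIncl_isStrictMorphism, groupTensor_isCyclicAInfinity, ⟨hochCyclicIso k G⟩⟩
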